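/- **Proposition 8.1.** Let $\Bbbk$ be an algebraically closed field and let $A$ be a connected, basic, finite-dimensional associative unital $\Bbbk$-algebra. Let $\mathcal{C}$ be a small $\Bbbk$-linear category with a $\Bbbk$-linear equivalence to the category $A\text{-mod}$ of finite-dimensional left $A$-modules. Let $\mathscr{C}_A$ be the $2$-category with one object $\mathtt{i}$ (identified with $\mathcal{C}$), whose $1$-morphisms are all endofunctors of $\mathcal{C}$ isomorphic (under the equivalence) to tensoring with $A$-$A$-bimodules in $\mathrm{add}\big(A\oplus(A\otimes_{\Bbbk}A)\big)$, and whose $2$-morphisms are all natural transformations of functors. For $1$-morphisms $F,G$ write $F\geq_L G$ if $F$ is isomorphic to a direct summand of $H\circ G$ for some $1$-morphism $H$, and $F\geq_J G$ if $F$ is isomorphic to a direct summand of $H\circ G\circ K$ for some $1$-morphisms $H,K$. The left cells and the two-sided cells are the equivalence classes of indecomposable $1$-morphisms for the preorders $\geq_L$ and $\geq_J$, respectively. Let $\mathcal{J}'$ be a two-sided cell of $\mathscr{C}_A$ which does not contain the identity $1$-morphism, and let $\mathcal{L}'$ be a left cell contained in $\mathcal{J}'$. Let $\mathbf{P}_{\mathtt{i}}=\mathscr{C}_A(\mathtt{i},{}_-)$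 be the principal $2$-representation (on which $\mathscr{C}_A$ acts by composition on the left), and consider its subrepresentation given by the additive closure of all $1$-morphisms $F$ with $F\geq_L\mathcal{L}'$, that is, $F\geq_L G$ for some $G\in\mathcal{L}'$. The cell $2$-representation $\mathbf{C}_{\mathcal{L}'}$ is the unique simple transitive quotient of this subrepresentation, i.e. its quotient by the unique maximal proper $\Bbbk$-linear ideal which is stable under the action of $\mathscr{C}_A$ (the sum of all proper stable ideals). Let $\mathbf{N}$ be the $2$-representation of $\mathscr{C}_A$ given by the natural action of $\mathscr{C}_A$ on the additive category of all projective objects of $\mathcal{C}$. Then $\mathbf{C}_{\mathcal{L}'}$ and $\mathbf{N}$ are equivalent as $2$-representations of $\mathscr{C}_A$: there is a strong ($2$-natural up to coherent isomorphism) transformation $\mathbf{C}_{\mathcal{L}'}\to\mathbf{N}$ whose component at $\mathtt{i}$ is a $\Bbbk$-linear equivalence of categories. -/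

import Mathlib

open CategoryTheory Bicategory
open scoped TensorProduct

universe w₁ v₁ u₁ v' u' w v u

noncomputable section

/-! ### Linear bicategories and their 2-representations -/

section General

variable (k : Type v) [Field k]

/-- A bicategory whose categories of `1`-morphisms are `k`-linear is called `k`-linear if
horizontal composition is `k`-bilinear on `2`-morphisms. -/
class IsLinearBicategory (B : Type u₁) [Bicategory.{w₁, v₁} B]
    [∀ a b : B, Preadditive (a ⟶ b)] [∀ a b : B, Linear k (a ⟶ b)] : Prop where
  whiskerLeft_add {a b c : B} (f : a ⟶ b) {g h : b ⟶ c} (η θ : g ⟶ h) :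
    f ◁ (η + θ) = f ◁ η + f ◁ θ
  add_whiskerRight {a b c : B} {f g : a ⟶ b} (η θ : f ⟶ g) (h : b ⟶ c) :
    (η + θ) ▷ h = η ▷ h + θ ▷ h
  whiskerLeft_smul {a b c : B} (f : a ⟶ b) {g h : b ⟶ c} (r : k) (η : g ⟶ h) :
    f ◁ (r • η) = r • (f ◁ η)
  smul_whiskerRight {a b c : B} {f g : a ⟶ b} (r : k) (η : f ⟶ g) (h : b ⟶ c) :
    (r • η) ▷ h = r • (η ▷ h)

variable (B : Type u₁) [Bicategory.{w₁, v₁} B]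
  [∀ a b : B, Preadditive (a ⟶ b)] [∀ a b : B, Linear k (a ⟶ b)]

/-- `k`-linear `2`-representations -/
structure TwoRep where
  /-- the underlying (pseudo)functor of bicategories -/
  toPseudofunctor : B ⥤ᵖ Cat.{v', u'}
  [preadditive : ∀ i : B, Preadditive (toPseudofunctor.obj i)]
  [linear : ∀ i : B, Linear k (toPseudofunctor.obj i)]
  [map_additive : ∀ {i j : B} (F : i ⟶ j), (toPseudofunctor.map F).toFunctor.Additive]
  [map_linear : ∀ {i j : B} (F : i ⟶ j), (toPseudofunctor.map F).toFunctor.Linear k]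
  map₂_add : ∀ {i j : B} {F G : i ⟶ j} (η θ : F ⟶ G) (X : toPseudofunctor.obj i),
    (toPseudofunctor.map₂ (η + θ)).toNatTrans.app X =
      (toPseudofunctor.map₂ η).toNatTrans.app X + (toPseudofunctor.map₂ θ).toNatTrans.app X
  map₂_smul : ∀ {i j : B} {F G : i ⟶ j} (r : k) (η : F ⟶ G) (X : toPseudofunctor.obj i),
    (toPseudofunctor.map₂ (r • η)).toNatTrans.app X =
      r • (toPseudofunctor.map₂ η).toNatTrans.app X

namespace TwoRep

attribute [instance] preadditive linear map_additive map_linear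

variable {k B}

/-- The category `M(i)`. -/
abbrev obj (M : TwoRep.{w₁, v₁, u₁, v', u'} k B) (i : B) : Type u' := M.toPseudofunctor.obj i

/-- The functor `M(F)`. -/
abbrev act (M : TwoRep.{w₁, v₁, u₁, v', u'} k B) {i j : B} (F : i ⟶ j) : M.obj i ⥤ M.obj j :=
  (M.toPseudofunctor.map F).toFunctor

/-- Two `2`-representations are equivalent if there is a strong transformation between them all of
whose components are (`k`-linear) equivalences of categories. -/
def Equivalent (M N : TwoRep.{w₁, v₁, u₁, v', u'} k B) : Prop :=
  ∃ Φ : M.toPseudofunctor.StrongTrans N.toPseudofunctor, ∀ i : B,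
    ∃ _ : (Φ.app i).toFunctor.Additive,
      (Φ.app i).toFunctor.Linear k ∧ (Φ.app i).toFunctor.IsEquivalence

/-- The pseudofunctor underlying the restriction of a `2`-representation. -/
def restrictPseudofunctor (M : TwoRep.{w₁, v₁, u₁, v', u'} k B)
    (P : ∀ i : B, ObjectProperty (M.obj i))
    (hP : ∀ {i j : B} (F : i ⟶ j) (X : M.obj i), P i X → P j ((M.act F).obj X)) :
    B ⥤ᵖ Cat.{v', u'} where
  obj i := Cat.of (P i).FullSubcategory
  map {_ j} F := ((P j).lift ((P _).ι ⋙ M.act F) fun X => hP F X.obj X.property).toCatHom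
  map₂ η := NatTrans.toCatHom₂
    { app X := ObjectProperty.homMk ((M.toPseudofunctor.map₂ η).toNatTrans.app X.obj)
      naturality X Y f := by
        apply ObjectProperty.hom_ext
        exact (M.toPseudofunctor.map₂ η).toNatTrans.naturality f.hom }
  map₂_id F := by
    apply Cat.Hom₂.ext
    apply NatTrans.ext
    funext X
    apply ObjectProperty.hom_ext
    exact congrArg (fun t => t.toNatTrans.app X.obj) (M.toPseudofunctor.map₂_id F)
  map₂_comp η θ := by
    apply Cat.Hom₂.ext
    apply NatTrans.ext
    funext X
    apply ObjectProperty.hom_ext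
    exact congrArg (fun t => t.toNatTrans.app X.obj) (M.toPseudofunctor.map₂_comp η θ)
  mapId i := Cat.Hom.isoMk (NatIso.ofComponents
    (fun X => (P i).isoMk ((Cat.Hom.toNatIso (M.toPseudofunctor.mapId i)).app X.obj))
    fun {X Y} f => by
      apply ObjectProperty.hom_ext
      exact (Cat.Hom.toNatIso (M.toPseudofunctor.mapId i)).hom.naturality f.hom)
  mapComp F G := Cat.Hom.isoMk (NatIso.ofComponents
    (fun X => (P _).isoMk ((Cat.Hom.toNatIso (M.toPseudofunctor.mapComp F G)).app X.obj))
    fun {X Y} f => by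
      apply ObjectProperty.hom_ext
      exact (Cat.Hom.toNatIso (M.toPseudofunctor.mapComp F G)).hom.naturality f.hom)
  map₂_whisker_left F _ _ η := by
    apply Cat.Hom₂.ext
    apply NatTrans.ext
    funext X
    apply ObjectProperty.hom_ext
    exact congrArg (fun t => t.toNatTrans.app X.obj) (M.toPseudofunctor.map₂_whisker_left F η)
  map₂_whisker_right η F := by
    apply Cat.Hom₂.ext
    apply NatTrans.ext
    funext X
    apply ObjectProperty.hom_ext
    exact congrArg (fun t => t.toNatTrans.app X.obj) (M.toPseudofunctor.map₂_whisker_right η F)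
  map₂_associator F G H := by
    apply Cat.Hom₂.ext
    apply NatTrans.ext
    funext X
    apply ObjectProperty.hom_ext
    exact congrArg (fun t => t.toNatTrans.app X.obj) (M.toPseudofunctor.map₂_associator F G H)
  map₂_left_unitor F := by
    apply Cat.Hom₂.ext
    apply NatTrans.ext
    funext X
    apply ObjectProperty.hom_ext
    exact congrArg (fun t => t.toNatTrans.app X.obj) (M.toPseudofunctor.map₂_left_unitor F)
  map₂_right_unitor F := by
    apply Cat.Hom₂.ext
    apply NatTrans.ext
    funext X
    apply ObjectProperty.hom_ext
    exact congrArg (fun t => t.toNatTrans.app X.obj) (M.toPseudofunctor.map₂_right_unitor F)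

instance (M : TwoRep.{w₁, v₁, u₁, v', u'} k B) (P hP) (i : B) :
    Preadditive ((M.restrictPseudofunctor P hP).obj i) :=
  inferInstanceAs (Preadditive (P i).FullSubcategory)

instance (M : TwoRep.{w₁, v₁, u₁, v', u'} k B) (P hP) (i : B) :
    Linear k ((M.restrictPseudofunctor P hP).obj i) :=
  inferInstanceAs (Linear k (P i).FullSubcategory)

instance (M : TwoRep.{w₁, v₁, u₁, v', u'} k B) (P hP) {i j : B} (F : i ⟶ j) :
    ((M.restrictPseudofunctor P hP).map F).toFunctor.Additive where
  map_add {_ _ f g} := ObjectProperty.hom_ext _ ((M.act F).map_add (f := f.hom) (g := g.hom))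

instance (M : TwoRep.{w₁, v₁, u₁, v', u'} k B) (P hP) {i j : B} (F : i ⟶ j) :
    ((M.restrictPseudofunctor P hP).map F).toFunctor.Linear k where
  map_smul f r := ObjectProperty.hom_ext _ ((M.act F).map_smul r f.hom)

/-- The restriction of a `2`-representation `M` to full subcategories of the categories `M(i)` which
are stable under the action. -/
def restrict (M : TwoRep.{w₁, v₁, u₁, v', u'} k B) (P : ∀ i : B, ObjectProperty (M.obj i))
    (hP : ∀ {i j : B} (F : i ⟶ j) (X : M.obj i), P i X → P j ((M.act F).obj X)) :
    TwoRep.{w₁, v₁, u₁, v', u'} k B where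
  toPseudofunctor := M.restrictPseudofunctor P hP
  map₂_add η θ X := ObjectProperty.hom_ext _ (M.map₂_add η θ X.obj)
  map₂_smul r η X := ObjectProperty.hom_ext _ (M.map₂_smul r η X.obj)

/-! #### Stable ideals and quotients -/

/-- A (`k`-linear, two-sided) ideal in each of the categories `M(i)`, stable under the action. -/
@[ext]
structure StableIdeal (M : TwoRep.{w₁, v₁, u₁, v', u'} k B) where
  /-- the morphisms from `X` to `Y` in the ideal -/
  carrier : ∀ {i : B} (X Y : M.obj i), Submodule k (X ⟶ Y)
  comp_mem : ∀ {i : B} {X Y Z : M.obj i} (f : X ⟶ Y) (g : Y ⟶ Z),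
    f ∈ carrier X Y → f ≫ g ∈ carrier X Z
  mem_comp : ∀ {i : B} {X Y Z : M.obj i} (f : X ⟶ Y) (g : Y ⟶ Z),
    g ∈ carrier Y Z → f ≫ g ∈ carrier X Z
  act_mem : ∀ {i j : B} (F : i ⟶ j) {X Y : M.obj i} (f : X ⟶ Y),
    f ∈ carrier X Y → (M.act F).map f ∈ carrier ((M.act F).obj X) ((M.act F).obj Y)

namespace StableIdeal

variable {M : TwoRep.{w₁, v₁, u₁, v', u'} k B} (I : StableIdeal M)

/-- An ideal is proper if it does not contain all morphisms. -/
def IsProper : Prop := ∃ (i : B) (X Y : M.obj i) (f : X ⟶ Y), f ∉ I.carrier X Y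

/-- The sum of a set of stable ideals. -/
def sum (S : Set (StableIdeal M)) : StableIdeal M where
  carrier X Y := ⨆ I ∈ S, I.carrier X Y
  comp_mem {i X Y Z} f g hf := by
    have : (⨆ I ∈ S, I.carrier X Y) ≤
        (⨆ I ∈ S, I.carrier X Z).comap (Linear.rightComp k X g) :=
      iSup₂_le fun I hI f hf => (le_iSup₂_of_le I hI le_rfl : I.carrier X Z ≤ _)
        (I.comp_mem f g hf)
    exact this hf
  mem_comp {i X Y Z} f g hg := by
    have : (⨆ I ∈ S, I.carrier Y Z) ≤
        (⨆ I ∈ S, I.carrier X Z).comap (Linear.leftComp k Z f) :=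
      iSup₂_le fun I hI g hg => (le_iSup₂_of_le I hI le_rfl : I.carrier X Z ≤ _)
        (I.mem_comp f g hg)
    exact this hg
  act_mem {i j} F {X Y} f hf := by
    have : (⨆ I ∈ S, I.carrier X Y) ≤
        (⨆ I ∈ S, I.carrier ((M.act F).obj X) ((M.act F).obj Y)).comap
          ((M.act F).mapLinearMap k (X := X) (Y := Y)) :=
      iSup₂_le fun I hI f hf => (le_iSup₂_of_le I hI le_rfl :
        I.carrier ((M.act F).obj X) ((M.act F).obj Y) ≤ _) (I.act_mem F f hf)
    exact this hf

/-- Congruence modulo a stable ideal. -/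
def rel (i : B) : HomRel (M.obj i) := fun X Y f g => f - g ∈ I.carrier X Y

instance (i : B) : Congruence (I.rel i) where
  comp_left {_ _ _} f {g g'} h := by
    change f ≫ g - f ≫ g' ∈ _
    rw [← Preadditive.comp_sub]
    exact I.mem_comp f _ h
  comp_right {_ _ _ f f'} g h := by
    change f ≫ g - f' ≫ g ∈ _
    rw [← Preadditive.sub_comp]
    exact I.comp_mem _ g h
  equivalence {X Y} :=
    { refl f := by
        change f - f ∈ _
        rw [sub_self]; exact Submodule.zero_mem _
      symm {f g} h := by
        change g - f ∈ _
        rw [← neg_sub]; exact Submodule.neg_mem _ h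
      trans {f g h} h₁ h₂ := by
        change f - h ∈ _
        rw [← sub_add_sub_cancel f g h]; exact Submodule.add_mem _ h₁ h₂ }

/-- The quotient category `M(i) / I(i)`. -/
abbrev Quot (i : B) : Type u' := CategoryTheory.Quotient (I.rel i)

/-- The projection `M(i) ⥤ M(i) / I(i)`. -/
abbrev proj (i : B) : M.obj i ⥤ I.Quot i := CategoryTheory.Quotient.functor (I.rel i)

instance (i : B) : Preadditive (I.Quot i) :=
  CategoryTheory.Quotient.preadditive (I.rel i) fun X Y f₁ f₂ g₁ g₂ hf hg => by
    change f₁ + g₁ - (f₂ + g₂) ∈ _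
    rw [add_sub_add_comm]
    exact Submodule.add_mem _ hf hg

instance (i : B) : (I.proj i).Additive where
  map_add := rfl

instance (i : B) : Linear k (I.Quot i) :=
  CategoryTheory.Quotient.linear k (I.rel i) fun a X Y f g h => by
    change a • f - a • g ∈ _
    rw [← smul_sub]
    exact Submodule.smul_mem _ a h

/-- The functor `M(i) / I(i) ⥤ M(j) / I(j)` induced by `M(F)`. -/
abbrev quotAct {i j : B} (F : i ⟶ j) : I.Quot i ⥤ I.Quot j :=
  CategoryTheory.Quotient.lift (I.rel i) (M.act F ⋙ I.proj j) fun X Y f g h => by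
    refine CategoryTheory.Quotient.sound (I.rel j) ?_
    change (M.act F).map f - (M.act F).map g ∈ _
    rw [← Functor.map_sub]
    exact I.act_mem F _ h

/-- The pseudofunctor underlying the quotient of a `2`-representation by a stable ideal. -/
def quotientPseudofunctor : B ⥤ᵖ Cat.{v', u'} where
  obj i := Cat.of (I.Quot i)
  map F := (I.quotAct F).toCatHom
  map₂ η := NatTrans.toCatHom₂
    { app X := (I.proj _).map ((M.toPseudofunctor.map₂ η).toNatTrans.app X.as)
      naturality := by
        rintro X Y ⟨f⟩
        exact congrArg (fun t => (I.proj _).map t)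
          ((M.toPseudofunctor.map₂ η).toNatTrans.naturality f) }
  map₂_id F := by
    apply Cat.Hom₂.ext
    apply NatTrans.ext
    funext X
    exact congrArg (fun t => (I.proj _).map t) (congrArg (fun t => t.toNatTrans.app X.as) (M.toPseudofunctor.map₂_id F))
  map₂_comp η θ := by
    apply Cat.Hom₂.ext
    apply NatTrans.ext
    funext X
    exact congrArg (fun t => (I.proj _).map t) (congrArg (fun t => t.toNatTrans.app X.as) (M.toPseudofunctor.map₂_comp η θ))
  mapId i := Cat.Hom.isoMk (NatIso.ofComponents
    (fun X => (I.proj i).mapIso ((Cat.Hom.toNatIso (M.toPseudofunctor.mapId i)).app X.as))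
    (by
      rintro X Y ⟨f⟩
      exact congrArg (fun t => (I.proj _).map t)
        ((Cat.Hom.toNatIso (M.toPseudofunctor.mapId i)).hom.naturality f)))
  mapComp F G := Cat.Hom.isoMk (NatIso.ofComponents
    (fun X => (I.proj _).mapIso ((Cat.Hom.toNatIso (M.toPseudofunctor.mapComp F G)).app X.as))
    (by
      rintro X Y ⟨f⟩
      exact congrArg (fun t => (I.proj _).map t)
        ((Cat.Hom.toNatIso (M.toPseudofunctor.mapComp F G)).hom.naturality f)))
  map₂_whisker_left F _ _ η := by
    apply Cat.Hom₂.ext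
    apply NatTrans.ext
    funext X
    exact congrArg (fun t => (I.proj _).map t) (congrArg (fun t => t.toNatTrans.app X.as) (M.toPseudofunctor.map₂_whisker_left F η))
  map₂_whisker_right η F := by
    apply Cat.Hom₂.ext
    apply NatTrans.ext
    funext X
    exact congrArg (fun t => (I.proj _).map t) (congrArg (fun t => t.toNatTrans.app X.as) (M.toPseudofunctor.map₂_whisker_right η F))
  map₂_associator F G H := by
    apply Cat.Hom₂.ext
    apply NatTrans.ext
    funext X
    exact congrArg (fun t => (I.proj _).map t) (congrArg (fun t => t.toNatTrans.app X.as) (M.toPseudofunctor.map₂_associator F G H))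
  map₂_left_unitor F := by
    apply Cat.Hom₂.ext
    apply NatTrans.ext
    funext X
    exact congrArg (fun t => (I.proj _).map t) (congrArg (fun t => t.toNatTrans.app X.as) (M.toPseudofunctor.map₂_left_unitor F))
  map₂_right_unitor F := by
    apply Cat.Hom₂.ext
    apply NatTrans.ext
    funext X
    exact congrArg (fun t => (I.proj _).map t) (congrArg (fun t => t.toNatTrans.app X.as) (M.toPseudofunctor.map₂_right_unitor F))

instance (i : B) : Preadditive (I.quotientPseudofunctor.obj i) :=
  inferInstanceAs (Preadditive (I.Quot i))

instance (i : B) : Linear k (I.quotientPseudofunctor.obj i) :=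
  inferInstanceAs (Linear k (I.Quot i))

instance {i j : B} (F : i ⟶ j) : (I.quotientPseudofunctor.map F).toFunctor.Additive where
  map_add := by
    rintro X Y ⟨f⟩ ⟨g⟩
    exact congrArg (fun t => (I.proj j).map t) ((M.act F).map_add (f := f) (g := g))

instance {i j : B} (F : i ⟶ j) : (I.quotientPseudofunctor.map F).toFunctor.Linear k where
  map_smul := by
    rintro X Y ⟨f⟩ r
    exact congrArg (fun t => (I.proj j).map t) ((M.act F).map_smul r f)

/-- The quotient `M / I` of a `2`-representation by a stable ideal. -/
def quotient : TwoRep.{w₁, v₁, u₁, v', u'} k B where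
  toPseudofunctor := I.quotientPseudofunctor
  map₂_add η θ X := congrArg (fun t => (I.proj _).map t) (M.map₂_add η θ X.as)
  map₂_smul r η X := congrArg (fun t => (I.proj _).map t) (M.map₂_smul r η X.as)

end StableIdeal

/-! #### Principal 2-representations -/

section Coherence

variable {B : Type u₁} [Bicategory.{w₁, v₁} B] {i a b c d : B}

theorem _root_.CategoryTheory.Bicategory.principal_aux₁ (X : i ⟶ a) (F : a ⟶ b) {G H : b ⟶ c}
    (η : G ⟶ H) : X ◁ F ◁ η = (α_ X F G).inv ≫ (X ≫ F) ◁ η ≫ (α_ X F H).hom := by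
  simp

theorem _root_.CategoryTheory.Bicategory.principal_aux₂ (X : i ⟶ a) {G H : a ⟶ b}
    (η : G ⟶ H) (F : b ⟶ c) :
    X ◁ η ▷ F = (α_ X G F).inv ≫ (X ◁ η) ▷ F ≫ (α_ X H F).hom := by
  simp

theorem _root_.CategoryTheory.Bicategory.principal_aux₃ (X : i ⟶ a) (F : a ⟶ b) (G : b ⟶ c)
    (H : c ⟶ d) : X ◁ (α_ F G H).hom = (α_ X (F ≫ G) H).inv ≫ (α_ X F G).inv ▷ H ≫
      𝟙 (((X ≫ F) ≫ G) ≫ H) ≫ (α_ (X ≫ F) G H).hom ≫ (α_ X F (G ≫ H)).hom := by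
  simp

theorem _root_.CategoryTheory.Bicategory.principal_aux₄ (X : i ⟶ a) (F : a ⟶ b) :
    X ◁ (λ_ F).hom = (α_ X (𝟙 _) F).inv ≫ (ρ_ X).hom ▷ F ≫ 𝟙 (X ≫ F) := by
  simp

theorem _root_.CategoryTheory.Bicategory.principal_aux₅ (X : i ⟶ a) (F : a ⟶ b) :
    X ◁ (ρ_ F).hom = (α_ X F (𝟙 _)).inv ≫ (ρ_ (X ≫ F)).hom ≫ 𝟙 (X ≫ F) := by
  simp

end Coherence

/-- The pseudofunctor `B(i, -)`. -/
def _root_.CategoryTheory.Bicategory.principalPseudofunctor (i : B) : B ⥤ᵖ Cat.{w₁, v₁} where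
  obj j := Cat.of (i ⟶ j)
  map F := (postcomp i F).toCatHom
  map₂ η := NatTrans.toCatHom₂
    { app X := X ◁ η
      naturality _ _ f := (whisker_exchange f η).symm }
  map₂_id F := by
    apply Cat.Hom₂.ext
    apply NatTrans.ext
    funext X
    exact whiskerLeft_id X F
  map₂_comp η θ := by
    apply Cat.Hom₂.ext
    apply NatTrans.ext
    funext X
    exact whiskerLeft_comp X η θ
  mapId j := Cat.Hom.isoMk (NatIso.ofComponents (fun X => ρ_ X)
    fun f => rightUnitor_naturality f)
  mapComp F G := Cat.Hom.isoMk (NatIso.ofComponents (fun X => (α_ X F G).symm)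
    fun f => associator_inv_naturality_left f F G)
  map₂_whisker_left F _ _ η := by
    apply Cat.Hom₂.ext
    apply NatTrans.ext
    funext X
    exact principal_aux₁ (i := i) X F η
  map₂_whisker_right η F := by
    apply Cat.Hom₂.ext
    apply NatTrans.ext
    funext X
    exact principal_aux₂ (i := i) X η F
  map₂_associator F G H := by
    apply Cat.Hom₂.ext
    apply NatTrans.ext
    funext X
    exact principal_aux₃ (i := i) X F G H
  map₂_left_unitor F := by
    apply Cat.Hom₂.ext
    apply NatTrans.ext
    funext X
    exact principal_aux₄ (i := i) X F
  map₂_right_unitor F := by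
    apply Cat.Hom₂.ext
    apply NatTrans.ext
    funext X
    exact principal_aux₅ (i := i) X F

instance (i j : B) : Preadditive ((principalPseudofunctor i).obj j) :=
  inferInstanceAs (Preadditive (i ⟶ j))

instance (i j : B) : Linear k ((principalPseudofunctor i).obj j) :=
  inferInstanceAs (Linear k (i ⟶ j))

variable [IsLinearBicategory k B]

variable (k) in
/-- The principal `2`-representation `P_i = B(i, -)`; `F : j ⟶ j'` acts by `X ↦ F ∘ X`, which is
denoted `X ≫ F`. -/
def principal (i : B) : TwoRep.{w₁, v₁, u₁, w₁, v₁} k B where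
  toPseudofunctor := principalPseudofunctor i
  map_additive F := ⟨fun {_ _ f g} => IsLinearBicategory.add_whiskerRight k f g F⟩
  map_linear F := ⟨fun f r => IsLinearBicategory.smul_whiskerRight r f F⟩
  map₂_add η θ X := IsLinearBicategory.whiskerLeft_add k X η θ
  map₂_smul r η X := IsLinearBicategory.whiskerLeft_smul X r η

end TwoRep

/-! ### Cells and cell 2-representations -/

/-- `X` is a direct summand of a finite direct sum of objects satisfying `P`: there are morphisms
`s t : X ⟶ Y t` and `r t : Y t ⟶ X` with `P (Y t)` and `∑ t, s t ≫ r t = 𝟙 X`. -/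
def addClosure {D : Type*} [Category* D] [Preadditive D] (P : D → Prop) : ObjectProperty D :=
  fun X => ∃ (n : ℕ) (Y : Fin n → D) (s : ∀ t, X ⟶ Y t) (r : ∀ t, Y t ⟶ X),
    (∀ t, P (Y t)) ∧ ∑ t, s t ≫ r t = 𝟙 X

/-- `X` is indecomposable: it is not zero, and whenever `X` is the direct sum of `Y` and `Z` (with
the displayed inclusions and projections), one of `Y` and `Z` is zero. -/
def IsIndecomposable {D : Type*} [Category* D] [Preadditive D] (X : D) : Prop :=
  ¬ Limits.IsZero X ∧ ∀ (Y Z : D) (i₁ : Y ⟶ X) (p₁ : X ⟶ Y) (i₂ : Z ⟶ X) (p₂ : X ⟶ Z),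
    i₁ ≫ p₁ = 𝟙 Y → i₂ ≫ p₂ = 𝟙 Z → p₁ ≫ i₁ + p₂ ≫ i₂ = 𝟙 X →
    Limits.IsZero Y ∨ Limits.IsZero Z

section Cells

variable {B : Type u₁} [Bicategory.{w₁, v₁} B]

/-- `F ≥_L G`: `F` is isomorphic to a direct summand of `H ∘ G` for some `H`. -/
def LeftGE {i j j' : B} (F : i ⟶ j') (G : i ⟶ j) : Prop :=
  ∃ H : j ⟶ j', Nonempty (Retract F (G ≫ H))

/-- `F ≥_J G`: `F` is isomorphic to a direct summand of `H ∘ G ∘ K` for some `H` and `K`. -/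
def TwoSidedGE {i i' j j' : B} (F : i' ⟶ j') (G : i ⟶ j) : Prop :=
  ∃ (K : i' ⟶ i) (H : j ⟶ j'), Nonempty (Retract F (K ≫ G ≫ H))

variable [∀ a b : B, Preadditive (a ⟶ b)]

/-- A left cell, i.e. an equivalence class of indecomposable `1`-morphisms for the left preorder.
All `1`-morphisms in it start at the same object `i`. -/
def IsLeftCell {i : B} (L : ∀ j : B, Set (i ⟶ j)) : Prop :=
  ∃ (j₀ : B) (G : i ⟶ j₀), IsIndecomposable G ∧
    ∀ (j : B) (F : i ⟶ j), F ∈ L j ↔ IsIndecomposable F ∧ LeftGE F G ∧ LeftGE G F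

/-- A two-sided cell, i.e. an equivalence class of indecomposable `1`-morphisms for the two-sided
preorder. -/
def IsTwoSidedCell (J : ∀ i j : B, Set (i ⟶ j)) : Prop :=
  ∃ (i₀ j₀ : B) (G : i₀ ⟶ j₀), IsIndecomposable G ∧
    ∀ (i j : B) (F : i ⟶ j), F ∈ J i j ↔ IsIndecomposable F ∧ TwoSidedGE F G ∧ TwoSidedGE G F

variable (k : Type v) [Field k] [∀ a b : B, Linear k (a ⟶ b)] [IsLinearBicategory k B]

/-- The subrepresentation of `P_i` given by the additive closure of all `1`-morphisms `F` such that
`F ≥_L L`. -/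
def cellSubrep {i : B} (L : ∀ j : B, Set (i ⟶ j)) : TwoRep.{w₁, v₁, u₁, w₁, v₁} k B :=
  (TwoRep.principal k i).restrict
    (fun j => addClosure (D := i ⟶ j) fun F => ∃ (j₀ : B), ∃ G ∈ L j₀, LeftGE F G)
    (by
      rintro j j' H (X : i ⟶ j) ⟨n, Y, s, r, hY, h⟩
      refine ⟨n, fun t => Y t ≫ H, fun t => s t ▷ H, fun t => r t ▷ H, fun t => ?_, ?_⟩
      · obtain ⟨j₀, G, hG, K, ⟨R⟩⟩ := hY t
        exact ⟨j₀, G, hG, K ≫ H, ⟨(R.map (postcomp i H)).trans (Retract.ofIso (α_ G K H))⟩⟩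
      · let φ : (X ⟶ X) →+ (X ≫ H ⟶ X ≫ H) :=
          AddMonoidHom.mk' (fun f => f ▷ H) fun f g => IsLinearBicategory.add_whiskerRight k f g H
        calc ∑ t, s t ▷ H ≫ r t ▷ H = ∑ t, φ (s t ≫ r t) :=
              Finset.sum_congr rfl fun t _ => (comp_whiskerRight (s t) (r t) H).symm
          _ = φ (∑ t, s t ≫ r t) := (map_sum φ _ _).symm
          _ = φ (𝟙 X) := congrArg φ h
          _ = 𝟙 (X ≫ H) := id_whiskerRight X H)

/-- The cell `2`-representation `C_L`: the quotient of `cellSubrep k L` by its unique maximal proper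
stable ideal, the sum of all proper stable ideals. -/
def cellTwoRep {i : B} (L : ∀ j : B, Set (i ⟶ j)) : TwoRep.{w₁, v₁, u₁, w₁, v₁} k B :=
  (TwoRep.StableIdeal.sum {I : TwoRep.StableIdeal (cellSubrep k L) | I.IsProper}).quotient

end Cells

end General

/-! ### Tensor products over noncommutative rings -/

section BalancedTensor

variable (A : Type u) [Ring A]
variable (M : Type u) [AddCommGroup M] [Module A M] [Module Aᵐᵒᵖ M]
variable (N : Type u) [AddCommGroup N] [Module A N]

/-- The `A`-submodule of `M ⊗_ℤ N` generated by all `m a ⊗ n - m ⊗ a n`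
(the right action of `a` on `m` is `MulOpposite.op a • m`). -/
def balancedRelations : Submodule A (M ⊗[ℤ] N) :=
  Submodule.span A
    {t | ∃ (m : M) (a : A) (n : N), t = (MulOpposite.op a • m) ⊗ₜ[ℤ] n - m ⊗ₜ[ℤ] (a • n)}

/-- The tensor product `M ⊗_A N` of an `A`-`A`-bimodule `M` and a left `A`-module `N` over a
(not necessarily commutative) ring `A`, as a left `A`-module. -/
def BalancedTensor : Type u := (M ⊗[ℤ] N) ⧸ balancedRelations A M N

namespace BalancedTensor

instance : AddCommGroup (BalancedTensor A M N) :=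
  inferInstanceAs (AddCommGroup ((M ⊗[ℤ] N) ⧸ balancedRelations A M N))

instance : Module A (BalancedTensor A M N) :=
  inferInstanceAs (Module A ((M ⊗[ℤ] N) ⧸ balancedRelations A M N))

variable {M N}

/-- The class of `m ⊗ n`. -/
def tmul (m : M) (n : N) : BalancedTensor A M N :=
  (balancedRelations A M N).mkQ (m ⊗ₜ[ℤ] n)

theorem add_tmul (m m' : M) (n : N) : tmul A (m + m') n = tmul A m n + tmul A m' n := by
  simp only [tmul, TensorProduct.add_tmul, map_add]; rfl

theorem tmul_add (m : M) (n n' : N) : tmul A m (n + n') = tmul A m n + tmul A m n' := by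
  simp only [tmul, TensorProduct.tmul_add, map_add]; rfl

theorem zero_tmul (n : N) : tmul A (0 : M) n = 0 := by
  simpa using add_tmul A (0 : M) 0 n

theorem tmul_zero (m : M) : tmul A m (0 : N) = 0 := by
  simpa using tmul_add A m (0 : N) 0

theorem smul_tmul' (a : A) (m : M) (n : N) : a • tmul A m n = tmul A (a • m) n := by
  simp only [tmul]
  rw [← TensorProduct.smul_tmul', map_smul]; rfl

theorem op_smul_tmul (a : A) (m : M) (n : N) :
    tmul A (MulOpposite.op a • m) n = tmul A m (a • n) := by
  have : (balancedRelations A M N).mkQ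
      ((MulOpposite.op a • m) ⊗ₜ[ℤ] n - m ⊗ₜ[ℤ] (a • n)) = 0 := by
    rw [Submodule.mkQ_apply, Submodule.Quotient.mk_eq_zero]
    exact Submodule.subset_span ⟨m, a, n, rfl⟩
  rw [map_sub] at this
  exact sub_eq_zero.1 this

theorem induction {p : BalancedTensor A M N → Prop} (t : BalancedTensor A M N)
    (h0 : p 0) (hadd : ∀ x y, p x → p y → p (x + y)) (ht : ∀ m n, p (tmul A m n)) : p t := by
  obtain ⟨x, rfl⟩ := Submodule.mkQ_surjective _ t
  induction x using TensorProduct.induction_on with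
  | zero => rw [map_zero]; exact h0
  | tmul m n => exact ht m n
  | add x y hx hy => rw [map_add]; exact hadd _ _ hx hy

variable {A}

theorem addHom_ext {P : Type*} [AddCommMonoid P] {f g : BalancedTensor A M N →+ P}
    (h : ∀ m n, f (tmul A m n) = g (tmul A m n)) : f = g := by
  ext t
  induction t using induction with
  | h0 => simp
  | hadd x y hx hy => simp [hx, hy]
  | ht m n => exact h m n

theorem hom_ext {P : Type*} [AddCommGroup P] [Module A P] {f g : BalancedTensor A M N →ₗ[A] P}
    (h : ∀ m n, f (tmul A m n) = g (tmul A m n)) : f = g := by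
  ext t
  induction t using induction with
  | h0 => simp
  | hadd x y hx hy => simp [hx, hy]
  | ht m n => exact h m n

/-- The `A`-linear map out of `M ⊗_A N` given by a balanced biadditive map. -/
def lift {P : Type*} [AddCommGroup P] [Module A P] (f : M →+ N →+ P)
    (hf : ∀ (a : A) m n, f (a • m) n = a • f m n)
    (hb : ∀ (a : A) m n, f (MulOpposite.op a • m) n = f m (a • n)) :
    BalancedTensor A M N →ₗ[A] P :=
  (balancedRelations A M N).liftQ
    { toFun := TensorProduct.liftAddHom f (fun r m n => by simp)
      map_add' := map_add _
      map_smul' := fun a t => by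
        induction t using TensorProduct.induction_on with
        | zero => simp
        | tmul m n => simpa [TensorProduct.smul_tmul'] using hf a m n
        | add x y hx hy => rw [smul_add, map_add, hx, hy, map_add, smul_add] }
    (by
      refine Submodule.span_le.2 ?_
      rintro _ ⟨m, a, n, rfl⟩
      simp [hb])

theorem lift_tmul {P : Type*} [AddCommGroup P] [Module A P] (f : M →+ N →+ P) (hf hb)
    (m : M) (n : N) : lift (A := A) f hf hb (tmul A m n) = f m n := rfl

/-- The map `f ⊗ g : M ⊗_A N → M' ⊗_A N'`. -/
def map {M' N' : Type u} [AddCommGroup M'] [Module A M'] [Module Aᵐᵒᵖ M'] [AddCommGroup N']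
    [Module A N'] (f : M →ₗ[A] M')
    (hf : ∀ (a : A) m, f (MulOpposite.op a • m) = MulOpposite.op a • f m) (g : N →ₗ[A] N') :
    BalancedTensor A M N →ₗ[A] BalancedTensor A M' N' :=
  lift (A := A)
    (AddMonoidHom.mk' (fun m => AddMonoidHom.mk' (fun n => tmul A (f m) (g n))
        fun n n' => by rw [map_add, tmul_add])
      fun m m' => by ext n; simp [add_tmul])
    (fun a m n => by simp [smul_tmul'])
    (fun a m n => by simp [hf, op_smul_tmul])

theorem map_tmul {M' N' : Type u} [AddCommGroup M'] [Module A M'] [Module Aᵐᵒᵖ M']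
    [AddCommGroup N'] [Module A N'] (f : M →ₗ[A] M') (hf) (g : N →ₗ[A] N') (m : M) (n : N) :
    map f hf g (tmul A m n) = tmul A (f m) (g n) := rfl

end BalancedTensor

end BalancedTensor

/-! ### Bimodules -/

/-- `A`-`A`-bimodules over `k`: a left and a right action of `A` which commute and on which `k`
acts centrally. The right action of `a` is the action of `MulOpposite.op a`. -/
structure Bimodule (k : Type v) [Field k] (A : Type u) [Ring A] [Algebra k A] where
  /-- the underlying type -/
  carrier : Type u
  [addCommGroup : AddCommGroup carrier]
  [left : Module A carrier]
  [right : Module Aᵐᵒᵖ carrier]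
  [comm : SMulCommClass A Aᵐᵒᵖ carrier]
  central : ∀ (c : k) (m : carrier),
    algebraMap k A c • m = MulOpposite.op (algebraMap k A c) • m

namespace Bimodule

attribute [instance] addCommGroup left right comm

variable {k : Type v} [Field k] {A : Type u} [Ring A] [Algebra k A]

/-- Homomorphisms of `A`-`A`-bimodules. -/
structure Hom (M N : Bimodule k A) where
  /-- the underlying homomorphism of left modules -/
  toLin : M.carrier →ₗ[A] N.carrier
  map_op_smul : ∀ (a : A) (m : M.carrier),
    toLin (MulOpposite.op a • m) = MulOpposite.op a • toLin m

variable (k A) in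
/-- The regular bimodule `A`. -/
abbrev regular : Bimodule k A where
  carrier := A
  central c m := by simp [Algebra.commutes]

variable (k A) in
/-- The space `A ⊗_k A` underlying the bimodule of the same name. -/
def Outer : Type u := A ⊗[k] A

namespace Outer

instance : AddCommGroup (Outer k A) := inferInstanceAs (AddCommGroup (A ⊗[k] A))

/-- The left action `a (x ⊗ y) = a x ⊗ y`. -/
instance : Module A (Outer k A) := inferInstanceAs (Module A (A ⊗[k] A))

/-- The right action `(x ⊗ y) a = x ⊗ y a`. -/
instance : Module Aᵐᵒᵖ (Outer k A) where
  smul a t := (LinearMap.lTensor A (LinearMap.mulRight k a.unop) : A ⊗[k] A →ₗ[k] A ⊗[k] A) t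
  one_smul t := by
    change LinearMap.lTensor A (LinearMap.mulRight k (1 : A)) t = t
    rw [LinearMap.mulRight_one, LinearMap.lTensor_id]; rfl
  mul_smul a b t := by
    change LinearMap.lTensor A (LinearMap.mulRight k (b.unop * a.unop)) t =
      LinearMap.lTensor A (LinearMap.mulRight k a.unop)
        (LinearMap.lTensor A (LinearMap.mulRight k b.unop) t)
    rw [LinearMap.mulRight_mul, LinearMap.lTensor_comp]; rfl
  smul_zero a := map_zero _
  smul_add a := map_add _
  add_smul a b t := by
    change LinearMap.lTensor A (LinearMap.mulRight k (a.unop + b.unop)) t =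
      LinearMap.lTensor A (LinearMap.mulRight k a.unop) t +
        LinearMap.lTensor A (LinearMap.mulRight k b.unop) t
    have : LinearMap.mulRight k (a.unop + b.unop) =
      LinearMap.mulRight k a.unop + LinearMap.mulRight k b.unop := by
        ext x; simp [mul_add]
    rw [this, LinearMap.lTensor_add]; rfl
  zero_smul t := by
    change LinearMap.lTensor A (LinearMap.mulRight k (0 : A)) t = 0
    rw [LinearMap.mulRight_zero_eq_zero, LinearMap.lTensor_zero]; rfl

/-- The element `x ⊗ y` -/
def mk (x y : A) : Outer k A := x ⊗ₜ[k] y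

theorem smul_mk (a x y : A) : a • (mk x y : Outer k A) = mk (a * x) y := rfl

theorem op_smul_mk (a x y : A) :
    MulOpposite.op a • (mk x y : Outer k A) = mk x (y * a) := rfl

theorem induction {p : Outer k A → Prop} (t : Outer k A)
    (h0 : p 0) (hadd : ∀ x y, p x → p y → p (x + y)) (ht : ∀ x y, p (mk x y)) : p t :=
  TensorProduct.induction_on (motive := p) t h0 ht hadd

instance : SMulCommClass A Aᵐᵒᵖ (Outer k A) where
  smul_comm a b t := by
    induction t using induction with
    | h0 => simp
    | hadd x y hx hy => simp only [smul_add, hx, hy]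
    | ht x y => rfl

end Outer

variable (k A) in
/-- The bimodule `A ⊗_k A` -/
abbrev outer : Bimodule k A where
  carrier := Outer k A
  central c t := by
    induction t using Outer.induction with
    | h0 => simp
    | hadd x y hx hy => simp only [smul_add, hx, hy]
    | ht x y =>
      rw [Outer.smul_mk, Outer.op_smul_mk, ← Algebra.commutes, ← Algebra.smul_def,
        ← Algebra.smul_def]
      exact TensorProduct.smul_tmul c x y

/-- `M` is a direct summand of a finite direct sum of bimodules in `S`: there are bimodule
homomorphisms `s t : M → Y t` and `r t : Y t → M` with `Y t ∈ S` and `∑ t, r t ∘ s t = id`. -/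
def InAdd (S : Set (Bimodule k A)) (M : Bimodule k A) : Prop :=
  ∃ (n : ℕ) (Y : Fin n → Bimodule k A) (s : ∀ t, Hom M (Y t)) (r : ∀ t, Hom (Y t) M),
    (∀ t, Y t ∈ S) ∧ ∑ t, (r t).toLin ∘ₗ (s t).toLin = LinearMap.id

/-- The functor `M ⊗_A -` on left `A`-modules. -/
def tensorFunctor (M : Bimodule k A) : ModuleCat.{u} A ⥤ ModuleCat.{u} A where
  obj N := ModuleCat.of A (BalancedTensor A M.carrier N)
  map f := ModuleCat.ofHom (BalancedTensor.map LinearMap.id (fun _ _ => rfl) f.hom)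
  map_id N := by
    ext1; exact BalancedTensor.hom_ext fun m n => rfl
  map_comp f g := by
    ext1; exact BalancedTensor.hom_ext fun m n => rfl

end Bimodule


namespace Bimodule

variable {k : Type v} [Field k] {A : Type u} [Ring A] [Algebra k A]

/-! #### Tensor products of bimodules -/

/-- Right multiplication by `a` as an endomorphism of the left module `M`. -/
def rightMul (M : Bimodule k A) (a : A) : M.carrier →ₗ[A] M.carrier where
  toFun m := MulOpposite.op a • m
  map_add' := smul_add _
  map_smul' b m := (smul_comm b (MulOpposite.op a) m).symm

/-- The right action `(m ⊗ n) a = m ⊗ n a` on a tensor product of bimodules. -/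
instance tensorRight (M N : Bimodule k A) :
    Module Aᵐᵒᵖ (BalancedTensor A M.carrier N.carrier) where
  smul a t := BalancedTensor.map LinearMap.id (fun _ _ => rfl) (N.rightMul a.unop) t
  one_smul t := by
    refine DFunLike.congr_fun (g := LinearMap.id) (BalancedTensor.hom_ext fun m n => ?_) t
    change BalancedTensor.tmul A m ((1 : Aᵐᵒᵖ) • n) = _
    rw [one_smul]; rfl
  mul_smul a b t := by
    refine DFunLike.congr_fun (g := LinearMap.comp
      (BalancedTensor.map LinearMap.id (fun _ _ => rfl) (N.rightMul a.unop))
      (BalancedTensor.map LinearMap.id (fun _ _ => rfl) (N.rightMul b.unop)))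
      (BalancedTensor.hom_ext fun m n => ?_) t
    change BalancedTensor.tmul A m ((a * b) • n) = BalancedTensor.tmul A m (a • b • n)
    rw [mul_smul]
  smul_zero a := map_zero _
  smul_add a := map_add _
  add_smul a b t := by
    refine DFunLike.congr_fun (g :=
      (BalancedTensor.map LinearMap.id (fun _ _ => rfl) (N.rightMul a.unop)) +
      (BalancedTensor.map LinearMap.id (fun _ _ => rfl) (N.rightMul b.unop)))
      (BalancedTensor.hom_ext fun m n => ?_) t
    change BalancedTensor.tmul A m ((a + b) • n) =
      BalancedTensor.tmul A m (a • n) + BalancedTensor.tmul A m (b • n)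
    rw [add_smul, BalancedTensor.tmul_add]
  zero_smul t := by
    refine DFunLike.congr_fun (g := 0) (BalancedTensor.hom_ext fun m n => ?_) t
    change BalancedTensor.tmul A m ((0 : Aᵐᵒᵖ) • n) = 0
    rw [zero_smul]
    simpa using BalancedTensor.tmul_add A m (0 : N.carrier) 0

theorem op_smul_tmul' {M N : Bimodule k A} (a : A) (m : M.carrier) (n : N.carrier) :
    MulOpposite.op a • BalancedTensor.tmul A m n =
      BalancedTensor.tmul A m (MulOpposite.op a • n) := rfl

/-- The bimodule `M ⊗_A N`. -/
abbrev tensor (M N : Bimodule k A) : Bimodule k A where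
  carrier := BalancedTensor A M.carrier N.carrier
  comm := ⟨fun a b t => by
    induction t using BalancedTensor.induction with
    | h0 => simp
    | hadd x y hx hy => simp only [smul_add, hx, hy]
    | ht m n => rfl⟩
  central c t := by
    induction t using BalancedTensor.induction with
    | h0 => simp
    | hadd x y hx hy => simp only [smul_add, hx, hy]
    | ht m n =>
      rw [BalancedTensor.smul_tmul', op_smul_tmul', M.central, BalancedTensor.op_smul_tmul,
        N.central]

namespace Hom

/-- Composition of bimodule homomorphisms. -/
def comp {M N P : Bimodule k A} (g : Hom N P) (f : Hom M N) : Hom M P where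
  toLin := g.toLin.comp f.toLin
  map_op_smul a m := by simp [f.map_op_smul, g.map_op_smul]

/-- A left linear map commuting with right multiplications is a bimodule homomorphism. -/
def mk' {M N : Bimodule k A} (f : M.carrier →ₗ[A] N.carrier)
    (h : ∀ a, f ∘ₗ M.rightMul a = N.rightMul a ∘ₗ f) : Hom M N :=
  ⟨f, fun a m => DFunLike.congr_fun (h a) m⟩

/-- Tensor product of bimodule homomorphisms. -/
def tensor {M N M' N' : Bimodule k A} (f : Hom M M') (g : Hom N N') :
    Hom (M.tensor N) (M'.tensor N') :=
  mk' (BalancedTensor.map f.toLin f.map_op_smul g.toLin)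
    fun a => BalancedTensor.hom_ext (M := M.carrier) (N := N.carrier) fun m n =>
      congrArg (BalancedTensor.tmul A (f.toLin m)) (g.map_op_smul a n)

end Hom

/-- `A ⊗_A N → N`. -/
def regularTensorHom (N : Type u) [AddCommGroup N] [Module A N] :
    BalancedTensor A (regular k A).carrier N →ₗ[A] N :=
  BalancedTensor.lift (A := A) (M := A)
    (AddMonoidHom.mk' (fun a => AddMonoidHom.mk' (fun n => a • n) (smul_add a))
      fun a b => by ext n; simp [add_smul])
    (fun a b n => by simp [mul_smul])
    (fun a b n => by simp [mul_smul])

/-- `N → A ⊗_A N`. -/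
def regularTensorInv (N : Type u) [AddCommGroup N] [Module A N] :
    N →ₗ[A] BalancedTensor A (regular k A).carrier N where
  toFun n := BalancedTensor.tmul A (M := A) 1 n
  map_add' n n' := BalancedTensor.tmul_add A (M := A) _ n n'
  map_smul' a n := by
    change BalancedTensor.tmul A (M := A) 1 (a • n) = a • BalancedTensor.tmul A (M := A) 1 n
    rw [BalancedTensor.smul_tmul', ← BalancedTensor.op_smul_tmul]; simp

variable (k A) in
/-- `A ⊗_A -` is isomorphic to the identity functor. -/
def tensorFunctorRegular : (regular k A).tensorFunctor ≅ 𝟭 (ModuleCat.{u} A) :=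
  NatIso.ofComponents
    (fun N =>
      { hom := ModuleCat.ofHom (regularTensorHom (k := k) N)
        inv := ModuleCat.ofHom (regularTensorInv (k := k) N)
        hom_inv_id := by
          ext1
          refine BalancedTensor.hom_ext fun (m : A) n => ?_
          change BalancedTensor.tmul A (M := A) 1 (m • n) = BalancedTensor.tmul A (M := A) m n
          rw [← BalancedTensor.op_smul_tmul]; simp
        inv_hom_id := by
          ext n
          exact one_smul A n })
    (fun {N N'} f => by
      ext1
      refine BalancedTensor.hom_ext fun (m : A) n => ?_
      exact (f.hom.map_smul m n).symm)

/-- The additive map out of `M ⊗_A N` given by a balanced biadditive map. -/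
def liftAdd (M : Bimodule k A) {N : Type u} [AddCommGroup N] [Module A N] {P : Type*}
    [AddCommGroup P] (f : M.carrier →+ N →+ P)
    (hb : ∀ (a : A) m n, f (MulOpposite.op a • m) n = f m (a • n)) :
    BalancedTensor A M.carrier N →+ P :=
  QuotientAddGroup.lift (balancedRelations A M.carrier N).toAddSubgroup
    (TensorProduct.liftAddHom f (fun r m n => by simp))
    (by
      intro t ht
      have key : ∀ a : A, TensorProduct.liftAddHom f (fun r m n => by simp) (a • t) = 0 := by
        induction ht using Submodule.span_induction with
        | mem t ht =>
          obtain ⟨m, b, n, rfl⟩ := ht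
          intro a
          rw [smul_sub, TensorProduct.smul_tmul', TensorProduct.smul_tmul', smul_comm]
          simp [hb]
        | zero => simp
        | add x y _ _ hx hy => intro a; rw [smul_add, map_add, hx, hy, add_zero]
        | smul b x _ hx => intro a; rw [← mul_smul]; exact hx _
      simpa using key 1)

/-- The map `m ↦ m ⊗ x`. -/
def tmulRight (M : Bimodule k A) {X : Type u} [AddCommGroup X] [Module A X] (x : X) :
    M.carrier →ₗ[A] BalancedTensor A M.carrier X where
  toFun m := BalancedTensor.tmul A m x
  map_add' m m' := BalancedTensor.add_tmul A m m' x
  map_smul' a m := (BalancedTensor.smul_tmul' A a m x).symm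

/-- `N ⊗_A (M ⊗_A X) → (N ⊗_A M) ⊗_A X`. -/
def assocHom (N M : Bimodule k A) (X : Type u) [AddCommGroup X] [Module A X] :
    BalancedTensor A N.carrier (BalancedTensor A M.carrier X) →ₗ[A]
      BalancedTensor A (N.tensor M).carrier X :=
  BalancedTensor.lift (A := A)
    (AddMonoidHom.mk' (fun n => M.liftAdd
        (AddMonoidHom.mk' (fun m => AddMonoidHom.mk'
          (fun x => BalancedTensor.tmul A (M := (N.tensor M).carrier)
            (BalancedTensor.tmul A n m) x)
          fun x x' => BalancedTensor.tmul_add A _ x x')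
          fun m m' => by
            ext x
            exact (congrArg (fun t => BalancedTensor.tmul A (M := (N.tensor M).carrier) t x)
              (BalancedTensor.tmul_add A n m m')).trans (BalancedTensor.add_tmul A _ _ x))
        fun a m x => by
          exact BalancedTensor.op_smul_tmul A a (M := (N.tensor M).carrier)
            (BalancedTensor.tmul A n m) x)
      fun n n' => BalancedTensor.addHom_ext fun m x =>
        (congrArg (fun t => BalancedTensor.tmul A (M := (N.tensor M).carrier) t x)
          (BalancedTensor.add_tmul A n n' m)).trans (BalancedTensor.add_tmul A _ _ x))
    (fun a n t => by
      induction t using BalancedTensor.induction with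
      | h0 => simp
      | hadd x y hx hy => rw [map_add, hx, hy, map_add, smul_add]
      | ht m x => rfl)
    (fun a n t => by
      induction t using BalancedTensor.induction with
      | h0 => simp
      | hadd x y hx hy => rw [map_add, hx, hy, smul_add, map_add]
      | ht m x =>
        exact congrArg (fun t => BalancedTensor.tmul A (M := (N.tensor M).carrier) t x)
          (BalancedTensor.op_smul_tmul A a n m))

/-- The map `n ⊗ m ↦ n ⊗ (m ⊗ x)`. -/
def assocInvAux (N M : Bimodule k A) {X : Type u} [AddCommGroup X] [Module A X] (x : X) :
    (N.tensor M).carrier →ₗ[A] BalancedTensor A N.carrier (BalancedTensor A M.carrier X) :=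
  BalancedTensor.map (A := A) (M := N.carrier) (N := M.carrier) LinearMap.id
    (fun _ _ => rfl) (M.tmulRight x)

/-- `(N ⊗_A M) ⊗_A X → N ⊗_A (M ⊗_A X)`. -/
def assocInv (N M : Bimodule k A) (X : Type u) [AddCommGroup X] [Module A X] :
    BalancedTensor A (N.tensor M).carrier X →ₗ[A]
      BalancedTensor A N.carrier (BalancedTensor A M.carrier X) :=
  BalancedTensor.lift (A := A) (M := (N.tensor M).carrier)
    (AddMonoidHom.flip (AddMonoidHom.mk'
      (fun x => (assocInvAux N M x).toAddMonoidHom)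
      fun x x' => BalancedTensor.addHom_ext (M := N.carrier) (N := M.carrier) fun n m =>
        (congrArg (BalancedTensor.tmul A n) (BalancedTensor.tmul_add A m x x')).trans
          (BalancedTensor.tmul_add A n _ _)))
    (fun a t x => (assocInvAux N M x).map_smul a t)
    (fun a t x => by
      refine DFunLike.congr_fun (f := (assocInvAux N M x).comp ((N.tensor M).rightMul a))
        (g := assocInvAux N M (a • x)) ?_ t
      exact BalancedTensor.hom_ext (M := N.carrier) (N := M.carrier) fun n m =>
        congrArg (BalancedTensor.tmul A n) (BalancedTensor.op_smul_tmul A a m x))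

/-- `N ⊗_A (M ⊗_A -)` is isomorphic to `(N ⊗_A M) ⊗_A -`. -/
def tensorFunctorTensor (N M : Bimodule k A) :
    M.tensorFunctor ⋙ N.tensorFunctor ≅ (N.tensor M).tensorFunctor :=
  NatIso.ofComponents
    (fun X =>
      { hom := ModuleCat.ofHom (assocHom N M X)
        inv := ModuleCat.ofHom (assocInv N M X)
        hom_inv_id := by
          ext1
          refine BalancedTensor.hom_ext fun n t => ?_
          change BalancedTensor A M.carrier X at t
          induction t using BalancedTensor.induction with
          | h0 =>
            erw [BalancedTensor.tmul_zero, map_zero]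
          | hadd s t hs ht =>
            erw [BalancedTensor.tmul_add, map_add, map_add, hs, ht]
          | ht m x => rfl
        inv_hom_id := by
          ext1
          refine BalancedTensor.hom_ext fun t x => ?_
          change BalancedTensor A N.carrier M.carrier at t
          induction t using BalancedTensor.induction with
          | h0 =>
            erw [BalancedTensor.zero_tmul, map_zero]
          | hadd s t hs ht =>
            erw [BalancedTensor.add_tmul, map_add, map_add, hs, ht]
          | ht n m => rfl })
    (fun {X X'} f => by
      ext1
      refine BalancedTensor.hom_ext fun n t => ?_
      change BalancedTensor A M.carrier X at t
      induction t using BalancedTensor.induction with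
      | h0 =>
        erw [BalancedTensor.tmul_zero, map_zero]
      | hadd s t hs ht =>
        erw [BalancedTensor.tmul_add, map_add, map_add, hs, ht]
      | ht m x => rfl)

end Bimodule


namespace Bimodule

variable {k : Type v} [Field k] {A : Type u} [Ring A] [Algebra k A]

/-! #### Bimodules in `add (A ⊕ A ⊗_k A)` -/

theorem InAdd.of_fintype {S : Set (Bimodule k A)} {M : Bimodule k A} {ι : Type*} [Fintype ι]
    (Y : ι → Bimodule k A) (hY : ∀ t, Y t ∈ S) (s : ∀ t, Hom M (Y t)) (r : ∀ t, Hom (Y t) M)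
    (h : ∑ t, (r t).toLin ∘ₗ (s t).toLin = LinearMap.id) : InAdd S M :=
  let e := (Fintype.equivFin ι).symm
  ⟨Fintype.card ι, fun t => Y (e t), fun t => s (e t), fun t => r (e t), fun _ => hY _,
    (Equiv.sum_comp e fun t => (r t).toLin ∘ₗ (s t).toLin).trans h⟩

theorem InAdd.of_inAdd {S : Set (Bimodule k A)} {M : Bimodule k A} {ι : Type*} [Fintype ι]
    (Y : ι → Bimodule k A) (hY : ∀ t, InAdd S (Y t)) (s : ∀ t, Hom M (Y t))
    (r : ∀ t, Hom (Y t) M) (h : ∑ t, (r t).toLin ∘ₗ (s t).toLin = LinearMap.id) :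
    InAdd S M := by
  choose n Z s' r' hZ h' using hY
  refine InAdd.of_fintype (ι := Σ t, Fin (n t)) (fun p => Z p.1 p.2) (fun p => hZ _ _)
    (fun p => (s' p.1 p.2).comp (s p.1)) (fun p => (r p.1).comp (r' p.1 p.2)) ?_
  rw [Fintype.sum_sigma]
  refine Eq.trans (Finset.sum_congr rfl fun t _ => ?_) h
  ext m
  rw [LinearMap.sum_apply]
  change ∑ y, (r t).toLin ((r' t y).toLin ((s' t y).toLin ((s t).toLin m))) =
    (r t).toLin ((s t).toLin m)
  have := DFunLike.congr_fun (h' t) ((s t).toLin m)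
  rw [LinearMap.sum_apply] at this
  rw [← map_sum]
  exact congrArg _ this

theorem InAdd.of_retract {S : Set (Bimodule k A)} {M Y : Bimodule k A} (hY : Y ∈ S)
    (s : Hom M Y) (r : Hom Y M) (h : r.toLin ∘ₗ s.toLin = LinearMap.id) : InAdd S M :=
  InAdd.of_fintype (ι := Unit) (fun _ => Y) (fun _ => hY) (fun _ => s) (fun _ => r)
    (by simpa using h)

theorem sum_tmul {M : Type u} [AddCommGroup M] [Module A M] [Module Aᵐᵒᵖ M]
    {N : Type u} [AddCommGroup N] [Module A N] {ι : Type*} [Fintype ι] (f : ι → M) (n : N) :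
    ∑ j, BalancedTensor.tmul A (f j) n = BalancedTensor.tmul A (∑ j, f j) n :=
  (map_sum (AddMonoidHom.mk' (fun m => BalancedTensor.tmul A m n)
    (fun m m' => BalancedTensor.add_tmul A m m' n)) f Finset.univ).symm

theorem tmul_sum {M : Type u} [AddCommGroup M] [Module A M] [Module Aᵐᵒᵖ M]
    {N : Type u} [AddCommGroup N] [Module A N] {ι : Type*} [Fintype ι] (m : M) (f : ι → N) :
    ∑ j, BalancedTensor.tmul A m (f j) = BalancedTensor.tmul A m (∑ j, f j) :=
  (map_sum (AddMonoidHom.mk' (fun n => BalancedTensor.tmul A m n)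
    (BalancedTensor.tmul_add A m)) f Finset.univ).symm

theorem InAdd.tensor {S : Set (Bimodule k A)}
    (hS : ∀ X ∈ S, ∀ Y ∈ S, InAdd S (X.tensor Y)) {M N : Bimodule k A}
    (hM : InAdd S M) (hN : InAdd S N) : InAdd S (M.tensor N) := by
  obtain ⟨p, Y, s, r, hY, h⟩ := hM
  obtain ⟨q, Z, s', r', hZ, h'⟩ := hN
  refine InAdd.of_inAdd (ι := Fin p × Fin q) (fun t => (Y t.1).tensor (Z t.2))
    (fun t => hS _ (hY _) _ (hZ _)) (fun t => (s t.1).tensor (s' t.2))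
    (fun t => (r t.1).tensor (r' t.2)) (BalancedTensor.hom_ext fun m n => ?_)
  rw [LinearMap.sum_apply]
  change ∑ t : Fin p × Fin q, BalancedTensor.tmul A ((r t.1).toLin ((s t.1).toLin m))
    ((r' t.2).toLin ((s' t.2).toLin n)) = BalancedTensor.tmul A m n
  rw [Fintype.sum_prod_type]
  have h1 : ∑ t, (r t).toLin ((s t).toLin m) = m := by
    simpa using DFunLike.congr_fun h m
  have h2 : ∑ t, (r' t).toLin ((s' t).toLin n) = n := by
    simpa using DFunLike.congr_fun h' n
  conv_rhs => rw [← h1, ← h2, ← sum_tmul]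
  exact Finset.sum_congr rfl fun t _ =>
    tmul_sum (A := A) ((r t).toLin ((s t).toLin m)) fun j => (r' j).toLin ((s' j).toLin n)

variable (k A) in
/-- The bimodules `A` and `A ⊗_k A`. -/
def generators : Set (Bimodule k A) := {regular k A, outer k A}

theorem inAdd_regular_tensor {Y : Bimodule k A} (hY : Y ∈ generators k A) :
    InAdd (generators k A) ((regular k A).tensor Y) := by
  refine InAdd.of_retract hY (Hom.mk' (regularTensorHom Y.carrier) fun a => ?_)
    ⟨regularTensorInv Y.carrier, fun a t => rfl⟩ ?_
  · exact BalancedTensor.hom_ext fun (m : A) n => smul_comm m (MulOpposite.op a) n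
  · refine BalancedTensor.hom_ext fun (m : A) n => ?_
    change BalancedTensor.tmul A (M := A) 1 (m • n) = BalancedTensor.tmul A (M := A) m n
    rw [← BalancedTensor.op_smul_tmul]; simp

/-- `M ⊗_A A → M`. -/
def tensorRegularHom (M : Bimodule k A) : Hom (M.tensor (regular k A)) M :=
  Hom.mk' (BalancedTensor.lift (A := A) (M := M.carrier) (N := A)
    (AddMonoidHom.mk' (fun m => AddMonoidHom.mk' (fun a => MulOpposite.op a • m)
        fun a b => by rw [MulOpposite.op_add, add_smul])
      fun m m' => by ext a; simp)
    (fun a m b => (smul_comm a (MulOpposite.op b) m).symm)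
    (fun a m b => by simp [mul_smul]))
    fun a => BalancedTensor.hom_ext (M := M.carrier) (N := A) fun m b =>
      mul_smul (MulOpposite.op a) (MulOpposite.op b) m

/-- `M → M ⊗_A A`. -/
def tensorRegularInv (M : Bimodule k A) : Hom M (M.tensor (regular k A)) where
  toLin := M.tmulRight (X := A) 1
  map_op_smul a m := by
    change BalancedTensor.tmul A (N := A) (MulOpposite.op a • m) 1 =
      BalancedTensor.tmul A (N := A) m (MulOpposite.op a • 1)
    rw [BalancedTensor.op_smul_tmul]; simp

theorem inAdd_tensor_regular {M : Bimodule k A} (hM : M ∈ generators k A) :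
    InAdd (generators k A) (M.tensor (regular k A)) := by
  refine InAdd.of_retract hM M.tensorRegularHom M.tensorRegularInv
    (BalancedTensor.hom_ext (M := M.carrier) (N := A) fun m n => ?_)
  change BalancedTensor.tmul A (N := A) (MulOpposite.op n • m) 1 = BalancedTensor.tmul A (N := A) m n
  rw [BalancedTensor.op_smul_tmul]; simp

theorem Outer.hom_ext {M : Type u} [AddCommGroup M] [Module A M] {f g : Outer k A →ₗ[A] M}
    (h : ∀ x y, f (Outer.mk x y) = g (Outer.mk x y)) : f = g := by
  ext t
  induction t using Outer.induction with
  | h0 => rw [map_zero, map_zero]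
  | hadd x y hx hy => rw [map_add, map_add, hx, hy]
  | ht x y => exact h x y

/-- The additive map `x ⊗ y ↦ x f(y)`. -/
def outerLiftAdd {M : Type u} [AddCommGroup M] [Module A M] (f : A →+ M)
    (hf : ∀ (c : k) (y : A), f (c • y) = algebraMap k A c • f y) : Outer k A →+ M :=
  TensorProduct.liftAddHom
    (AddMonoidHom.mk' (fun x => AddMonoidHom.mk' (fun y => x • f y) fun y z => by
      rw [map_add, smul_add]) fun x y => by ext; simp [add_smul])
    (fun c x y => by
      change (c • x) • f y = x • f (c • y)
      rw [hf, Algebra.smul_def, Algebra.commutes, mul_smul])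

/-- The left linear map `x ⊗ y ↦ x f(y)`. -/
def outerLift {M : Type u} [AddCommGroup M] [Module A M] (f : A →+ M)
    (hf : ∀ (c : k) (y : A), f (c • y) = algebraMap k A c • f y) : Outer k A →ₗ[A] M where
  toFun := outerLiftAdd f hf
  map_add' := map_add _
  map_smul' a t := by
    induction t using Outer.induction with
    | h0 => simp
    | hadd x y hx hy => rw [smul_add, map_add, hx, hy, map_add, smul_add]
    | ht x y => exact mul_smul a x _

theorem outerLift_mk {M : Type u} [AddCommGroup M] [Module A M] (f : A →+ M) (hf)
    (x y : A) : outerLift (k := k) f hf (Outer.mk x y) = x • f y := rfl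

theorem Outer.mk_add (x y z : A) : (mk x (y + z) : Outer k A) = mk x y + mk x z :=
  TensorProduct.tmul_add x y z

theorem Outer.add_mk (x y z : A) : (mk (x + y) z : Outer k A) = mk x z + mk y z :=
  TensorProduct.add_tmul x y z

theorem Outer.mk_smul (c : k) (x y : A) : (mk x (c • y) : Outer k A) = algebraMap k A c • mk x y := by
  rw [Outer.smul_mk, ← Algebra.smul_def]
  exact (TensorProduct.smul_tmul c x y).symm

theorem Outer.central (c : k) (t : Outer k A) :
    algebraMap k A c • t = MulOpposite.op (algebraMap k A c) • t :=
  (outer k A).central c t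

/-- `x ⊗ y ↦ (x ⊗ b) ⊗ (1 ⊗ y)`. -/
def outerToTensor (b : A) : Hom (outer k A) ((outer k A).tensor (outer k A)) :=
  Hom.mk' (outerLift
    (AddMonoidHom.mk' (fun y => BalancedTensor.tmul A (Outer.mk 1 b : Outer k A)
        (Outer.mk 1 y : Outer k A)) fun y z => by
      rw [Outer.mk_add, BalancedTensor.tmul_add])
    (fun c y => by
      change BalancedTensor.tmul A (Outer.mk 1 b : Outer k A) (Outer.mk 1 (c • y) : Outer k A) =
        algebraMap k A c • BalancedTensor.tmul A (Outer.mk 1 b : Outer k A)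
          (Outer.mk 1 y : Outer k A)
      rw [Outer.mk_smul, ← BalancedTensor.op_smul_tmul, ← Outer.central,
        BalancedTensor.smul_tmul']))
    fun a => Outer.hom_ext fun x y => rfl

/-- The additive map `z ⊗ w ↦ 1 ⊗ φ(y z) w`. -/
def outerContract (φ : A →ₗ[k] k) (y : A) : Outer k A →+ Outer k A :=
  ((TensorProduct.mk k A A 1) ∘ₗ (TensorProduct.lid k A).toLinearMap ∘ₗ
    LinearMap.rTensor A (φ ∘ₗ LinearMap.mulLeft k y)).toAddMonoidHom

theorem outerContract_mk (φ : A →ₗ[k] k) (y z w : A) :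
    outerContract φ y (Outer.mk z w) = Outer.mk 1 (φ (y * z) • w) := rfl

theorem Outer.addHom_ext {M : Type u} [AddCommGroup M] {f g : Outer k A →+ M}
    (h : ∀ x y, f (Outer.mk x y) = g (Outer.mk x y)) : f = g := by
  ext t
  induction t using Outer.induction with
  | h0 => rw [map_zero, map_zero]
  | hadd x y hx hy => rw [map_add, map_add, hx, hy]
  | ht x y => exact h x y

/-- The map `(x ⊗ y, z ⊗ w) ↦ x ⊗ φ(y z) w`. -/
def outerPair (φ : A →ₗ[k] k) : Outer k A →ₗ[A] (Outer k A →+ Outer k A) :=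
  outerLift (AddMonoidHom.mk' (outerContract φ) fun y y' => Outer.addHom_ext fun z w => by
      rw [AddMonoidHom.add_apply, outerContract_mk, outerContract_mk, outerContract_mk, add_mul,
        map_add, add_smul, Outer.mk_add])
    fun c y => Outer.addHom_ext fun z w => by
      change outerContract φ (c • y) (Outer.mk z w) =
        algebraMap k A c • outerContract φ y (Outer.mk z w)
      rw [outerContract_mk, outerContract_mk, smul_mul_assoc, map_smul, smul_assoc, Outer.mk_smul]

/-- The bimodule homomorphism `(x ⊗ y) ⊗ (z ⊗ w) ↦ x ⊗ φ(y z) w`. -/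
def tensorToOuter (φ : A →ₗ[k] k) : Hom ((outer k A).tensor (outer k A)) (outer k A) :=
  Hom.mk' (BalancedTensor.lift (A := A) (M := Outer k A) (N := Outer k A)
      (outerPair φ).toAddMonoidHom
      (fun a m n => DFunLike.congr_fun ((outerPair φ).map_smul a m) n)
      (fun a m n => by
        change outerPair φ (MulOpposite.op a • m) n = outerPair φ m (a • n)
        induction m using Outer.induction with
        | h0 => simp
        | hadd x y hx hy => simp only [smul_add, map_add, AddMonoidHom.add_apply, hx, hy]
        | ht x y =>
          induction n using Outer.induction with
          | h0 => simp
          | hadd z w hz hw => simp only [smul_add, map_add, hz, hw]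
          | ht z w =>
            change x • Outer.mk 1 (φ ((y * a) * z) • w) = x • Outer.mk 1 (φ (y * (a * z)) • w)
            rw [mul_assoc]))
    fun a => BalancedTensor.hom_ext (M := Outer k A) (N := Outer k A) fun m n => by
      change outerPair φ m (MulOpposite.op a • n) = MulOpposite.op a • outerPair φ m n
      induction m using Outer.induction with
      | h0 => simp
      | hadd x y hx hy => simp only [smul_add, map_add, AddMonoidHom.add_apply, hx, hy]
      | ht x y =>
        induction n using Outer.induction with
        | h0 => simp
        | hadd z w hz hw => simp only [smul_add, map_add, hz, hw]
        | ht z w =>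
          change x • Outer.mk 1 (φ (y * z) • (w * a)) =
            MulOpposite.op a • x • Outer.mk 1 (φ (y * z) • w)
          rw [Outer.smul_mk, Outer.smul_mk, Outer.op_smul_mk, smul_mul_assoc]

theorem inAdd_outer_tensor_outer [FiniteDimensional k A] :
    InAdd (generators k A) ((outer k A).tensor (outer k A)) := by
  let b := Module.finBasis k A
  refine InAdd.of_fintype (ι := Fin (Module.finrank k A)) (fun _ => outer k A)
    (fun _ => Or.inr rfl) (fun t => tensorToOuter (b.coord t)) (fun t => outerToTensor (b t))
    (BalancedTensor.hom_ext (M := Outer k A) (N := Outer k A) fun m n => ?_)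
  rw [LinearMap.sum_apply]
  change ∑ t, (outerToTensor (b t)).toLin (outerPair (b.coord t) m n) =
    BalancedTensor.tmul A m n
  induction m using Outer.induction with
  | h0 => simp [BalancedTensor.zero_tmul]
  | hadd x y hx hy =>
    simp only [map_add, AddMonoidHom.add_apply, Finset.sum_add_distrib, hx, hy,
      BalancedTensor.add_tmul]
  | ht x y =>
    induction n using Outer.induction with
    | h0 => simp [BalancedTensor.tmul_zero]
    | hadd z w hz hw =>
      simp only [map_add, Finset.sum_add_distrib, hz, hw, BalancedTensor.tmul_add]
    | ht z w =>
      have key : ∀ t, (outerToTensor (b t)).toLin (outerPair (b.coord t) (Outer.mk x y)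
          (Outer.mk z w)) = BalancedTensor.tmul A (Outer.mk x (b.coord t (y * z) • b t) : Outer k A)
            (Outer.mk 1 w : Outer k A) := by
        intro t
        change (outerToTensor (b t)).toLin (x • Outer.mk 1 (b.coord t (y * z) • w)) = _
        rw [map_smul]
        change x • (1 : A) • BalancedTensor.tmul A (Outer.mk 1 (b t) : Outer k A)
          (Outer.mk 1 (b.coord t (y * z) • w) : Outer k A) = _
        rw [one_smul, Outer.mk_smul, ← BalancedTensor.op_smul_tmul, ← Outer.central,
          ← Outer.mk_smul, BalancedTensor.smul_tmul', Outer.smul_mk, mul_one]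
      have h2 : ∑ t, (Outer.mk x (b.coord t (y * z) • b t) : Outer k A) = Outer.mk x (y * z) := by
        conv_rhs => rw [← b.sum_repr (y * z)]
        exact (TensorProduct.tmul_sum x _ _).symm
      rw [Finset.sum_congr rfl fun t _ => key t, sum_tmul, h2]
      have : (Outer.mk z w : Outer k A) = z • Outer.mk 1 w := by rw [Outer.smul_mk, mul_one]
      rw [this, ← BalancedTensor.op_smul_tmul, Outer.op_smul_mk]

theorem inAdd_tensor [FiniteDimensional k A] {M N : Bimodule k A}
    (hM : InAdd (generators k A) M) (hN : InAdd (generators k A) N) :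
    InAdd (generators k A) (M.tensor N) := by
  refine InAdd.tensor ?_ hM hN
  rintro X (rfl | rfl) Y hY
  · exact inAdd_regular_tensor hY
  · obtain rfl | rfl := hY
    · exact inAdd_tensor_regular (Or.inr rfl)
    · exact inAdd_outer_tensor_outer

end Bimodule


namespace Bimodule

variable {k : Type v} [Field k] {A : Type u} [Ring A] [Algebra k A]

/-! #### Tensoring with such a bimodule is linear and preserves projective modules -/

instance (M : Bimodule k A) : M.tensorFunctor.Additive where
  map_add {X Y f g} := by
    ext1
    exact BalancedTensor.hom_ext fun m n => BalancedTensor.tmul_add A m (f.hom n) (g.hom n)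

instance (M : Bimodule k A) : M.tensorFunctor.Linear k where
  map_smul {X Y} f c := by
    ext1
    refine BalancedTensor.hom_ext fun m n => ?_
    change BalancedTensor.tmul A m (algebraMap k A c • f.hom n) =
      algebraMap k A c • BalancedTensor.tmul A m (f.hom n)
    rw [← BalancedTensor.op_smul_tmul, ← M.central, BalancedTensor.smul_tmul']

/-- `(A ⊗_k A) ⊗_A P` is a free left `A`-module; we only need that it is projective. -/
theorem projective_outer (P : Type u) [AddCommGroup P] [Module A P] :
    Module.Projective A (BalancedTensor A (outer k A).carrier P) := by
  let _ : Module k P := Module.compHom P (algebraMap k A)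
  have hs : ∀ (c : k) (p : P), c • p = algebraMap k A c • p := fun _ _ => rfl
  let g : A →+ (P →+ A ⊗[k] P) := AddMonoidHom.mk'
    (fun y => AddMonoidHom.mk' (fun p => (1 : A) ⊗ₜ[k] (y • p))
      fun p q => by rw [smul_add, TensorProduct.tmul_add])
    fun y z => by
      ext p
      change (1 : A) ⊗ₜ[k] ((y + z) • p) = (1 : A) ⊗ₜ[k] (y • p) + (1 : A) ⊗ₜ[k] (z • p)
      rw [add_smul, TensorProduct.tmul_add]
  let F : Outer k A →ₗ[A] (P →+ A ⊗[k] P) := outerLift g fun c y => by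
    ext p
    change (1 : A) ⊗ₜ[k] ((c • y) • p) = algebraMap k A c • ((1 : A) ⊗ₜ[k] (y • p))
    rw [TensorProduct.smul_tmul', smul_eq_mul, mul_one, Algebra.algebraMap_eq_smul_one,
      TensorProduct.smul_tmul, hs, ← mul_smul, Algebra.smul_def]
  let i : BalancedTensor A (outer k A).carrier P →ₗ[A] A ⊗[k] P :=
    BalancedTensor.lift (A := A) (M := Outer k A) F.toAddMonoidHom
      (fun a m n => DFunLike.congr_fun (F.map_smul a m) n)
      (fun a m n => by
        change F (MulOpposite.op a • m) n = F m (a • n)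
        induction m using Outer.induction with
        | h0 => simp
        | hadd x y hx hy => simp only [smul_add, map_add, AddMonoidHom.add_apply, hx, hy]
        | ht x y =>
          change x • ((1 : A) ⊗ₜ[k] ((y * a) • n)) = x • ((1 : A) ⊗ₜ[k] (y • a • n))
          rw [mul_smul])
  let r : A ⊗[k] P →ₗ[A] BalancedTensor A (outer k A).carrier P :=
    { toFun := TensorProduct.liftAddHom
        (AddMonoidHom.mk' (fun x => AddMonoidHom.mk'
          (fun p => BalancedTensor.tmul A (Outer.mk x 1 : Outer k A) p)
          (BalancedTensor.tmul_add A _)) fun x y => by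
            ext p
            exact (congrArg (fun t => BalancedTensor.tmul A t p) (Outer.add_mk x y 1)).trans
              (BalancedTensor.add_tmul A _ _ _))
        (fun c x p => by
          change BalancedTensor.tmul A (Outer.mk (c • x) 1 : Outer k A) p =
            BalancedTensor.tmul A (Outer.mk x 1 : Outer k A) (algebraMap k A c • p)
          rw [← BalancedTensor.op_smul_tmul, ← Outer.central, Outer.smul_mk, Algebra.smul_def])
      map_add' := map_add _
      map_smul' := fun a t => by
        induction t using TensorProduct.induction_on with
        | zero => simp
        | tmul x p => exact (BalancedTensor.smul_tmul' A a (Outer.mk x 1 : Outer k A) p).symm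
        | add x y hx hy => rw [smul_add, map_add, hx, hy, map_add, smul_add] }
  refine Module.Projective.of_split i r ?_
  refine BalancedTensor.hom_ext fun m n => ?_
  change Outer k A at m
  change r (F m n) = BalancedTensor.tmul A m n
  induction m using Outer.induction with
  | h0 => simp [BalancedTensor.zero_tmul]
  | hadd x y hx hy =>
    simp only [map_add, AddMonoidHom.add_apply, hx, hy, BalancedTensor.add_tmul]
  | ht x y =>
    change BalancedTensor.tmul A (Outer.mk (x * 1) 1 : Outer k A) (y • n) = _
    rw [← BalancedTensor.op_smul_tmul, Outer.op_smul_mk, mul_one, one_mul]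

theorem InAdd.projective {M : Bimodule k A} (hM : InAdd (generators k A) M) (P : Type u)
    [AddCommGroup P] [Module A P] [Module.Projective A P] :
    Module.Projective A (BalancedTensor A M.carrier P) := by
  obtain ⟨n, Y, s, r, hY, h⟩ := hM
  have : ∀ t, Module.Projective A (BalancedTensor A (Y t).carrier P) := by
    intro t
    have := hY t
    generalize Y t = X at this
    obtain rfl | rfl := this
    · refine Module.Projective.of_split (regularTensorHom (k := k) P) (regularTensorInv P) ?_
      refine BalancedTensor.hom_ext fun (m : A) n => ?_
      change BalancedTensor.tmul A (M := A) 1 (m • n) = BalancedTensor.tmul A (M := A) m n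
      rw [← BalancedTensor.op_smul_tmul]; simp
    · exact projective_outer P
  have : Module.Projective A (∀ t, BalancedTensor A (Y t).carrier P) :=
    Module.Projective.of_equiv' (DFinsupp.linearEquivFunOnFintype (R := A)
      (M := fun t => BalancedTensor A (Y t).carrier P))
  refine Module.Projective.of_split (M := ∀ t, BalancedTensor A (Y t).carrier P)
    (LinearMap.pi fun t => BalancedTensor.map (s t).toLin (s t).map_op_smul LinearMap.id)
    (∑ t, BalancedTensor.map (r t).toLin (r t).map_op_smul LinearMap.id ∘ₗ LinearMap.proj t) ?_
  refine BalancedTensor.hom_ext fun m p => ?_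
  have h1 : ∑ t, (r t).toLin ((s t).toLin m) = m := by
    simpa using DFunLike.congr_fun h m
  rw [LinearMap.comp_apply, LinearMap.sum_apply]
  change ∑ t, BalancedTensor.tmul A ((r t).toLin ((s t).toLin m)) p = BalancedTensor.tmul A m p
  rw [sum_tmul, h1]

end Bimodule

/-! ### Finitely generated modules -/

section FG

variable {A : Type u} [Ring A]

/-- A finitely generated module which is projective among finitely generated modules is
projective. -/
theorem FGModuleCat.moduleProjective (P : FGModuleCat.{u} A) [Projective P] :
    Module.Projective A P.obj := by
  obtain ⟨n, f, hf⟩ := Module.Finite.exists_fin' A P.obj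
  let Q : FGModuleCat.{u} A := ⟨ModuleCat.of A (Fin n → A), by
    change Module.Finite A (Fin n → A); infer_instance⟩
  let g : Q ⟶ P := ObjectProperty.homMk (ModuleCat.ofHom f)
  have hg : Epi g.hom := (ModuleCat.epi_iff_surjective _).2 hf
  have : Epi g := ⟨fun a b hab => by
    apply ObjectProperty.hom_ext
    rw [← cancel_epi g.hom]
    exact congrArg (fun t => t.hom) hab⟩
  refine Module.Projective.of_split (M := Fin n → A) (Projective.factorThru (𝟙 P) g).hom.hom f ?_
  have := Projective.factorThru_comp (𝟙 P) g
  exact congrArg (fun t => t.hom.hom) this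

/-- A finitely generated projective module is projective among finitely generated modules. -/
theorem FGModuleCat.projective_of_module (P : FGModuleCat.{u} A) (h : Module.Projective A P.obj) :
    Projective P where
  factors {E X} f e he := by
    have hs : Function.Surjective e.hom.hom := by
      rw [← LinearMap.range_eq_top]
      let Q : FGModuleCat.{u} A := ⟨ModuleCat.of A (X.obj ⧸ LinearMap.range e.hom.hom), by
        change Module.Finite A (X ⧸ LinearMap.range e.hom.hom); infer_instance⟩
      let q : X ⟶ Q := ObjectProperty.homMk
        (ModuleCat.ofHom (LinearMap.range e.hom.hom).mkQ)
      have : q = ObjectProperty.homMk (ModuleCat.ofHom 0) := by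
        rw [← cancel_epi e]
        ext x
        exact (Submodule.Quotient.mk_eq_zero _).2 ⟨x, rfl⟩
      rw [← Submodule.ker_mkQ (LinearMap.range e.hom.hom)]
      exact LinearMap.ker_eq_top.2 (congrArg (fun t => t.hom.hom) this)
    obtain ⟨g, hg⟩ := Module.projective_lifting_property e.hom.hom f.hom.hom hs
    refine ⟨ObjectProperty.homMk (ModuleCat.ofHom g), ?_⟩
    ext x
    exact DFunLike.congr_fun hg x

end FG

/-! ### Functors given by bimodules in `add (A ⊕ A ⊗_k A)` -/

section

variable (k : Type v) [Field k] {A : Type u} [Ring A] [Algebra k A]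
variable {C : Type w} [SmallCategory C]

/-- Endofunctors of a category `C ≌ A-mod` isomorphic to tensoring with a bimodule in
`add (A ⊕ A ⊗_k A)`. -/
def isProjFunctor (e : C ≌ FGModuleCat.{u} A) : ObjectProperty (C ⥤ C) := fun T =>
  ∃ M : Bimodule k A, M.InAdd (Bimodule.generators k A) ∧
    Nonempty (T ⋙ e.functor ⋙ (ModuleCat.isFG A).ι ≅
      e.functor ⋙ (ModuleCat.isFG A).ι ⋙ M.tensorFunctor)

variable {k} {e : C ≌ FGModuleCat.{u} A}

theorem isProjFunctor_id : isProjFunctor k e (𝟭 C) :=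
  ⟨Bimodule.regular k A, Bimodule.InAdd.of_retract (Or.inl rfl) ⟨LinearMap.id, fun _ _ => rfl⟩
    ⟨LinearMap.id, fun _ _ => rfl⟩ rfl,
    ⟨Functor.isoWhiskerLeft (e.functor ⋙ (ModuleCat.isFG A).ι)
      (Bimodule.tensorFunctorRegular k A).symm⟩⟩

theorem isProjFunctor_comp [FiniteDimensional k A] {T S : C ⥤ C} (hT : isProjFunctor k e T)
    (hS : isProjFunctor k e S) : isProjFunctor k e (T ⋙ S) := by
  obtain ⟨M, hM, ⟨α⟩⟩ := hT
  obtain ⟨N, hN, ⟨β⟩⟩ := hS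
  exact ⟨N.tensor M, Bimodule.inAdd_tensor hN hM,
    ⟨Functor.isoWhiskerLeft T β ≪≫ Functor.isoWhiskerRight α N.tensorFunctor ≪≫
      Functor.isoWhiskerLeft (e.functor ⋙ (ModuleCat.isFG A).ι)
        (Bimodule.tensorFunctorTensor N M)⟩⟩

theorem isProjFunctor.additive [Preadditive C] [e.functor.Additive] {T : C ⥤ C}
    (hT : isProjFunctor k e T) : T.Additive := by
  obtain ⟨M, -, ⟨α⟩⟩ := hT
  have : (T ⋙ e.functor ⋙ (ModuleCat.isFG A).ι).Additive := Functor.additive_of_iso α.symm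
  exact Functor.additive_of_comp_faithful T (e.functor ⋙ (ModuleCat.isFG A).ι)

theorem isProjFunctor.linear [Preadditive C] [Linear k C] [e.functor.Additive]
    [e.functor.Linear k] {T : C ⥤ C} (hT : isProjFunctor k e T) : T.Linear k := by
  have := hT.additive
  obtain ⟨M, -, ⟨α⟩⟩ := hT
  have h := Functor.linear_of_iso k α.symm
  refine ⟨fun {X Y} f c => (e.functor ⋙ (ModuleCat.isFG A).ι).map_injective ?_⟩
  exact (h.map_smul f c).trans
    ((e.functor ⋙ (ModuleCat.isFG A).ι).map_smul c (T.map f)).symm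

theorem isProjFunctor.projective {T : C ⥤ C} (hT : isProjFunctor k e T) {X : C}
    (hX : Projective X) : Projective (T.obj X) := by
  obtain ⟨M, hM, ⟨α⟩⟩ := hT
  rw [← e.map_projective_iff] at hX ⊢
  have := FGModuleCat.moduleProjective (e.functor.obj X)
  have h2 : Module.Projective A
      ((e.functor ⋙ (ModuleCat.isFG A).ι ⋙ M.tensorFunctor).obj X) :=
    hM.projective (e.functor.obj X).obj
  exact FGModuleCat.projective_of_module _ (Module.Projective.of_equiv' (α.app X).toLinearEquiv.symm)

end


/-! ### The 2-category of projective functors -/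

/-- The set of objects of the `2`-category `C_A` of projective functors on a category `C` with an
equivalence `e : C ≌ A-mod`: it has just one object. Its structure is defined below. -/
inductive ProjTwoCat (k : Type v) [Field k] {A : Type u} [Ring A] [Algebra k A]
    {C : Type w} [SmallCategory C] (e : C ≌ FGModuleCat.{u} A) : Type
  | star : ProjTwoCat k e

namespace ProjTwoCat

variable (k : Type v) [Field k] {A : Type u} [Ring A] [Algebra k A] [FiniteDimensional k A]
variable {C : Type w} [SmallCategory C] (e : C ≌ FGModuleCat.{u} A)

/-- `1`-morphisms are the endofunctors of `C` isomorphic to tensoring with a bimodule in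
`add (A ⊕ A ⊗_k A)`, `2`-morphisms are all natural transformations. The composition
`F ≫ G` is "first `F`, then `G`". -/
instance : Bicategory (ProjTwoCat k e) where
  Hom _ _ := (isProjFunctor k e).FullSubcategory
  id _ := ⟨𝟭 C, isProjFunctor_id⟩
  comp F G := ⟨F.obj ⋙ G.obj, isProjFunctor_comp F.property G.property⟩
  homCategory _ _ := inferInstanceAs (Category (isProjFunctor k e).FullSubcategory)
  whiskerLeft F _ _ η := ObjectProperty.homMk (Functor.whiskerLeft F.obj η.hom)
  whiskerRight η F := ObjectProperty.homMk (Functor.whiskerRight η.hom F.obj)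
  associator F G H := (isProjFunctor k e).isoMk (Functor.associator F.obj G.obj H.obj)
  leftUnitor F := (isProjFunctor k e).isoMk F.obj.leftUnitor
  rightUnitor F := (isProjFunctor k e).isoMk F.obj.rightUnitor
  whiskerLeft_id _ _ := by ext; simp
  whiskerLeft_comp _ _ _ _ η θ := by ext; simp
  id_whiskerLeft η := by ext; simp
  comp_whiskerLeft F G _ _ η := by ext; simp
  id_whiskerRight _ _ := by ext; simp
  comp_whiskerRight η θ F := by ext; simp
  whiskerRight_id η := by ext; simp
  whiskerRight_comp η F G := by ext; simp
  whisker_assoc F _ _ η G := by ext; simp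
  whisker_exchange η θ := by ext; simp
  pentagon _ _ _ _ := by ext; simp
  triangle _ _ := by ext; simp

variable [Preadditive C]

instance (a b : ProjTwoCat k e) : Preadditive (a ⟶ b) :=
  inferInstanceAs (Preadditive (isProjFunctor k e).FullSubcategory)

variable [Linear k C]

instance (a b : ProjTwoCat k e) : Linear k (a ⟶ b) :=
  inferInstanceAs (Linear k (isProjFunctor k e).FullSubcategory)

variable [e.functor.Additive] [e.functor.Linear k]

instance : IsLinearBicategory k (ProjTwoCat k e) where
  whiskerLeft_add _ _ _ _ _ := rfl
  add_whiskerRight η θ h := by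
    have := h.property.additive
    apply ObjectProperty.hom_ext
    apply NatTrans.ext
    funext X
    exact h.obj.map_add
  whiskerLeft_smul _ _ _ _ _ := rfl
  smul_whiskerRight r η h := by
    have := h.property.additive
    have := h.property.linear
    apply ObjectProperty.hom_ext
    apply NatTrans.ext
    funext X
    exact h.obj.map_smul r _

/-- The tautological pseudofunctor from `C_A` to categories. -/
def tautologicalPseudofunctor : ProjTwoCat k e ⥤ᵖ Cat.{w, w} where
  obj _ := Cat.of C
  map F := F.obj.toCatHom
  map₂ η := NatTrans.toCatHom₂ η.hom
  map₂_id _ := rfl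
  map₂_comp _ _ := rfl
  mapId _ := Iso.refl _
  mapComp _ _ := Iso.refl _
  map₂_whisker_left F _ _ η := by
    apply Cat.Hom₂.ext
    apply NatTrans.ext
    funext (X : C)
    change η.hom.app (F.obj.obj X) = 𝟙 _ ≫ η.hom.app (F.obj.obj X) ≫ 𝟙 _
    simp
  map₂_whisker_right η F := by
    apply Cat.Hom₂.ext
    apply NatTrans.ext
    funext (X : C)
    change F.obj.map (η.hom.app X) = 𝟙 _ ≫ F.obj.map (η.hom.app X) ≫ 𝟙 _
    simp
  map₂_associator F G H := by
    apply Cat.Hom₂.ext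
    apply NatTrans.ext
    funext (X : C)
    change 𝟙 (H.obj.obj (G.obj.obj (F.obj.obj X))) = 𝟙 _ ≫ H.obj.map (𝟙 _) ≫ 𝟙 _ ≫ 𝟙 _ ≫ 𝟙 _
    simp
  map₂_left_unitor F := by
    apply Cat.Hom₂.ext
    apply NatTrans.ext
    funext (X : C)
    change 𝟙 (F.obj.obj X) = 𝟙 _ ≫ F.obj.map (𝟙 X) ≫ 𝟙 _
    simp
  map₂_right_unitor F := by
    apply Cat.Hom₂.ext
    apply NatTrans.ext
    funext (X : C)
    change 𝟙 (F.obj.obj X) = 𝟙 _ ≫ 𝟙 _ ≫ 𝟙 _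
    simp

instance (i : ProjTwoCat k e) : Preadditive ((tautologicalPseudofunctor k e).obj i) :=
  inferInstanceAs (Preadditive C)

instance (i : ProjTwoCat k e) : Linear k ((tautologicalPseudofunctor k e).obj i) :=
  inferInstanceAs (Linear k C)

/-- The tautological `2`-representation of `C_A` on `C`: a functor acts on `C` by itself. -/
def tautological : TwoRep.{w, w, 0, w, w} k (ProjTwoCat k e) where
  toPseudofunctor := tautologicalPseudofunctor k e
  map_additive F := F.property.additive
  map_linear F := F.property.linear
  map₂_add _ _ _ := rfl
  map₂_smul _ _ _ := rfl

/-- The natural action of `C_A` on the category of projective objects of `C`. -/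
def naturalAction : TwoRep.{w, w, 0, w, w} k (ProjTwoCat k e) :=
  (tautological k e).restrict (fun _ => fun X : C => Projective X)
    fun F _ hX => F.property.projective hX

end ProjTwoCat

/-! ### Connected and basic algebras -/

/-- The algebra `A` is connected (indecomposable as an algebra): it is not zero, and `0` and `1` are
its only central idempotents. -/
def IsConnectedAlgebra (A : Type u) [Ring A] : Prop :=
  Nontrivial A ∧ ∀ z ∈ Subring.center A, IsIdempotentElem z → z = 0 ∨ z = 1

/-- The algebra `A` over the algebraically closed field `k` is basic: modulo its Jacobson radical it
is isomorphic to a product of copies of `k`. -/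
def IsBasicAlgebra (k : Type v) [Field k] (A : Type u) [Ring A] [Algebra k A] : Prop :=
  ∃ n : ℕ, Nonempty ((A ⧸ Ring.jacobson A) ≃ₐ[k] (Fin n → k))

end

noncomputable section

/-! ### Basic algebras -/

/-! Write `G` for a representative of the left cell. Since the two-sided cell misses the identity,
`G` is not isomorphic to it. Natural transformations between functors given by bimodules are the
same as bimodule homomorphisms (`natOfHom_injective`, `natOfHom_surjective`), so `G` corresponds to
a bimodule `M` without nontrivial idempotent endomorphisms. By Fitting's lemma `End M` is local, so
`M` is a summand of `A` or of a column `A ⊗_k eA`, where `e` is one of the primitive idempotents of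
the basic algebra `A`. A nonzero summand of `A` is `A` itself because `A` is connected, and this is
excluded.

Let `V` be the functor given by the column `A ⊗_k eA` and `W` the one given by `A ⊗_k A`. Let `χ` be
the character of `A` belonging to `e`, and let `S` be the object corresponding to the
one-dimensional module on which `A` acts by `χ`. The additive closure of `V` is stable under the
action (`inAdd_tensor_column`), `G` is a summand of `V`, and `V` is a summand of `W ∘ G`
(`column_isRetract`). Hence the subrepresentation attached to the left cell is exactly the additive
closure of `V`. No classification of the indecomposable summands of `V` is needed.

The equivalence is evaluation at `S`. Since `(A ⊗ eA) ⊗_A S ≅ A`, it takes projective values. It is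
full, because endomorphisms of `A` are right multiplications and these lift to the left factor of `A
⊗ eA`. Every projective `P` is the value of `P ⊗ eA`. It remains to see that the transformations
vanishing at `S` form the largest proper stable ideal. Let `f` be an endomorphism of `V` with `f_S ≠
0`. Contracting the left leg of the element defining `f` by a suitable functional gives `b` in `eAe`
with `χ(b) = 1`. Since `b - e` is nilpotent, `b` is invertible in `eAe`, and the identity of `V`
factors through `W(f)` (`exists_contraction`). A stable ideal containing `f` therefore contains the
identity of `V`, and hence everything. This is `le_vanishingIdeal`, from which
`cellTwoRep_equivalent` follows. -/

theorem isUnit_or_isUnit_of_isUnit_add {R : Type*} [Ring R]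
    (h : ∀ x : R, IsUnit x ∨ IsNilpotent x) {a b : R} (hab : IsUnit (a + b)) :
    IsUnit a ∨ IsUnit b := by
  obtain ⟨w, hw⟩ := hab
  -- Dividing by the unit `w = a + b` reduces to a sum equal to `1`; if one term is nilpotent, the
  -- other is `1` minus a nilpotent.
  have h1 : (↑w⁻¹ : R) * a + ↑w⁻¹ * b = 1 := by rw [← mul_add, ← hw, Units.inv_mul]
  rcases h (↑w⁻¹ * a) with h2 | h2
  · left
    simpa using w.isUnit.mul h2
  · right
    have h3 := h2.isUnit_one_sub
    rw [← h1, add_sub_cancel_left] at h3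
    simpa using w.isUnit.mul h3

/-- Such a ring is local; this is the finite-sum form behind the Krull–Schmidt arguments below.
`Nontrivial` rules out the empty sum. -/
theorem exists_isUnit_of_isUnit_sum {R : Type*} [Ring R] [Nontrivial R]
    (h : ∀ x : R, IsUnit x ∨ IsNilpotent x) {ι : Type*} (s : Finset ι) (f : ι → R)
    (hs : IsUnit (∑ i ∈ s, f i)) : ∃ i ∈ s, IsUnit (f i) := by
  classical
  induction s using Finset.induction_on with
  | empty => simp at hs
  | insert a s ha ih =>
    rw [Finset.sum_insert ha] at hs
    rcases isUnit_or_isUnit_of_isUnit_add h hs with h1 | h1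
    · exact ⟨a, Finset.mem_insert_self a s, h1⟩
    · obtain ⟨i, hi, h2⟩ := ih h1
      exact ⟨i, Finset.mem_insert_of_mem hi, h2⟩

/-- The common kernel of a family of characters of an algebra. -/
def charKer {k : Type v} [Field k] {A : Type u} [Ring A] [Algebra k A] {n : ℕ}
    (χ : Fin n → A →ₐ[k] k) : Submodule k A :=
  ⨅ i, LinearMap.ker (χ i).toLinearMap

theorem mem_charKer {k : Type v} [Field k] {A : Type u} [Ring A] [Algebra k A] {n : ℕ}
    {χ : Fin n → A →ₐ[k] k} {a : A} : a ∈ charKer χ ↔ ∀ i, χ i a = 0 := by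
  simp [charKer]

/-- The coordinates of `A / rad A ≅ kⁿ` are the characters, and the standard idempotents of `kⁿ`
lift because the radical of an Artinian ring is nilpotent. The common kernel of the characters is
the radical. -/
theorem IsBasicAlgebra.exists_idempotents {k : Type v} [Field k] {A : Type u} [Ring A]
    [Algebra k A] [FiniteDimensional k A] (h : IsBasicAlgebra k A) :
    ∃ (n : ℕ) (χ : Fin n → A →ₐ[k] k) (e : Fin n → A), CompleteOrthogonalIdempotents e ∧
      (∀ i j, χ i (e j) = if i = j then 1 else 0) ∧ IsNilpotent (charKer χ) := by
  obtain ⟨n, ⟨φ⟩⟩ := h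
  have hArt : IsArtinianRing A := IsArtinianRing.of_finite k A
  let π : A →ₐ[k] (A ⧸ Ring.jacobson A) := Ideal.Quotient.mkₐ k _
  let ψ : A →ₐ[k] (Fin n → k) := φ.toAlgHom.comp π
  let χ : Fin n → A →ₐ[k] k := fun i => (Pi.evalAlgHom k (fun _ => k) i).comp ψ
  have hker : ∀ a, ψ a = 0 ↔ a ∈ Ring.jacobson A := by
    intro a
    change φ (π a) = 0 ↔ _
    rw [map_eq_zero_iff φ φ.injective]
    exact Ideal.Quotient.eq_zero_iff_mem
  have hmem : ∀ a, a ∈ charKer χ ↔ a ∈ Ring.jacobson A := by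
    intro a
    rw [mem_charKer, ← hker, funext_iff]
    rfl
  obtain ⟨N, hN⟩ := IsSemiprimaryRing.isNilpotent (R := A)
  -- Powers of `charKer χ` are powers of `k`-submodules, those of the radical are powers of ideals;
  -- nilpotency is carried over from the latter.
  have hpow : ∀ m, ∀ a ∈ (charKer χ) ^ m, a ∈ (Ring.jacobson A) ^ m := by
    intro m
    induction m with
    | zero => intro a _; rw [Submodule.pow_zero, Ideal.one_eq_top]; trivial
    | succ m ih =>
      intro a ha
      rw [pow_succ] at ha
      rw [Submodule.pow_succ]
      induction ha using Submodule.mul_induction_on' with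
      | mem_mul_mem x hx y hy => exact Ideal.mul_mem_mul (ih x hx) ((hmem y).1 hy)
      | add x _ y _ hx hy => exact add_mem hx hy
  have hsurj : Function.Surjective ψ := φ.surjective.comp Ideal.Quotient.mk_surjective
  -- The kernel of `ψ` is the radical, so orthogonal idempotents lift along `ψ`.
  obtain ⟨e, he, he'⟩ := CompleteOrthogonalIdempotents.lift_of_isNilpotent_ker ψ.toRingHom
    (e := fun i : Fin n => Pi.single i (1 : k))
    (fun x hx => ⟨N, by
      have h1 : x ^ N ∈ (Ring.jacobson A) ^ N := Ideal.pow_mem_pow ((hker x).1 hx) N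
      rw [hN] at h1
      exact h1⟩)
    (CompleteOrthogonalIdempotents.single _) (fun i => hsurj _)
  refine ⟨n, χ, e, he, fun i j => ?_, N, ?_⟩
  · have := congrFun (congrFun he' j) i
    change ψ (e j) i = _ at this
    change ψ (e j) i = _
    rw [this, Pi.single_apply]
  · rw [Submodule.zero_eq_bot, ← le_bot_iff]
    intro a ha
    have := hpow N a ha
    rw [hN] at this
    exact this

/-! ### Bimodule homomorphisms and local endomorphism rings -/

namespace Bimodule

variable {k : Type v} [Field k] {A : Type u} [Ring A] [Algebra k A]

namespace Hom

variable {M N P : Bimodule k A}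

theorem ext {f g : Hom M N} (h : ∀ m, f.toLin m = g.toLin m) : f = g := by
  cases f; cases g
  congr
  exact LinearMap.ext h

variable (M) in
/-- The identity homomorphism. -/
def id : Hom M M := ⟨LinearMap.id, fun _ _ => rfl⟩

end Hom

/-! ### Images of idempotent endomorphisms -/

section Image

variable {M : Bimodule k A} (p : Hom M M)

instance imageRight : Module Aᵐᵒᵖ (LinearMap.range p.toLin) :=
  letI : SMul Aᵐᵒᵖ (LinearMap.range p.toLin) :=
    ⟨fun a x => ⟨a • (x : M.carrier), by
      obtain ⟨_, y, rfl⟩ := x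
      exact ⟨a • y, p.map_op_smul a.unop y⟩⟩⟩
  Function.Injective.module Aᵐᵒᵖ (LinearMap.range p.toLin).subtype.toAddMonoidHom
    Subtype.val_injective fun _ _ => rfl

/-- The image of an endomorphism of a bimodule. -/
def image : Bimodule k A where
  carrier := LinearMap.range p.toLin
  comm := ⟨fun a b x => Subtype.ext (smul_comm a b (x : M.carrier))⟩
  central c x := Subtype.ext (M.central c (x : M.carrier))

/-- The inclusion of the image. -/
def imageIncl : Hom (image p) M := ⟨(LinearMap.range p.toLin).subtype, fun _ _ => rfl⟩

/-- The projection onto the image. -/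
def imageProj : Hom M (image p) := ⟨p.toLin.rangeRestrict, fun a m =>
  Subtype.ext (p.map_op_smul a m)⟩

theorem imageIncl_comp_imageProj : (imageIncl p).comp (imageProj p) = p := rfl

theorem imageProj_comp_imageIncl (hp : p.comp p = p) :
    (imageProj p).comp (imageIncl p) = Hom.id _ := by
  refine Hom.ext ?_
  rintro ⟨_, x, rfl⟩
  refine Subtype.ext ?_
  exact congrArg (fun f : Hom M M => f.toLin x) hp

end Image

/-! ### Endomorphisms of bimodules with trivial idempotents -/

/-- The bimodule is not zero and its only idempotent endomorphisms are `0` and `1`. -/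
def HasTrivialIdempotents (M : Bimodule k A) : Prop :=
  Nontrivial M.carrier ∧
    ∀ p : Hom M M, p.comp p = p → p.toLin = 0 ∨ p.toLin = LinearMap.id

/-- The endomorphism ring of a bimodule. -/
abbrev endSubring (M : Bimodule k A) : Subring (Module.End A M.carrier) :=
  Subring.centralizer (Set.range M.rightMul)

/-- An element of the endomorphism ring as a homomorphism. -/
def homOfEnd {M : Bimodule k A} (x : M.endSubring) : Hom M M :=
  ⟨x.1, fun a m => by
    have := Subring.mem_centralizer_iff.1 x.2 (M.rightMul a) ⟨a, rfl⟩
    exact (DFunLike.congr_fun this m).symm⟩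

/-- A homomorphism as an element of the endomorphism ring. -/
def endOfHom {M : Bimodule k A} (f : Hom M M) : M.endSubring :=
  ⟨f.toLin, by
    rw [Subring.mem_centralizer_iff]
    rintro _ ⟨a, rfl⟩
    ext m
    exact (f.map_op_smul a m).symm⟩

/-- Fitting's lemma: for large `n` the module is `ker xⁿ ⊕ im xⁿ`, and the projection onto the image
is an idempotent bimodule endomorphism, hence `0` or `1`. In the first case `xⁿ = 0`, in the second
`xⁿ` is bijective. -/
theorem HasTrivialIdempotents.isUnit_or_isNilpotent {M : Bimodule k A}
    (h : M.HasTrivialIdempotents) [IsNoetherian A M.carrier] [IsArtinian A M.carrier]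
    (x : M.endSubring) : IsUnit x ∨ IsNilpotent x := by
  -- The condition `n ≥ 1` is needed to pass from invertibility of `xⁿ` to that of `x`.
  obtain ⟨n, hn⟩ := ((LinearMap.eventually_isCompl_ker_pow_range_pow x.1).and
    (Filter.eventually_ge_atTop 1)).exists
  obtain ⟨hc, hn1⟩ := hn
  have hx : ∀ a m, (x ^ n).1 (MulOpposite.op a • m) = MulOpposite.op a • (x ^ n).1 m :=
    fun a m => (homOfEnd (x ^ n)).map_op_smul a m
  set f : Module.End A M.carrier := x.1 ^ n with hf
  have hx' : ∀ a m, f (MulOpposite.op a • m) = MulOpposite.op a • f m := hx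
  -- The Fitting projection comes as a left linear map. It commutes with the right action because
  -- both the kernel and the image of `f` are stable under it, as is seen by decomposing `m = u + f
  -- v`.
  let p : Hom M M := ⟨(LinearMap.range f).projection (LinearMap.ker f) hc.symm, fun a m => by
    have hdec : ∀ m, ∃ u v, f u = 0 ∧ m = u + f v := fun m => by
      have : m ∈ LinearMap.ker f ⊔ LinearMap.range f := by rw [hc.sup_eq_top]; trivial
      obtain ⟨u, hu, _, ⟨v, rfl⟩, rfl⟩ := Submodule.mem_sup.1 this
      exact ⟨u, v, hu, rfl⟩
    have hval : ∀ u v, f u = 0 →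
        (LinearMap.range f).projection (LinearMap.ker f) hc.symm (u + f v) = f v := by
      intro u v hu
      rw [map_add, Submodule.projection_apply_of_mem_left _ (LinearMap.mem_range_self f v)]
      have : (LinearMap.range f).projection (LinearMap.ker f) hc.symm u = 0 := by
        rw [← Submodule.coe_projectionOnto_apply]
        simpa using (Submodule.projectionOnto_apply_eq_zero_iff hc.symm).2 hu
      rw [this, zero_add]
    obtain ⟨u, v, hu, rfl⟩ := hdec m
    rw [hval u v hu, smul_add, ← hx', hval _ _ (by rw [hx', hu, smul_zero])]⟩
  have hpr : LinearMap.range p.toLin = LinearMap.range f := Submodule.range_projection hc.symm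
  have hpp : p.comp p = p := Hom.ext fun m =>
    Submodule.projection_apply_of_mem_left hc.symm
      (hpr.le (LinearMap.mem_range_self p.toLin m))
  rcases h.2 p hpp with h0 | h1
  · right
    refine ⟨n, Subtype.ext ?_⟩
    change f = 0
    rw [← LinearMap.range_eq_bot, ← hpr, h0, LinearMap.range_zero]
  · left
    have hr : LinearMap.range f = ⊤ := by rw [← hpr, h1, LinearMap.range_id]
    have hk : LinearMap.ker f = ⊥ := by
      have := hc.inf_eq_bot
      rwa [hr, inf_top_eq] at this
    have hu : IsUnit (x.1 ^ n) := (Module.End.isUnit_iff _).2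
      ⟨LinearMap.ker_eq_bot.1 hk, LinearMap.range_eq_top.1 hr⟩
    have hu' : IsUnit x.1 := (isUnit_pow_iff (by omega)).1 hu
    obtain ⟨y, hy⟩ := hu'
    -- The inverse of `x` among left linear maps still commutes with right multiplications, so it
    -- lies in the endomorphism ring of the bimodule.
    refine ⟨⟨x, ⟨(↑y⁻¹ : Module.End A M.carrier), ?_⟩, Subtype.ext ?_, Subtype.ext ?_⟩, rfl⟩
    · rw [Subring.mem_centralizer_iff]
      intro g hg
      have : Commute g (y : Module.End A M.carrier) := by
        rw [hy]; exact Subring.mem_centralizer_iff.1 x.2 g hg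
      exact this.units_inv_right
    · change x.1 * ↑y⁻¹ = 1
      rw [← hy, Units.mul_inv]
    · change ↑y⁻¹ * x.1 = 1
      rw [← hy, Units.inv_mul]

/-- If the identity of a bimodule with local endomorphism ring is a sum of endomorphisms, then one
of the summands is invertible. -/
theorem HasTrivialIdempotents.exists_inverse {M : Bimodule k A}
    (h : M.HasTrivialIdempotents) [IsNoetherian A M.carrier] [IsArtinian A M.carrier]
    {ι : Type*} (s : Finset ι) (f : ι → Hom M M) (hs : ∑ i ∈ s, (f i).toLin = LinearMap.id) :
    ∃ i ∈ s, ∃ g : Hom M M, (f i).comp g = Hom.id M ∧ g.comp (f i) = Hom.id M := by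
  have := h.1
  obtain ⟨i, hi, y, hy⟩ := exists_isUnit_of_isUnit_sum h.isUnit_or_isNilpotent s
    (fun i => endOfHom (f i)) (by
      have : ∑ i ∈ s, endOfHom (f i) = 1 := by
        refine Subtype.ext ?_
        rw [AddSubmonoidClass.coe_finsetSum]
        exact hs
      rw [this]; exact isUnit_one)
  refine ⟨i, hi, homOfEnd ↑y⁻¹, Hom.ext fun m => ?_, Hom.ext fun m => ?_⟩
  · have := congrArg (fun z : M.endSubring => z.1 m) y.mul_inv
    rw [hy] at this
    exact this
  · have := congrArg (fun z : M.endSubring => z.1 m) y.inv_mul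
    rw [hy] at this
    exact this

end Bimodule


namespace Bimodule

variable {k : Type v} [Field k] {A : Type u} [Ring A] [Algebra k A]

/-! ### The bimodules `P ⊗_k A` -/

section Induced

variable (k A)
variable (P : Type u) [AddCommGroup P] [Module k P] [Module A P] [IsScalarTower k A P]

/-- The space `P ⊗_k A` underlying the bimodule of the same name. -/
def InducedSpace : Type u := P ⊗[k] A

instance : AddCommGroup (InducedSpace k A P) := inferInstanceAs (AddCommGroup (P ⊗[k] A))

instance : Module A (InducedSpace k A P) := inferInstanceAs (Module A (P ⊗[k] A))

instance : Module Aᵐᵒᵖ (InducedSpace k A P) where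
  smul a t := (LinearMap.lTensor P (LinearMap.mulRight k a.unop) : P ⊗[k] A →ₗ[k] P ⊗[k] A) t
  one_smul t := by
    change LinearMap.lTensor P (LinearMap.mulRight k (1 : A)) t = t
    rw [LinearMap.mulRight_one, LinearMap.lTensor_id]; rfl
  mul_smul a b t := by
    change LinearMap.lTensor P (LinearMap.mulRight k (b.unop * a.unop)) t =
      LinearMap.lTensor P (LinearMap.mulRight k a.unop)
        (LinearMap.lTensor P (LinearMap.mulRight k b.unop) t)
    rw [LinearMap.mulRight_mul, LinearMap.lTensor_comp]; rfl
  smul_zero a := map_zero _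
  smul_add a := map_add _
  add_smul a b t := by
    change LinearMap.lTensor P (LinearMap.mulRight k (a.unop + b.unop)) t =
      LinearMap.lTensor P (LinearMap.mulRight k a.unop) t +
        LinearMap.lTensor P (LinearMap.mulRight k b.unop) t
    have : LinearMap.mulRight k (a.unop + b.unop) =
      LinearMap.mulRight k a.unop + LinearMap.mulRight k b.unop := by
        ext x; simp [mul_add]
    rw [this, LinearMap.lTensor_add]; rfl
  zero_smul t := by
    change LinearMap.lTensor P (LinearMap.mulRight k (0 : A)) t = 0
    rw [LinearMap.mulRight_zero_eq_zero, LinearMap.lTensor_zero]; rfl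

variable {P}

/-- The element `p ⊗ y`. -/
def InducedSpace.mk (p : P) (y : A) : InducedSpace k A P := p ⊗ₜ[k] y

variable {k A}

theorem InducedSpace.induction {q : InducedSpace k A P → Prop} (t : InducedSpace k A P)
    (h0 : q 0) (hadd : ∀ x y, q x → q y → q (x + y)) (ht : ∀ x y, q (mk k A x y)) : q t :=
  TensorProduct.induction_on (motive := q) t h0 ht hadd

theorem InducedSpace.smul_mk (a : A) (p : P) (y : A) : a • mk k A p y = mk k A (a • p) y := rfl

theorem InducedSpace.op_smul_mk (a : A) (p : P) (y : A) :
    MulOpposite.op a • mk k A p y = mk k A p (y * a) := rfl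

theorem InducedSpace.mk_smul (c : k) (p : P) (y : A) :
    mk k A p (c • y) = mk k A (c • p) y := (TensorProduct.smul_tmul c p y).symm

theorem InducedSpace.hom_ext {M : Type u} [AddCommGroup M] [Module A M]
    {f g : InducedSpace k A P →ₗ[A] M} (h : ∀ x y, f (mk k A x y) = g (mk k A x y)) : f = g := by
  ext t
  induction t using InducedSpace.induction with
  | h0 => rw [map_zero, map_zero]
  | hadd x y hx hy => rw [map_add, map_add, hx, hy]
  | ht x y => exact h x y

variable (k A P)

/-- The bimodule `P ⊗_k A`. -/
abbrev induced : Bimodule k A where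
  carrier := InducedSpace k A P
  comm := ⟨fun a b t => by
    induction t using InducedSpace.induction with
    | h0 => simp
    | hadd x y hx hy => simp only [smul_add, hx, hy]
    | ht x y => rfl⟩
  central c t := by
    induction t using InducedSpace.induction with
    | h0 => simp
    | hadd x y hx hy => simp only [smul_add, hx, hy]
    | ht x y =>
      rw [InducedSpace.smul_mk, InducedSpace.op_smul_mk, ← Algebra.commutes, ← Algebra.smul_def,
        InducedSpace.mk_smul, algebraMap_smul]

variable {k A P}
variable {P' : Type u} [AddCommGroup P'] [Module k P'] [Module A P'] [IsScalarTower k A P']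

/-- The left linear map `p ⊗ y ↦ g p ⊗ c y`. -/
def inducedLin (g : P →ₗ[A] P') (c : A) : InducedSpace k A P →ₗ[A] InducedSpace k A P' :=
  (TensorProduct.AlgebraTensorModule.map g (LinearMap.mulLeft k c) : P ⊗[k] A →ₗ[A] P' ⊗[k] A)

/-- The homomorphism `p ⊗ y ↦ g p ⊗ c y`. -/
def inducedMap (g : P →ₗ[A] P') (c : A) : Hom (induced k A P) (induced k A P') :=
  Hom.mk' (inducedLin g c) fun a => InducedSpace.hom_ext fun x y => by
    change g x ⊗ₜ[k] (c * (y * a)) = g x ⊗ₜ[k] (c * y * a)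
    rw [mul_assoc]

end Induced

variable (k) in
/-- The endomorphism `x ⊗ y ↦ x a ⊗ c y` of `A ⊗_k A`. -/
def outerEnd (a c : A) : Hom (outer k A) (outer k A) :=
  inducedMap (P := A) (P' := A) (LinearMap.toSpanSingleton A A a) c

theorem outerEnd_mk (a c x y : A) :
    (outerEnd k a c).toLin (Outer.mk x y) = Outer.mk (x * a) (c * y) := rfl

/-- `A ⊗_k A` is generated by `1 ⊗ 1` as a bimodule. -/
theorem outer_hom_ext {M : Bimodule k A} {f g : Hom (outer k A) M}
    (h : f.toLin (Outer.mk 1 1 : Outer k A) = g.toLin (Outer.mk 1 1 : Outer k A)) : f = g := by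
  refine Hom.ext fun t => DFunLike.congr_fun (Outer.hom_ext fun x y => ?_) t
  have : (Outer.mk x y : Outer k A) = x • MulOpposite.op y • Outer.mk 1 1 := by
    rw [Outer.op_smul_mk, Outer.smul_mk, mul_one, one_mul]
  rw [this]
  calc f.toLin (x • MulOpposite.op y • (Outer.mk 1 1 : Outer k A))
      = x • MulOpposite.op y • f.toLin (Outer.mk 1 1 : Outer k A) :=
        (f.toLin.map_smul x _).trans (congrArg (x • ·) (f.map_op_smul y _))
    _ = x • MulOpposite.op y • g.toLin (Outer.mk 1 1 : Outer k A) := by rw [h]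
    _ = g.toLin (x • MulOpposite.op y • (Outer.mk 1 1 : Outer k A)) :=
        ((g.toLin.map_smul x _).trans (congrArg (x • ·) (g.map_op_smul y _))).symm

theorem outerEnd_comp (a c a' c' : A) :
    (outerEnd k a c).comp (outerEnd k a' c') = outerEnd k (a' * a) (c * c') :=
  outer_hom_ext (by
    change (outerEnd k a c).toLin ((outerEnd k a' c').toLin (Outer.mk 1 1)) = _
    rw [outerEnd_mk, outerEnd_mk, outerEnd_mk, one_mul, one_mul, mul_one, mul_one])

/-! ### Indecomposable bimodules in `add (A ⊕ A ⊗_k A)` -/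

theorem finite_outer [FiniteDimensional k A] : Module.Finite A (Outer k A) :=
  inferInstanceAs (Module.Finite A (A ⊗[k] A))

/-- Over the Artinian ring `A` this supplies the chain conditions required by Fitting's lemma, and
it lets the tensor functor preserve finitely generated modules. -/
theorem InAdd.finite [FiniteDimensional k A] {M : Bimodule k A} (hM : InAdd (generators k A) M) :
    Module.Finite A M.carrier := by
  obtain ⟨n, Y, s, r, hY, h⟩ := hM
  have : ∀ t, Module.Finite A (Y t).carrier := by
    intro t
    have := hY t
    generalize Y t = X at this
    obtain rfl | rfl := this
    · exact inferInstanceAs (Module.Finite A A)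
    · exact finite_outer
  refine Module.Finite.of_surjective
    (∑ t, (r t).toLin ∘ₗ LinearMap.proj t : (∀ t, (Y t).carrier) →ₗ[A] M.carrier) fun m => ?_
  refine ⟨fun t => (s t).toLin m, ?_⟩
  have := DFunLike.congr_fun h m
  simpa using this

/-- A bimodule with local endomorphism ring in `add (A ⊕ A ⊗_k A)` is a direct summand of `A` or of
`A ⊗_k e_j A` for some `j`. -/
theorem InAdd.regular_or_outer [FiniteDimensional k A] {M : Bimodule k A}
    (hM : InAdd (generators k A) M) (h : M.HasTrivialIdempotents) {n : ℕ} {e : Fin n → A}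
    (he : CompleteOrthogonalIdempotents e) :
    (∃ (s : Hom M (regular k A)) (r : Hom (regular k A) M), r.comp s = Hom.id M) ∨
    ∃ (j : Fin n) (s : Hom M (outer k A)) (r : Hom (outer k A) M), r.comp s = Hom.id M ∧
      (outerEnd k 1 (e j)).comp s = s ∧ r.comp (outerEnd k 1 (e j)) = r := by
  have := hM.finite
  have : IsArtinianRing A := IsArtinianRing.of_finite k A
  obtain ⟨m, Y, s, r, hY, hsum⟩ := hM
  obtain ⟨X, s, r, hX, g, hg⟩ : ∃ (X : Bimodule k A) (s : Hom M X) (r : Hom X M),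
      X ∈ generators k A ∧ ∃ g : Hom M M, (r.comp s).comp g = Hom.id M := by
    -- The identity of `M` is the sum of the `r t ∘ s t`. By locality one of them is invertible, so
    -- `M` is a summand of a single generator.
    obtain ⟨t, -, g, hg, -⟩ := h.exists_inverse Finset.univ (fun t => (r t).comp (s t)) hsum
    exact ⟨Y t, s t, r t, hY t, g, hg⟩
  obtain rfl | rfl := hX
  · exact Or.inl ⟨s.comp g, r, hg⟩
  · right
    -- The decomposition `1 = ∑ e_j` acts on the right factor and splits `A ⊗ A` into columns; a
    -- second use of locality then selects one column.
    have hid : ∑ j, (outerEnd k 1 (e j)).toLin = LinearMap.id := by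
      refine Outer.hom_ext fun x y => ?_
      rw [LinearMap.sum_apply]
      change ∑ j, (x * 1) ⊗ₜ[k] (e j * y) = x ⊗ₜ[k] y
      rw [mul_one, ← TensorProduct.tmul_sum, ← Finset.sum_mul, he.complete, one_mul]
    obtain ⟨j, -, g', hg', -⟩ := h.exists_inverse Finset.univ
      (fun j => ((r.comp (outerEnd k 1 (e j))).comp s).comp g) (by
        refine Eq.trans (LinearMap.ext fun m => ?_) (congrArg Hom.toLin hg)
        rw [LinearMap.sum_apply]
        change ∑ j, r.toLin ((outerEnd k 1 (e j)).toLin (s.toLin (g.toLin m))) =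
          r.toLin (s.toLin (g.toLin m))
        rw [← map_sum, ← LinearMap.sum_apply, hid]
        rfl)
    have hee : (outerEnd k 1 (e j)).comp (outerEnd k 1 (e j)) = outerEnd k 1 (e j) := by
      rw [outerEnd_comp, mul_one, (he.idem j).eq]
    -- The idempotent is inserted into both the inclusion and the projection, so that each of them
    -- absorbs it.
    refine ⟨j, (outerEnd k 1 (e j)).comp ((s.comp g).comp g'), r.comp (outerEnd k 1 (e j)),
      ?_, ?_, ?_⟩
    · refine Eq.trans ?_ hg'
      change (r.comp ((outerEnd k 1 (e j)).comp (outerEnd k 1 (e j)))).comp ((s.comp g).comp g') = _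
      rw [hee]
      rfl
    · change ((outerEnd k 1 (e j)).comp (outerEnd k 1 (e j))).comp ((s.comp g).comp g') = _
      rw [hee]
    · change r.comp ((outerEnd k 1 (e j)).comp (outerEnd k 1 (e j))) = _
      rw [hee]

end Bimodule


/-! ### Summands of the regular bimodule, and endomorphisms of `A ⊗_k e A` -/

namespace Bimodule

variable {k : Type v} [Field k] {A : Type u} [Ring A] [Algebra k A]

/-- The idempotent endomorphism `s ∘ r` of the regular bimodule is both left and right
multiplication by `z`, the image of `1`. So `z` is a central idempotent, and by connectedness `0` or
`1`; the value `0` would make `M` zero. -/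
theorem comp_eq_id_of_connected (hA : IsConnectedAlgebra A) {M : Bimodule k A}
    (hM : Nontrivial M.carrier) {s : Hom M (regular k A)} {r : Hom (regular k A) M}
    (h : r.comp s = Hom.id M) : s.comp r = Hom.id _ := by
  let q : Hom (regular k A) (regular k A) := s.comp r
  have hq : q.comp q = q := by
    change s.comp ((r.comp s).comp r) = _
    rw [h]; rfl
  let z : A := q.toLin (1 : A)
  have hl : ∀ a : A, q.toLin a = a * z := fun a => by
    have := q.toLin.map_smul a (1 : A)
    rwa [smul_eq_mul, mul_one] at this
  have hr : ∀ a : A, q.toLin a = z * a := fun a => by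
    have := q.map_op_smul a (1 : A)
    change q.toLin ((1 : A) * a) = z * a at this
    rwa [one_mul] at this
  have hz : IsIdempotentElem z := by
    have h1 : q.toLin (q.toLin (1 : A)) = q.toLin (1 : A) := congrArg (fun f => f.toLin (1 : A)) hq
    exact (hl z).symm.trans h1
  rcases hA.2 z (Subring.mem_center_iff.2 fun a => (hl a).symm.trans (hr a)) hz with h0 | h1
  · exfalso
    obtain ⟨m, hm⟩ := exists_ne (0 : M.carrier)
    apply hm
    have hrs : ∀ m, r.toLin (s.toLin m) = m := fun m => congrArg (fun f => f.toLin m) h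
    have h2 : s.toLin (r.toLin (s.toLin m)) = 0 := (hl (s.toLin m)).trans (by rw [h0, mul_zero])
    rw [hrs] at h2
    rw [← hrs m, h2, map_zero]
  · exact Hom.ext fun a => (hl a).trans (by rw [h1, mul_one]; rfl)

/-- The left linear map `x ⊗ y ↦ χ(y) x`. -/
def outerChar (χ : A →ₐ[k] k) : Outer k A →ₗ[A] A :=
  outerLift (((Algebra.linearMap k A).comp χ.toLinearMap).toAddMonoidHom) fun c y => by
    change algebraMap k A (χ (c • y)) = algebraMap k A c * algebraMap k A (χ y)
    rw [map_smul, smul_eq_mul, map_mul]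

theorem outerChar_mk (χ : A →ₐ[k] k) (x y : A) :
    outerChar χ (Outer.mk x y) = x * algebraMap k A (χ y) := rfl

/-- The map `x ⊗ y ↦ φ(x) y`. -/
def outerFunctional (φ : A →ₗ[k] k) : Outer k A →+ A :=
  ((TensorProduct.lid k A).toLinearMap ∘ₗ LinearMap.rTensor A φ : A ⊗[k] A →ₗ[k] A).toAddMonoidHom

theorem outerFunctional_mk (φ : A →ₗ[k] k) (x y : A) :
    outerFunctional φ (Outer.mk x y) = φ x • y := rfl

/-- The data of a primitive idempotent `e` and the corresponding character `χ`. -/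
structure IsPrimitivePair (χ : A →ₐ[k] k) (e : A) (J : Submodule k A) : Prop where
  idem : IsIdempotentElem e
  nilp : IsNilpotent J
  char_eq : χ e = 1
  corner_mem : ∀ y, e * y * e - algebraMap k A (χ y) * e ∈ J

variable {χ : A →ₐ[k] k} {e : A} {J : Submodule k A}

/-- A radical argument. If `1 ⊗ χ` kills `p(1 ⊗ 1)`, then `p(1 ⊗ 1)` lies in `A ⊗ J`, so each
application of `p` gains a factor `J`. As `p` is idempotent, its image lies in `A ⊗ Jᵐ` for all `m`,
hence is zero. -/
theorem IsPrimitivePair.eq_zero (he : IsPrimitivePair χ e J) {p : Hom (outer k A) (outer k A)}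
    (hp : p.comp p = p) (h1 : (outerEnd k 1 e).comp p = p) (h2 : p.comp (outerEnd k 1 e) = p)
    (h0 : outerChar χ (p.toLin (Outer.mk 1 1 : Outer k A)) = 0) : p.toLin = 0 := by
  -- `K I` is the image of `A ⊗ I` in `A ⊗ A`.
  let K : Submodule k A → Submodule A (Outer k A) :=
    fun I => Submodule.span A {t | ∃ y ∈ I, t = Outer.mk 1 y}
  have hmk : ∀ (I : Submodule k A) x y, y ∈ I → (Outer.mk x y : Outer k A) ∈ K I := fun I x y hy => by
    have : (Outer.mk x y : Outer k A) = x • Outer.mk 1 y := by rw [Outer.smul_mk, mul_one]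
    rw [this]
    exact Submodule.smul_mem _ _ (Submodule.subset_span ⟨y, hy, rfl⟩)
  -- Modulo `A ⊗ J`, multiplying the right leg by `e` on both sides replaces `y` by `χ(y) e`. For
  -- `t₀`, which is fixed by both multiplications, only the character value remains.
  have hψ : ∀ t : Outer k A, (outerEnd k 1 e).toLin (MulOpposite.op e • t) -
      outerChar χ t • (Outer.mk 1 e : Outer k A) ∈ K J := by
    intro t
    induction t using Outer.induction with
    | h0 => rw [smul_zero, map_zero, map_zero, zero_smul, sub_zero]; exact zero_mem _
    | hadd x y hx hy =>
      rw [smul_add, map_add, map_add, add_smul, add_sub_add_comm]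
      exact add_mem hx hy
    | ht x y =>
      rw [outerChar_mk, Outer.op_smul_mk]
      erw [outerEnd_mk]
      have : (Outer.mk (x * 1) (e * (y * e)) : Outer k A) -
          (x * algebraMap k A (χ y)) • (Outer.mk 1 e : Outer k A) =
          Outer.mk x (e * y * e - algebraMap k A (χ y) * e) := by
        rw [sub_eq_iff_eq_add, mul_smul, ← Outer.mk_smul, Algebra.smul_def, Outer.smul_mk,
          mul_one,
          ← Outer.mk_add, sub_add_cancel, mul_assoc]
      rw [this]
      exact hmk J _ _ (he.corner_mem y)
  set t₀ : Outer k A := p.toLin (Outer.mk 1 1 : Outer k A) with ht₀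
  have ht1 : (outerEnd k 1 e).toLin t₀ = t₀ := congrArg (fun f => f.toLin (Outer.mk 1 1)) h1
  have ht2 : MulOpposite.op e • t₀ = t₀ := by
    have := congrArg (fun f : Hom (outer k A) (outer k A) => f.toLin (Outer.mk 1 1)) h2
    refine Eq.trans (p.map_op_smul e _).symm (Eq.trans ?_ this)
    change p.toLin (Outer.mk 1 (1 * e)) = p.toLin (Outer.mk (1 * 1) (e * 1))
    rw [one_mul, mul_one, mul_one]
  have hK1 : t₀ ∈ K J := by
    have := hψ t₀
    rwa [ht2, ht1, h0, zero_smul, sub_zero] at this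
  have hop : ∀ I : Submodule k A, ∀ y ∈ I, ∀ t ∈ K J, MulOpposite.op y • t ∈ K (J * I) := by
    intro I y hy t ht
    induction ht using Submodule.span_induction with
    | mem t ht =>
      obtain ⟨z, hz, rfl⟩ := ht
      rw [Outer.op_smul_mk]
      exact hmk _ _ _ (Submodule.mul_mem_mul hz hy)
    | zero => rw [smul_zero]; exact zero_mem _
    | add x y _ _ hx hy => rw [smul_add]; exact add_mem hx hy
    | smul a x _ hx =>
      rw [← smul_comm]
      exact Submodule.smul_mem _ _ hx
  -- Here `p(1 ⊗ y) = p(1 ⊗ 1) y`, and `p(1 ⊗ 1)` is in `K J`.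
  have hstep : ∀ I, ∀ t ∈ K I, p.toLin t ∈ K (J * I) := by
    intro I t ht
    induction ht using Submodule.span_induction with
    | mem t ht =>
      obtain ⟨y, hy, rfl⟩ := ht
      have h3 : (Outer.mk 1 y : Outer k A) = MulOpposite.op y • Outer.mk 1 1 := by
        rw [Outer.op_smul_mk, one_mul]
      rw [h3]
      have h4 := hop I y hy t₀ hK1
      rw [ht₀] at h4
      exact (p.map_op_smul y (Outer.mk 1 1 : Outer k A)).symm ▸ h4
    | zero => rw [map_zero]; exact zero_mem _
    | add x y _ _ hx hy => rw [map_add]; exact add_mem hx hy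
    | smul a x _ hx => rw [map_smul]; exact Submodule.smul_mem _ _ hx
  -- Since `p t = p (p t)`, the previous step can be iterated; the factor `⊤` lets the induction
  -- start at `m = 0`.
  have hall : ∀ m t, p.toLin t ∈ K (J ^ m * ⊤) := by
    intro m
    induction m with
    | zero =>
      intro t
      have : ∀ w : Outer k A, w ∈ K (J ^ 0 * ⊤) := by
        intro w
        induction w using Outer.induction with
        | h0 => exact zero_mem _
        | hadd x y hx hy => exact add_mem hx hy
        | ht x y => exact hmk _ _ _ (by rw [pow_zero, one_mul]; trivial)
      exact this _
    | succ m ih =>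
      intro t
      have := hstep _ _ (ih t)
      rwa [← mul_assoc, ← pow_succ', show p.toLin (p.toLin t) = p.toLin t from congrArg (fun f => f.toLin t) hp] at this
  obtain ⟨N, hN⟩ := he.nilp
  ext t
  have h6 := hall N t
  have h7 : K (J ^ N * ⊤) = ⊥ := by
    rw [eq_bot_iff]
    refine Submodule.span_le.2 ?_
    rintro _ ⟨y, hy, rfl⟩
    rw [hN, zero_mul] at hy
    have : y = 0 := hy
    subst this
    exact TensorProduct.tmul_zero A (1 : A)
  rw [h7] at h6
  exact h6

/-- Inserting `1 ⊗ 1` in the middle, applying `f` to the second factor and contracting the middle by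
`φ` sends `x ⊗ y` to `x ⊗ b y`, where `b = (φ ⊗ 1)(f(1 ⊗ 1))`. If `φ` is chosen with `χ(b) = 1`,
then `b` is invertible in `eAe`, and `c` undoes it. -/
theorem IsPrimitivePair.exists_contraction (he : IsPrimitivePair χ e J)
    {f : Hom (outer k A) (outer k A)}
    (h1 : (outerEnd k 1 e).comp f = f) (h2 : f.comp (outerEnd k 1 e) = f)
    (h0 : outerChar χ (f.toLin (Outer.mk 1 1 : Outer k A)) ≠ 0) :
    ∃ (φ : A →ₗ[k] k) (c : A), (outerEnd k 1 c).comp ((tensorToOuter φ).comp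
      ((Hom.tensor (Hom.id (outer k A)) f).comp (outerToTensor 1))) = outerEnd k 1 e := by
  set t₀ : Outer k A := f.toLin (Outer.mk 1 1 : Outer k A) with ht₀
  have ht1 : (outerEnd k 1 e).toLin t₀ = t₀ := congrArg (fun f => f.toLin (Outer.mk 1 1)) h1
  have ht2 : MulOpposite.op e • t₀ = t₀ := by
    have := congrArg (fun f : Hom (outer k A) (outer k A) => f.toLin (Outer.mk 1 1)) h2
    refine Eq.trans (f.map_op_smul e _).symm (Eq.trans ?_ this)
    change f.toLin (Outer.mk 1 (1 * e)) = f.toLin (Outer.mk (1 * 1) (e * 1))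
    rw [one_mul, mul_one, mul_one]
  -- Over a field a nonzero vector takes the value `1` under some functional; below `χ(b)` turns out
  -- to be exactly this value.
  obtain ⟨φ, hφ⟩ : ∃ φ : A →ₗ[k] k, φ (outerChar χ t₀) = 1 :=
    Module.Projective.exists_dual_eq_one k h0
  let b : A := outerFunctional φ t₀
  have hb1 : e * b = b := by
    have : ∀ t : Outer k A, outerFunctional φ ((outerEnd k 1 e).toLin t) =
        e * outerFunctional φ t := by
      intro t
      induction t using Outer.induction with
      | h0 => rw [map_zero, map_zero, mul_zero]
      | hadd x y hx hy => rw [map_add, map_add, map_add, hx, hy, mul_add]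
      | ht x y =>
        change φ (x * 1) • (e * y) = e * (φ x • y)
        rw [mul_one, mul_smul_comm]
    have h := this t₀
    rw [ht1] at h
    exact h.symm
  have hb2 : b * e = b := by
    have : ∀ t : Outer k A, outerFunctional φ (MulOpposite.op e • t) =
        outerFunctional φ t * e := by
      intro t
      induction t using Outer.induction with
      | h0 => rw [smul_zero, map_zero, zero_mul]
      | hadd x y hx hy => rw [smul_add, map_add, map_add, hx, hy, add_mul]
      | ht x y =>
        change φ x • (y * e) = (φ x • y) * e
        rw [smul_mul_assoc]
    have h := this t₀
    rw [ht2] at h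
    exact h.symm
  have hb3 : χ b = 1 := by
    have : ∀ t : Outer k A, χ (outerFunctional φ t) = φ (outerChar χ t) := by
      intro t
      induction t using Outer.induction with
      | h0 => rw [map_zero, map_zero, map_zero, map_zero]
      | hadd x y hx hy => rw [map_add, map_add, map_add, map_add, hx, hy]
      | ht x y =>
        rw [outerFunctional_mk, outerChar_mk, map_smul, ← Algebra.commutes, ← Algebra.smul_def,
          map_smul, smul_eq_mul, smul_eq_mul, mul_comm]
    rw [this, hφ]
  -- Because `b = e b e` and `χ(b) = 1`, the element `b - e` lies in the nilpotent `J`.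
  have hz : IsNilpotent (b - e) := by
    have hmem : b - e ∈ J := by
      have := he.corner_mem b
      rwa [hb1, hb2, hb3, map_one, one_mul] at this
    obtain ⟨N, hN⟩ := he.nilp
    refine ⟨N, ?_⟩
    have := Submodule.pow_mem_pow J hmem N
    rw [hN] at this
    exact this
  obtain ⟨w, hw⟩ := hz.isUnit_one_add
  refine ⟨φ, ↑w⁻¹, ?_⟩
  -- With `w = 1 + (b - e)` one has `w e = b`, so the inverse of `w` in `A` serves as an inverse of
  -- `b` in the corner.
  have hcb : (↑w⁻¹ : A) * b = e := by
    have h3 : (w : A) * e = b := by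
      rw [hw, add_mul, one_mul, sub_mul, hb2, he.idem.eq, add_sub_cancel]
    rw [← h3, ← mul_assoc, Units.inv_mul, one_mul]
  have key : (tensorToOuter φ).comp ((Hom.tensor (Hom.id (outer k A)) f).comp (outerToTensor 1)) =
      outerEnd k 1 b := by
    refine outer_hom_ext ?_
    have h4 : ∀ t : Outer k A, outerPair φ (Outer.mk 1 1) t = Outer.mk 1 (outerFunctional φ t) := by
      intro t
      induction t using Outer.induction with
      | h0 => rw [map_zero, map_zero]; exact (TensorProduct.tmul_zero A (1 : A)).symm
      | hadd x y hx hy => rw [map_add, map_add, hx, hy, Outer.mk_add]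
      | ht x y =>
        change (1 : A) • (Outer.mk 1 (φ (1 * x) • y) : Outer k A) = Outer.mk 1 (φ x • y)
        rw [one_smul, one_mul]
    change (tensorToOuter φ).toLin ((Hom.tensor (Hom.id (outer k A)) f).toLin
      ((1 : A) • BalancedTensor.tmul A (Outer.mk 1 1 : Outer k A) (Outer.mk 1 1 : Outer k A))) = _
    rw [one_smul]
    change outerPair φ (Outer.mk 1 1) t₀ = (Outer.mk (1 * 1) (b * 1) : Outer k A)
    rw [h4, mul_one, mul_one]
  rw [key, outerEnd_comp, mul_one, hcb]

end Bimodule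


namespace Bimodule

variable {k : Type v} [Field k] {A : Type u} [Ring A] [Algebra k A]

/-! ### Modules given by characters -/

/-- `X` is the one-dimensional module given by the character `χ`, with basis vector `x₀` and
coordinate function `κ`. -/
structure IsCharModule (χ : A →ₐ[k] k) {X : Type u} [AddCommGroup X] [Module A X] (x₀ : X)
    (κ : X →+ k) : Prop where
  coord_smul : ∀ a x, κ (a • x) = χ a * κ x
  coord_basis : κ x₀ = 1
  eq_smul : ∀ x, x = algebraMap k A (κ x) • x₀

/-- The module is `A / ker χ`, with `χ` itself as coordinate function. -/
theorem exists_isCharModule (χ : A →ₐ[k] k) :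
    ∃ κ : (A ⧸ RingHom.ker χ) →+ k, IsCharModule χ (Submodule.Quotient.mk (1 : A)) κ := by
  let κ : (A ⧸ RingHom.ker χ) →+ k :=
    QuotientAddGroup.lift (Submodule.toAddSubgroup (RingHom.ker χ)) χ.toRingHom.toAddMonoidHom
      fun x hx => hx
  have hκ : ∀ a : A, κ (Submodule.Quotient.mk a) = χ a := fun a => rfl
  refine ⟨κ, ?_, ?_, ?_⟩
  · intro a x
    obtain ⟨y, rfl⟩ := Submodule.Quotient.mk_surjective _ x
    rw [← Submodule.Quotient.mk_smul, hκ, hκ, smul_eq_mul, map_mul]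
  · rw [hκ, map_one]
  · intro x
    obtain ⟨y, rfl⟩ := Submodule.Quotient.mk_surjective _ x
    rw [← Submodule.Quotient.mk_smul, hκ, smul_eq_mul, mul_one]
    refine (Submodule.Quotient.eq _).2 ?_
    change χ (y - algebraMap k A (χ y)) = 0
    rw [map_sub, AlgHom.commutes]
    exact sub_self _

theorem IsCharModule.of_equiv {χ : A →ₐ[k] k} {X Y : Type u} [AddCommGroup X] [Module A X]
    [AddCommGroup Y] [Module A Y] {x₀ : X} {κ : X →+ k} (h : IsCharModule χ x₀ κ) (φ : X ≃ₗ[A] Y) :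
    IsCharModule χ (φ x₀) (κ.comp φ.symm.toLinearMap.toAddMonoidHom) where
  coord_smul a y := by
    change κ (φ.symm (a • y)) = χ a * κ (φ.symm y)
    rw [map_smul, h.coord_smul]
  coord_basis := by
    change κ (φ.symm (φ x₀)) = 1
    rw [φ.symm_apply_apply, h.coord_basis]
  eq_smul y := by
    change y = algebraMap k A (κ (φ.symm y)) • φ x₀
    rw [← map_smul, ← h.eq_smul, φ.apply_symm_apply]

theorem IsCharModule.smul_basis {χ : A →ₐ[k] k} {X : Type u} [AddCommGroup X] [Module A X]
    {x₀ : X} {κ : X →+ k} (h : IsCharModule χ x₀ κ) (a : A) :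
    a • x₀ = algebraMap k A (χ a) • x₀ := by
  have := h.eq_smul (a • x₀)
  rwa [h.coord_smul, h.coord_basis, mul_one] at this

section

variable (P : Type u) [AddCommGroup P] [Module k P] [Module A P] [IsScalarTower k A P]

/-- The left linear map `p ⊗ y ↦ χ(y) p`. -/
def inducedChar (χ : A →ₐ[k] k) : InducedSpace k A P →ₗ[A] P :=
  ((TensorProduct.AlgebraTensorModule.rid k A P).toLinearMap ∘ₗ
    TensorProduct.AlgebraTensorModule.map LinearMap.id χ.toLinearMap : P ⊗[k] A →ₗ[A] P)

theorem inducedChar_mk (χ : A →ₐ[k] k) (p : P) (y : A) :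
    inducedChar P χ (InducedSpace.mk k A p y) = χ y • p := rfl

theorem inducedChar_op_smul (χ : A →ₐ[k] k) (a : A) (t : InducedSpace k A P) :
    inducedChar P χ (MulOpposite.op a • t) = χ a • inducedChar P χ t := by
  induction t using InducedSpace.induction with
  | h0 => rw [smul_zero, map_zero, smul_zero]
  | hadd x y hx hy => rw [smul_add, map_add, map_add, smul_add, hx, hy]
  | ht x y =>
    rw [InducedSpace.op_smul_mk, inducedChar_mk, inducedChar_mk, map_mul, mul_smul, smul_comm]

variable {χ : A →ₐ[k] k} {X : Type u} [AddCommGroup X] [Module A X] {x₀ : X} {κ : X →+ k}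

/-- `(P ⊗_k A) ⊗_A X ≅ P` if `X` is one-dimensional. -/
def inducedTensorEquiv (h : IsCharModule χ x₀ κ) :
    BalancedTensor A (induced k A P).carrier X ≃ₗ[A] P :=
  LinearEquiv.ofLinearMap
    (BalancedTensor.lift (A := A)
      (AddMonoidHom.mk' (fun t => AddMonoidHom.mk' (fun x => κ x • inducedChar P χ t)
        fun x y => by rw [map_add, add_smul]) fun s t => by ext x; simp)
      (fun a t x => by
        change κ x • inducedChar P χ (a • t) = a • κ x • inducedChar P χ t
        rw [map_smul, smul_comm])
      (fun a t x => by
        change κ x • inducedChar P χ (MulOpposite.op a • t) = κ (a • x) • inducedChar P χ t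
        rw [inducedChar_op_smul, h.coord_smul, mul_comm, mul_smul]))
    { toFun p := BalancedTensor.tmul A (M := InducedSpace k A P) (InducedSpace.mk k A p 1) x₀
      map_add' p q := by
        rw [← BalancedTensor.add_tmul]
        exact congrArg (fun t => BalancedTensor.tmul A (M := InducedSpace k A P) t x₀)
          (TensorProduct.add_tmul p q (1 : A))
      map_smul' a p :=
        (BalancedTensor.smul_tmul' A a (InducedSpace.mk k A p 1) x₀).symm }
    (by
      ext p
      change κ x₀ • χ 1 • p = p
      rw [h.coord_basis, map_one, one_smul, one_smul])
    (by
      refine BalancedTensor.hom_ext fun t x => ?_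
      change BalancedTensor.tmul A (M := InducedSpace k A P)
        (InducedSpace.mk k A (κ x • inducedChar P χ t) 1) x₀ = BalancedTensor.tmul A t x
      change InducedSpace k A P at t
      induction t using InducedSpace.induction with
      | h0 =>
        rw [map_zero, smul_zero, BalancedTensor.zero_tmul]
        exact (congrArg (fun t => BalancedTensor.tmul A (M := InducedSpace k A P) t x₀)
          (TensorProduct.zero_tmul P (1 : A))).trans (BalancedTensor.zero_tmul A _)
      | hadd s t hs ht =>
        rw [BalancedTensor.add_tmul, ← hs, ← ht, map_add, smul_add, ← BalancedTensor.add_tmul]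
        exact congrArg (fun t => BalancedTensor.tmul A (M := InducedSpace k A P) t x₀)
          (TensorProduct.add_tmul _ _ (1 : A))
      | ht p y =>
        -- The right leg `y` is moved across the tensor sign, where it acts on the one-dimensional
        -- `X` by the scalar `χ(y)`; the scalar is then moved back to the left leg.
        have hx : y • x = algebraMap k A (κ x * χ y) • x₀ := by
          have := h.eq_smul (y • x)
          rwa [h.coord_smul, mul_comm] at this
        have h1 : InducedSpace.mk k A p y = MulOpposite.op y • InducedSpace.mk k A p 1 := by
          rw [InducedSpace.op_smul_mk, one_mul]
        rw [inducedChar_mk, h1, BalancedTensor.op_smul_tmul, hx, ← BalancedTensor.op_smul_tmul,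
          InducedSpace.op_smul_mk, one_mul, ← mul_smul, ← InducedSpace.mk_smul, Algebra.smul_def,
          mul_one])

end

section

variable {χ : A →ₐ[k] k} {X : Type u} [AddCommGroup X] [Module A X] {x₀ : X} {κ : X →+ k}

/-- `outer k A` is `induced k A A` by definition, and the inverse of `inducedTensorEquiv A h` sends
`a` to `(a ⊗ 1) ⊗ x₀`. -/
theorem IsCharModule.outer_eq_tmul (h : IsCharModule χ x₀ κ)
    (z : BalancedTensor A (outer k A).carrier X) :
    ∃ a : A, z = BalancedTensor.tmul A (Outer.mk a 1 : Outer k A) x₀ :=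
  ⟨inducedTensorEquiv A h z, ((inducedTensorEquiv A h).symm_apply_apply z).symm⟩

/-- The right leg of `t` acts on `x₀` through `χ`, so tensoring with `X` sees only `outerChar χ t`.
-/
theorem IsCharModule.tmul_eq (h : IsCharModule χ x₀ κ) (t : Outer k A) :
    BalancedTensor.tmul A t x₀ = BalancedTensor.tmul A (Outer.mk (outerChar χ t) 1 : Outer k A) x₀ := by
  induction t using Outer.induction with
  | h0 =>
    rw [map_zero, BalancedTensor.zero_tmul]
    exact ((congrArg (fun t => BalancedTensor.tmul A (M := Outer k A) t x₀)
      (TensorProduct.zero_tmul A (1 : A))).trans (BalancedTensor.zero_tmul A _)).symm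
  | hadd s t hs ht =>
    rw [BalancedTensor.add_tmul, hs, ht, map_add, ← BalancedTensor.add_tmul, Outer.add_mk]
  | ht x y =>
    have h1 : (Outer.mk x y : Outer k A) = MulOpposite.op y • Outer.mk x 1 := by
      rw [Outer.op_smul_mk, one_mul]
    conv_lhs => rw [h1]
    rw [BalancedTensor.op_smul_tmul, h.smul_basis, ← BalancedTensor.op_smul_tmul, ← Outer.central,
      Outer.smul_mk, outerChar_mk, Algebra.commutes]

/-- The map induced by a bimodule homomorphism on tensor products with `X`. -/
def Hom.rTensor {M N : Bimodule k A} (f : Hom M N) (X : Type u) [AddCommGroup X] [Module A X] :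
    BalancedTensor A M.carrier X →ₗ[A] BalancedTensor A N.carrier X :=
  BalancedTensor.map f.toLin f.map_op_smul LinearMap.id

/-- `(A ⊗ A) ⊗_A X` is generated by `(1 ⊗ 1) ⊗ x₀`, whose image depends only on the character value
of `f(1 ⊗ 1)`. -/
theorem IsCharModule.rTensor_eq_zero (h : IsCharModule χ x₀ κ) {f : Hom (outer k A) (outer k A)}
    (hf : outerChar χ (f.toLin (Outer.mk 1 1 : Outer k A)) = 0) : f.rTensor X = 0 := by
  ext z
  obtain ⟨a, rfl⟩ := h.outer_eq_tmul z
  change BalancedTensor.tmul A (f.toLin (Outer.mk a 1 : Outer k A)) x₀ = 0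
  have h1 : (Outer.mk a 1 : Outer k A) = a • Outer.mk 1 1 := by
    rw [Outer.smul_mk, mul_one]
  rw [h1, map_smul, ← BalancedTensor.smul_tmul']
  refine (congrArg (a • ·) (h.tmul_eq _)).trans ?_
  rw [hf, BalancedTensor.smul_tmul', Outer.smul_mk, mul_zero]
  exact (congrArg (fun t => BalancedTensor.tmul A (M := Outer k A) t x₀)
      (TensorProduct.zero_tmul A (1 : A))).trans (BalancedTensor.zero_tmul A _)

/-- `(A ⊗ A) ⊗_A X` is free of rank one, so `g` is a right multiplication, and right multiplication
on the left leg is a bimodule map. This is the source of fullness of evaluation. -/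
theorem IsCharModule.rTensor_surjective (h : IsCharModule χ x₀ κ)
    (g : BalancedTensor A (outer k A).carrier X →ₗ[A] BalancedTensor A (outer k A).carrier X) :
    ∃ a : A, (outerEnd k a 1).rTensor X = g := by
  obtain ⟨a, ha⟩ := h.outer_eq_tmul (g (BalancedTensor.tmul A (Outer.mk 1 1 : Outer k A) x₀))
  refine ⟨a, LinearMap.ext fun z => ?_⟩
  obtain ⟨b, rfl⟩ := h.outer_eq_tmul z
  change BalancedTensor.tmul A (Outer.mk (b * a) (1 * 1) : Outer k A) x₀ = _
  have h1 : (BalancedTensor.tmul A (Outer.mk b 1 : Outer k A) x₀) =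
      b • BalancedTensor.tmul A (Outer.mk 1 1 : Outer k A) x₀ := by
    rw [BalancedTensor.smul_tmul', Outer.smul_mk, mul_one]
  refine Eq.trans ?_ (congrArg g h1).symm
  rw [map_smul, ha, BalancedTensor.smul_tmul', Outer.smul_mk, mul_one]

/-- The factor `e` crosses to `X` and acts there by `χ(e) = 1`; thus cutting `P ⊗ A` down to `P ⊗
eA` does not change the value at `X`. -/
theorem IsCharModule.rTensor_inducedMap (h : IsCharModule χ x₀ κ) {P : Type u} [AddCommGroup P]
    [Module k P] [Module A P] [IsScalarTower k A P] {e : A} (he : χ e = 1) :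
    (inducedMap (k := k) (LinearMap.id : P →ₗ[A] P) e).rTensor X = LinearMap.id := by
  ext z
  obtain ⟨p, rfl⟩ := (inducedTensorEquiv P h).symm.surjective z
  change BalancedTensor.tmul A (InducedSpace.mk k A p (e * 1)) x₀ =
    BalancedTensor.tmul A (InducedSpace.mk k A p 1) x₀
  have h1 : InducedSpace.mk k A p (e * 1) = MulOpposite.op e • InducedSpace.mk k A p 1 := by
    rw [InducedSpace.op_smul_mk, one_mul, mul_one]
  rw [h1, BalancedTensor.op_smul_tmul, h.smul_basis, he, map_one, one_smul]

end

/-! ### The bimodules `P ⊗_k e A` -/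

theorem InAdd.of_retract_inAdd {S : Set (Bimodule k A)} {M Y : Bimodule k A} (hY : InAdd S Y)
    (s : Hom M Y) (r : Hom Y M) (h : r.comp s = Hom.id M) : InAdd S M :=
  InAdd.of_inAdd (ι := Unit) (fun _ => Y) (fun _ => hY) (fun _ => s) (fun _ => r)
    (by rw [Fintype.sum_unique]; exact congrArg Hom.toLin h)

section

variable (k A)

theorem inAdd_outer : InAdd (generators k A) (outer k A) :=
  InAdd.of_retract (Or.inr rfl) (Hom.id _) (Hom.id _) rfl

variable {k A}

/-- A dual basis: `P` is a summand of `Aⁿ`, and the splitting is read off coordinate by coordinate.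
-/
theorem exists_sum_comp_eq_id (P : Type u) [AddCommGroup P] [Module A P] [Module.Finite A P] [Module.Projective A P] :
    ∃ (n : ℕ) (g : Fin n → P →ₗ[A] A) (f : Fin n → A →ₗ[A] P),
      ∑ t, f t ∘ₗ g t = LinearMap.id := by
  obtain ⟨n, f, g, -, -, h⟩ := Module.Finite.exists_comp_eq_id_of_projective A P
  refine ⟨n, fun t => LinearMap.proj t ∘ₗ g, fun t => f ∘ₗ LinearMap.single A (fun _ => A) t, ?_⟩
  refine Eq.trans (LinearMap.ext fun p => ?_) h
  rw [LinearMap.sum_apply]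
  change ∑ t, f (Pi.single t (g p t)) = f (g p)
  rw [← map_sum, Finset.univ_sum_single]

end

end Bimodule


/-! ### Natural transformations of tensor functors -/

namespace Bimodule

variable {k : Type v} [Field k] {A : Type u} [Ring A] [Algebra k A]

/-- The natural transformation given by a bimodule homomorphism. -/
def tensorMap {M N : Bimodule k A} (f : Hom M N) : M.tensorFunctor ⟶ N.tensorFunctor where
  app X := ModuleCat.ofHom (f.rTensor X)
  naturality X Y g := by
    ext1
    exact BalancedTensor.hom_ext fun m x => rfl

theorem tensorMap_id (M : Bimodule k A) : tensorMap (Hom.id M) = 𝟙 _ := by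
  ext X : 2
  ext1
  exact BalancedTensor.hom_ext fun m x => rfl

theorem tensorMap_comp {M N P : Bimodule k A} (g : Hom N P) (f : Hom M N) :
    tensorMap (g.comp f) = tensorMap f ≫ tensorMap g := by
  ext X : 2
  ext1
  exact BalancedTensor.hom_ext fun m x => rfl

/-- Naturality of associativity in the middle bimodule; it identifies whiskering with tensoring by
an identity in `whiskerRight_natOfHom`. -/
theorem tensorMap_tensor {M N : Bimodule k A} (Q : Bimodule k A) (f : Hom M N) :
    Functor.whiskerRight (tensorMap f) Q.tensorFunctor ≫ (tensorFunctorTensor Q N).hom =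
      (tensorFunctorTensor Q M).hom ≫ tensorMap (Hom.tensor (Hom.id Q) f) := by
  ext X : 2
  ext1
  refine BalancedTensor.hom_ext fun q t => ?_
  change BalancedTensor A M.carrier X at t
  induction t using BalancedTensor.induction with
  | h0 =>
    erw [BalancedTensor.tmul_zero, map_zero]
  | hadd s t hs ht =>
    erw [BalancedTensor.tmul_add, map_add, map_add, hs, ht]
  | ht m x => rfl

theorem sum_tensorMap {M : Bimodule k A} {n : ℕ} {Y : Fin n → Bimodule k A}
    (s : ∀ t, Hom M (Y t)) (r : ∀ t, Hom (Y t) M)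
    (h : ∑ t, (r t).toLin ∘ₗ (s t).toLin = LinearMap.id) :
    ∑ t, tensorMap (s t) ≫ tensorMap (r t) = 𝟙 M.tensorFunctor := by
  ext X : 2
  have key : ∑ t, (r t).rTensor X ∘ₗ (s t).rTensor X =
      (LinearMap.id : BalancedTensor A M.carrier X →ₗ[A] _) := by
    refine BalancedTensor.hom_ext fun m x => ?_
    rw [LinearMap.sum_apply]
    change ∑ t, BalancedTensor.tmul A ((r t).toLin ((s t).toLin m)) x = BalancedTensor.tmul A m x
    rw [sum_tmul]
    have := DFunLike.congr_fun h m
    rw [LinearMap.sum_apply] at this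
    exact congrArg (fun m => BalancedTensor.tmul A m x) this
  rw [NatTrans.app_sum]
  ext1
  rw [ModuleCat.hom_sum]
  exact key

/-- A surjection `Aⁿ → N` induces one from `Mⁿ` onto `M ⊗_A N`. -/
theorem finite_balancedTensor (M : Bimodule k A) [Module.Finite A M.carrier] (N : Type u)
    [AddCommGroup N] [Module A N] [Module.Finite A N] :
    Module.Finite A (BalancedTensor A M.carrier N) := by
  obtain ⟨n, f, hf⟩ := Module.Finite.exists_fin' A N
  let x : Fin n → N := fun i => f (Pi.single i 1)
  have hx : ∀ v, f v = ∑ i, v i • x i := fun v => by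
    conv_lhs => rw [pi_eq_sum_univ v]
    rw [map_sum]
    refine Finset.sum_congr rfl fun i _ => ?_
    rw [map_smul]
    congr 2
    ext j
    rw [Pi.single_apply]
    simp [eq_comm]
  refine Module.Finite.of_surjective
    (∑ i, M.tmulRight (x i) ∘ₗ LinearMap.proj i : (Fin n → M.carrier) →ₗ[A] _) fun t => ?_
  induction t using BalancedTensor.induction with
  | h0 => exact ⟨0, map_zero _⟩
  | hadd s t hs ht =>
    obtain ⟨s, rfl⟩ := hs
    obtain ⟨t, rfl⟩ := ht
    exact ⟨s + t, map_add _ _ _⟩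
  | ht m y =>
    obtain ⟨v, rfl⟩ := hf y
    refine ⟨fun i => MulOpposite.op (v i) • m, ?_⟩
    rw [LinearMap.sum_apply]
    change ∑ i, BalancedTensor.tmul A (MulOpposite.op (v i) • m) (x i) = _
    rw [hx, ← tmul_sum]
    exact Finset.sum_congr rfl fun i _ => BalancedTensor.op_smul_tmul A _ _ _

end Bimodule

/-! ### Endofunctors of `C` realized by bimodules, and Eilenberg–Watts -/

section Realization

variable {k : Type v} [Field k] {A : Type u} [Ring A] [Algebra k A]
variable {C : Type w} [SmallCategory C] (e : C ≌ FGModuleCat.{u} A)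

/-- The fully faithful functor from `C` to all `A`-modules. -/
abbrev toMod : C ⥤ ModuleCat.{u} A := e.functor ⋙ (ModuleCat.isFG A).ι

/-- Realizations of an endofunctor as tensoring with a bimodule. -/
abbrev Realization (T : C ⥤ C) (M : Bimodule k A) :=
  T ⋙ e.functor ⋙ (ModuleCat.isFG A).ι ≅ e.functor ⋙ (ModuleCat.isFG A).ι ⋙ M.tensorFunctor

/-- Tensoring with `M` preserves finitely generated modules, so it can be restricted to them and
conjugated by `e`. -/
theorem exists_realization [FiniteDimensional k A] {M : Bimodule k A}
    (hM : M.InAdd (Bimodule.generators k A)) : ∃ T : C ⥤ C, Nonempty (Realization e T M) := by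
  have := hM.finite
  let F : FGModuleCat.{u} A ⥤ FGModuleCat.{u} A :=
    (ModuleCat.isFG A).lift ((ModuleCat.isFG A).ι ⋙ M.tensorFunctor) fun X => by
      have : Module.Finite A X.obj := X.property
      exact M.finite_balancedTensor X.obj
  exact ⟨e.functor ⋙ F ⋙ e.inverse, ⟨Functor.isoWhiskerLeft (e.functor ⋙ F)
    (Functor.isoWhiskerRight e.counitIso (ModuleCat.isFG A).ι)⟩⟩

theorem exists_iso_of_finite (X : Type u) [AddCommGroup X] [Module A X] [Module.Finite A X] :
    ∃ R : C, Nonempty ((toMod e).obj R ≅ ModuleCat.of A X) :=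
  ⟨e.inverse.obj ⟨ModuleCat.of A X, ‹_›⟩,
    ⟨(ModuleCat.isFG A).ι.mapIso (e.counitIso.app ⟨ModuleCat.of A X, ‹_›⟩)⟩⟩

variable {e}
variable {T S U H : C ⥤ C} {M N P Q : Bimodule k A}
  (α : Realization e T M) (β : Realization e S N) (γ : Realization e U P) (δ : Realization e H Q)

/-- The natural transformation of endofunctors of `C` given by a bimodule homomorphism. -/
def natOfHom (f : Bimodule.Hom M N) : T ⟶ S where
  app X := (toMod e).preimage
    (α.hom.app X ≫ (Bimodule.tensorMap f).app ((toMod e).obj X) ≫ β.inv.app X)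
  naturality X Y g := (toMod e).map_injective (by
    rw [Functor.map_comp, Functor.map_comp, Functor.map_preimage, Functor.map_preimage]
    have h1 := α.hom.naturality g
    have h2 := (Bimodule.tensorMap f).naturality ((toMod e).map g)
    have h3 := β.inv.naturality g
    dsimp at h1 h2 h3 ⊢
    rw [reassoc_of% h1, reassoc_of% h2, Category.assoc, Category.assoc, h3])

theorem map_natOfHom_app (f : Bimodule.Hom M N) (X : C) :
    (toMod e).map ((natOfHom α β f).app X) =
      α.hom.app X ≫ (Bimodule.tensorMap f).app ((toMod e).obj X) ≫ β.inv.app X :=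
  (toMod e).map_preimage _

theorem natOfHom_id : natOfHom α α (Bimodule.Hom.id M) = 𝟙 T := by
  ext X
  apply (toMod e).map_injective
  rw [map_natOfHom_app, Bimodule.tensorMap_id]
  simp

theorem natOfHom_comp (f : Bimodule.Hom M N) (g : Bimodule.Hom N P) :
    natOfHom α β f ≫ natOfHom β γ g = natOfHom α γ (g.comp f) := by
  ext X
  apply (toMod e).map_injective
  rw [NatTrans.comp_app, Functor.map_comp, map_natOfHom_app, map_natOfHom_app, map_natOfHom_app,
    Bimodule.tensorMap_comp]
  simp

variable (k e) in
/-- The category `C` contains a free module of rank one. -/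
theorem exists_generator : ∃ (R : C) (x : (toMod e).obj R),
    (∀ N : Bimodule k A, Function.Bijective (N.tmulRight x)) ∧
    ∀ (X : C) (y : (toMod e).obj X), ∃ g : R ⟶ X, (toMod e).map g x = y := by
  obtain ⟨R, ⟨ξ⟩⟩ := exists_iso_of_finite e A
  have h1 : ξ.hom (ξ.inv (1 : A)) = (1 : A) := by
    rw [← ModuleCat.comp_apply, ξ.inv_hom_id]; rfl
  refine ⟨R, ξ.inv (1 : A), fun N => ⟨?_, fun t => ?_⟩, fun X y => ?_⟩
  -- The left inverse identifies `R` with `A` by `ξ` and then uses `N ⊗_A A → N`.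
  · refine Function.LeftInverse.injective
      (g := fun t => N.tensorRegularHom.toLin ((Bimodule.tensorFunctor N).map ξ.hom t)) fun n => ?_
    change MulOpposite.op (ξ.hom (ξ.inv (1 : A))) • n = n
    rw [h1]
    exact one_smul _ n
  · induction t using BalancedTensor.induction with
    | h0 => exact ⟨0, map_zero _⟩
    | hadd s t hs ht =>
      obtain ⟨s, rfl⟩ := hs
      obtain ⟨t, rfl⟩ := ht
      exact ⟨s + t, map_add _ _ _⟩
    | ht n y =>
      -- Every `y` equals `ξ(y) x`, and the coefficient moves to the left of the tensor sign.
      refine ⟨MulOpposite.op (ξ.hom y : A) • n, ?_⟩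
      refine (BalancedTensor.op_smul_tmul A _ n _).trans ?_
      rw [← map_smul, smul_eq_mul, mul_one, ← ModuleCat.comp_apply, ξ.hom_inv_id]
      rfl
  · refine ⟨(toMod e).preimage (ξ.hom ≫ ModuleCat.ofHom (LinearMap.toSpanSingleton A _ y)), ?_⟩
    rw [Functor.map_preimage, ModuleCat.comp_apply, h1]
    exact one_smul A y

/-- The component at the free module of rank one recovers the bimodule map. -/
theorem natOfHom_injective : Function.Injective (natOfHom α β) := by
  intro f g h
  obtain ⟨R, x, hx, -⟩ := exists_generator k e
  have h1 := congrArg (fun η => (toMod e).map (NatTrans.app η R)) h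
  simp only [map_natOfHom_app] at h1
  rw [cancel_epi, cancel_mono] at h1
  refine Bimodule.Hom.ext fun m => (hx N).1 ?_
  exact congrArg (fun φ => ModuleCat.Hom.hom φ (BalancedTensor.tmul A m x)) h1

/-- The uniqueness half of Eilenberg–Watts: the component at the free module `R` gives a left linear
map `F`, and naturality along maps `R ⟶ X` determines all other components, since every element of
`X` is the image of the generator. -/
theorem natOfHom_surjective : Function.Surjective (natOfHom α β) := by
  intro η
  obtain ⟨R, x, hx, hx'⟩ := exists_generator k e
  let φ : ∀ X, M.tensorFunctor.obj ((toMod e).obj X) ⟶ N.tensorFunctor.obj ((toMod e).obj X) :=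
    fun X => α.inv.app X ≫ (toMod e).map (η.app X) ≫ β.hom.app X
  have hφ : ∀ {X Y : C} (g : X ⟶ Y), M.tensorFunctor.map ((toMod e).map g) ≫ φ Y =
      φ X ≫ N.tensorFunctor.map ((toMod e).map g) := by
    intro X Y g
    have h1 := α.inv.naturality g
    have h2 := congrArg (toMod e).map (η.naturality g)
    have h3 := β.hom.naturality g
    dsimp at h1 h2 h3
    dsimp [φ]
    rw [reassoc_of% h1, Category.assoc, Category.assoc, ← h3]
    rw [Functor.map_comp, Functor.map_comp] at h2
    dsimp at h2
    rw [reassoc_of% h2]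
  let F : M.carrier →ₗ[A] N.carrier :=
    (LinearEquiv.ofBijective (N.tmulRight x) (hx N)).symm.toLinearMap ∘ₗ
      (φ R).hom ∘ₗ M.tmulRight x
  have hF : ∀ m, φ R (BalancedTensor.tmul A m x) = BalancedTensor.tmul A (F m) x := fun m =>
    ((LinearEquiv.ofBijective (N.tmulRight x) (hx N)).apply_symm_apply _).symm
  have hF' : ∀ X m (y : (toMod e).obj X),
      φ X (BalancedTensor.tmul A m y) = BalancedTensor.tmul A (F m) y := by
    intro X m y
    obtain ⟨g, rfl⟩ := hx' X y
    refine (congrArg (fun t => ModuleCat.Hom.hom t (BalancedTensor.tmul A m x)) (hφ g)).trans ?_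
    refine (congrArg (fun t => (N.tensorFunctor.map ((toMod e).map g)).hom t) (hF m)).trans ?_
    rfl
  -- Right linearity comes from naturality: the formula `hF'` is applied at `X = R` to the element
  -- `a • x` in place of `x`.
  let f : Bimodule.Hom M N := ⟨F, fun a m => (hx N).1 (by
    refine (hF (MulOpposite.op a • m)).symm.trans ?_
    rw [BalancedTensor.op_smul_tmul, hF', ← BalancedTensor.op_smul_tmul]
    rfl)⟩
  refine ⟨f, ?_⟩
  ext X
  apply (toMod e).map_injective
  rw [map_natOfHom_app]
  have : (Bimodule.tensorMap f).app ((toMod e).obj X) = φ X := by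
    ext1
    exact BalancedTensor.hom_ext fun m y => (hF' X m y).symm
  rw [this]
  simp [φ]

/-- The realization of a composition by a tensor product. -/
def Realization.comp : Realization e (T ⋙ H) (Q.tensor M) :=
  Functor.isoWhiskerLeft T δ ≪≫ Functor.isoWhiskerRight α Q.tensorFunctor ≪≫
      Functor.isoWhiskerLeft (e.functor ⋙ (ModuleCat.isFG A).ι)
        (Bimodule.tensorFunctorTensor Q M)

/-- Pasting of three commutative squares, used in `whiskerRight_natOfHom`. -/
theorem comp_eq_comp_of_squares {D : Type*} [Category* D] {X₀ X₁ X₂ X₃ X₄ X₅ Y₂ Y₄ : D}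
    {a : X₀ ⟶ X₁} {d : X₁ ⟶ X₂} {d' : X₀ ⟶ Y₂} {q : Y₂ ⟶ X₂} {b : X₂ ⟶ X₃} {a' : Y₂ ⟶ X₄}
    {m : X₄ ⟶ X₃} {n : X₃ ⟶ X₅} {n' : X₄ ⟶ Y₄} {m' : Y₄ ⟶ X₅} (h₁ : a ≫ d = d' ≫ q)
    (h₂ : q ≫ b = a' ≫ m) (h₃ : m ≫ n = n' ≫ m') :
    a ≫ d ≫ b ≫ n = (d' ≫ a' ≫ n') ≫ m' := by
  rw [reassoc_of% h₁, reassoc_of% h₂, h₃, Category.assoc, Category.assoc]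

/-- Three naturality squares are pasted: that of `δ`, the defining square of `natOfHom α β f` with
`Q ⊗ -` applied, and that of associativity. -/
theorem whiskerRight_natOfHom (f : Bimodule.Hom M N) :
    Functor.whiskerRight (natOfHom α β f) H =
      natOfHom (Realization.comp α δ) (Realization.comp β δ)
        (Bimodule.Hom.tensor (Bimodule.Hom.id Q) f) := by
  ext X
  apply (toMod e).map_injective
  rw [map_natOfHom_app]
  refine Eq.trans ?_ (Category.assoc _ _ _)
  refine (Iso.eq_comp_inv ((Realization.comp β δ).app X)).2 ?_
  have h1 := δ.hom.naturality ((natOfHom α β f).app X)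
  have h2 := congrArg (fun t => NatTrans.app t ((toMod e).obj X)) (Bimodule.tensorMap_tensor Q f)
  have h3 := map_natOfHom_app α β f X
  rw [← Category.assoc] at h3
  have h4 := (Iso.eq_comp_inv (β.app X)).1 h3
  change (toMod e).map (H.map ((natOfHom α β f).app X)) ≫ δ.hom.app (S.obj X) ≫
    Q.tensorFunctor.map (β.hom.app X) ≫
      (Bimodule.tensorFunctorTensor Q N).hom.app ((toMod e).obj X) =
    (δ.hom.app (T.obj X) ≫ Q.tensorFunctor.map (α.hom.app X) ≫
      (Bimodule.tensorFunctorTensor Q M).hom.app ((toMod e).obj X)) ≫ _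
  change (toMod e).map (H.map ((natOfHom α β f).app X)) ≫ δ.hom.app (S.obj X) =
    δ.hom.app (T.obj X) ≫ Q.tensorFunctor.map ((toMod e).map ((natOfHom α β f).app X)) at h1
  change Q.tensorFunctor.map ((Bimodule.tensorMap f).app ((toMod e).obj X)) ≫
    (Bimodule.tensorFunctorTensor Q N).hom.app ((toMod e).obj X) =
    (Bimodule.tensorFunctorTensor Q M).hom.app ((toMod e).obj X) ≫
      (Bimodule.tensorMap _).app ((toMod e).obj X) at h2
  have h5 : Q.tensorFunctor.map ((toMod e).map ((natOfHom α β f).app X)) ≫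
      Q.tensorFunctor.map (β.hom.app X) = Q.tensorFunctor.map (α.hom.app X) ≫
      Q.tensorFunctor.map ((Bimodule.tensorMap f).app ((toMod e).obj X)) :=
    ((Q.tensorFunctor.map_comp _ _).symm.trans (congrArg Q.tensorFunctor.map h4)).trans
      (Q.tensorFunctor.map_comp _ _)
  exact comp_eq_comp_of_squares h1 h5 h2

variable [Preadditive C] [e.functor.Additive]

theorem sum_natOfHom {n : ℕ} {Y : Fin n → Bimodule k A} {W : Fin n → C ⥤ C}
    (ω : ∀ t, Realization e (W t) (Y t))
    (s : ∀ t, Bimodule.Hom M (Y t)) (r : ∀ t, Bimodule.Hom (Y t) M)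
    (h : ∑ t, (r t).toLin ∘ₗ (s t).toLin = LinearMap.id) :
    ∑ t, natOfHom α (ω t) (s t) ≫ natOfHom (ω t) α (r t) = 𝟙 T := by
  ext X
  apply (toMod e).map_injective
  rw [NatTrans.app_sum, Functor.map_sum]
  have h1 := congrArg (fun t => NatTrans.app t ((toMod e).obj X)) (Bimodule.sum_tensorMap s r h)
  simp only [NatTrans.app_sum, NatTrans.comp_app, Functor.map_comp, map_natOfHom_app] at h1 ⊢
  have h2 : ∀ t, (α.hom.app X ≫ (Bimodule.tensorMap (s t)).app ((toMod e).obj X) ≫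
      (ω t).inv.app X) ≫ ((ω t).hom.app X ≫ (Bimodule.tensorMap (r t)).app ((toMod e).obj X) ≫
      α.inv.app X) = α.hom.app X ≫ ((Bimodule.tensorMap (s t)).app ((toMod e).obj X) ≫
        (Bimodule.tensorMap (r t)).app ((toMod e).obj X)) ≫ α.inv.app X := by
    intro t
    simp
  rw [Finset.sum_congr rfl fun t _ => h2 t, ← Preadditive.comp_sum, ← Preadditive.sum_comp, h1]
  simp

/-- `Bimodule.Hom` carries no addition here, so additivity is expressed through the underlying
linear maps. -/
theorem natOfHom_add {f g h : Bimodule.Hom M N} (hfg : h.toLin = f.toLin + g.toLin) :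
    natOfHom α β h = natOfHom α β f + natOfHom α β g := by
  ext X
  apply (toMod e).map_injective
  rw [NatTrans.app_add, Functor.map_add]
  simp only [map_natOfHom_app]
  have : (Bimodule.tensorMap h).app ((toMod e).obj X) =
      (Bimodule.tensorMap f).app ((toMod e).obj X) + (Bimodule.tensorMap g).app ((toMod e).obj X) := by
    ext1
    refine BalancedTensor.hom_ext fun m y => ?_
    change BalancedTensor.tmul A (h.toLin m) y =
      BalancedTensor.tmul A (f.toLin m) y + BalancedTensor.tmul A (g.toLin m) y
    rw [hfg]
    exact BalancedTensor.add_tmul A _ _ y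
  rw [this, Preadditive.add_comp, Preadditive.comp_add]

theorem natOfHom_eq_zero {f : Bimodule.Hom M N} (h : f.toLin = 0) : natOfHom α β f = 0 := by
  ext X
  apply (toMod e).map_injective
  rw [map_natOfHom_app]
  have : (Bimodule.tensorMap f).app ((toMod e).obj X) = 0 := by
    ext1
    refine BalancedTensor.hom_ext fun m y => ?_
    change BalancedTensor.tmul A (f.toLin m) y = 0
    rw [h]
    exact BalancedTensor.zero_tmul A y
  rw [this, Limits.zero_comp, Limits.comp_zero]
  exact ((toMod e).map_zero _ _).symm

end Realization


/-! ### The columns `A ⊗_k e A` and the modules obtained from them -/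

namespace Bimodule

variable {k : Type v} [Field k] {A : Type u} [Ring A] [Algebra k A]

/-- `s : M → N` and `r : N → M` exhibit `M` as a direct summand of `N`. -/
def IsRetract (M N : Bimodule k A) : Prop :=
  ∃ (s : Hom M N) (r : Hom N M), r.comp s = Hom.id M

/-- `(A ⊗ A) ⊗_A (A ⊗ A)` is `A ⊗ A ⊗ A`; expanding the middle factor in a basis gives `dim A`
copies of `A ⊗ A`. The maps are kept explicit because they are cut down by `e` afterwards. -/
theorem sum_outerToTensor [FiniteDimensional k A] {ι : Type*} [Fintype ι] (b : Module.Basis ι k A) :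
    ∑ t, (outerToTensor (b t)).toLin ∘ₗ (tensorToOuter (b.coord t)).toLin =
      (LinearMap.id : ((outer k A).tensor (outer k A)).carrier →ₗ[A] _) := by
  refine BalancedTensor.hom_ext (M := Outer k A) (N := Outer k A) fun m n => ?_
  rw [LinearMap.sum_apply]
  change ∑ t, (outerToTensor (b t)).toLin (outerPair (b.coord t) m n) =
    BalancedTensor.tmul A m n
  induction m using Outer.induction with
  | h0 => simp [BalancedTensor.zero_tmul]
  | hadd x y hx hy =>
    simp only [map_add, AddMonoidHom.add_apply, Finset.sum_add_distrib, hx, hy,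
      BalancedTensor.add_tmul]
  | ht x y =>
    induction n using Outer.induction with
    | h0 => simp [BalancedTensor.tmul_zero]
    | hadd z w hz hw =>
      simp only [map_add, Finset.sum_add_distrib, hz, hw, BalancedTensor.tmul_add]
    | ht z w =>
      have key : ∀ t, (outerToTensor (b t)).toLin (outerPair (b.coord t) (Outer.mk x y)
          (Outer.mk z w)) = BalancedTensor.tmul A (Outer.mk x (b.coord t (y * z) • b t) : Outer k A)
            (Outer.mk 1 w : Outer k A) := by
        intro t
        change (outerToTensor (b t)).toLin (x • Outer.mk 1 (b.coord t (y * z) • w)) = _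
        rw [map_smul]
        change x • (1 : A) • BalancedTensor.tmul A (Outer.mk 1 (b t) : Outer k A)
          (Outer.mk 1 (b.coord t (y * z) • w) : Outer k A) = _
        rw [one_smul, Outer.mk_smul, ← BalancedTensor.op_smul_tmul, ← Outer.central,
          ← Outer.mk_smul, BalancedTensor.smul_tmul', Outer.smul_mk, mul_one]
      have h2 : ∑ t, (Outer.mk x (b.coord t (y * z) • b t) : Outer k A) = Outer.mk x (y * z) := by
        conv_rhs => rw [← b.sum_repr (y * z)]
        exact (TensorProduct.tmul_sum x _ _).symm
      rw [Finset.sum_congr rfl fun t _ => key t, sum_tmul, h2]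
      have : (Outer.mk z w : Outer k A) = z • Outer.mk 1 w := by rw [Outer.smul_mk, mul_one]
      rw [this, ← BalancedTensor.op_smul_tmul, Outer.op_smul_mk]

/-- The bimodule `A ⊗_k e A`. -/
abbrev column (k : Type v) [Field k] {A : Type u} [Ring A] [Algebra k A] (e : A) : Bimodule k A :=
  image (outerEnd k 1 e)

section Column

variable {e : A} (he : IsIdempotentElem e)

include he

theorem outerEnd_idem : (outerEnd k 1 e).comp (outerEnd k 1 e) = outerEnd k 1 e := by
  rw [outerEnd_comp, mul_one, he.eq]

theorem outerToTensor_comp_outerEnd (b : A) :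
    (outerToTensor b).comp (outerEnd k 1 e) =
      (Hom.tensor (Hom.id _) (outerEnd k 1 e)).comp (outerToTensor b) :=
  outer_hom_ext (by
    change ((1 : A) * 1) • BalancedTensor.tmul A (Outer.mk 1 b : Outer k A)
        (Outer.mk 1 (e * 1) : Outer k A) = (Hom.tensor (Hom.id (outer k A)) (outerEnd k 1 e)).toLin
          ((1 : A) • BalancedTensor.tmul A (Outer.mk 1 b : Outer k A) (Outer.mk 1 1 : Outer k A))
    rw [mul_one, one_smul, one_smul]
    exact congrArg (fun z => BalancedTensor.tmul A (Outer.mk 1 b : Outer k A)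
      (Outer.mk z (e * 1) : Outer k A)) (mul_one 1).symm)

/-- The decomposition of `sum_outerToTensor` involves only the middle factor, so it is compatible
with `e` acting on the right leg and restricts to the column. -/
theorem inAdd_outer_tensor_column [FiniteDimensional k A] :
    InAdd {column k e} ((outer k A).tensor (column k e)) := by
  let b := Module.finBasis k A
  let q := outerEnd k 1 e
  refine InAdd.of_fintype (ι := Fin (Module.finrank k A)) (fun _ => column k e) (fun _ => rfl)
    (fun t => (imageProj q).comp ((tensorToOuter (b.coord t)).comp
      (Hom.tensor (Hom.id _) (imageIncl q))))
    (fun t => (Hom.tensor (Hom.id _) (imageProj q)).comp ((outerToTensor (b t)).comp (imageIncl q)))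
    (LinearMap.ext fun m => ?_)
  -- Moving `q` past `outerToTensor` makes it independent of `t`; it leaves the sum, and
  -- `sum_outerToTensor` applies.
  have h1 : ∀ t z, (outerToTensor (b t)).toLin (q.toLin z) =
      (Hom.tensor (Hom.id _) q).toLin ((outerToTensor (b t)).toLin z) := fun t z =>
    congrArg (fun f => f.toLin z) (outerToTensor_comp_outerEnd he (b t))
  rw [LinearMap.sum_apply]
  change ∑ t, (Hom.tensor (Hom.id (outer k A)) (imageProj q)).toLin ((outerToTensor (b t)).toLin
    (q.toLin ((tensorToOuter (b.coord t)).toLin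
      ((Hom.tensor (Hom.id (outer k A)) (imageIncl q)).toLin m)))) = m
  simp only [h1]
  rw [← map_sum, ← map_sum]
  have h2 := DFunLike.congr_fun (sum_outerToTensor b)
    ((Hom.tensor (Hom.id (outer k A)) (imageIncl q)).toLin m)
  rw [LinearMap.sum_apply] at h2
  refine (congrArg (fun z => (Hom.tensor (Hom.id (outer k A)) (imageProj q)).toLin
    ((Hom.tensor (Hom.id (outer k A)) q).toLin z)) h2).trans ?_
  refine DFunLike.congr_fun (f := (Hom.tensor (Hom.id (outer k A)) (imageProj q)).toLin ∘ₗ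
    (Hom.tensor (Hom.id (outer k A)) q).toLin ∘ₗ
      (Hom.tensor (Hom.id (outer k A)) (imageIncl q)).toLin) (g := LinearMap.id)
      (BalancedTensor.hom_ext (M := Outer k A) (N := (column k e).carrier) fun m n => ?_) m
  change BalancedTensor.tmul A m ((imageProj q).toLin (q.toLin ((imageIncl q).toLin n))) =
    BalancedTensor.tmul A m n
  have h3 : (imageProj q).comp (imageIncl q) = Hom.id _ :=
    imageProj_comp_imageIncl q (outerEnd_idem he)
  have h4 := congrArg (fun f => f.toLin ((imageProj q).toLin ((imageIncl q).toLin n))) h3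
  have h5 := congrArg (fun f => f.toLin n) h3
  exact congrArg _ (h4.trans h5)

/-- This makes the additive closure of the column functor stable under the action; it suffices to
check the two generators. -/
theorem inAdd_tensor_column [FiniteDimensional k A] {N : Bimodule k A}
    (hN : InAdd (generators k A) N) : InAdd {column k e} (N.tensor (column k e)) := by
  obtain ⟨n, Y, s, r, hY, h⟩ := hN
  refine InAdd.of_inAdd (fun t => (Y t).tensor (column k e)) (fun t => ?_)
    (fun t => (s t).tensor (Hom.id _)) (fun t => (r t).tensor (Hom.id _))
    (BalancedTensor.hom_ext fun m x => ?_)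
  · have hYt := hY t
    generalize Y t = X at hYt
    obtain rfl | rfl := hYt
    · refine InAdd.of_retract rfl (Hom.mk' (regularTensorHom (column k e).carrier) fun a => ?_)
        ⟨regularTensorInv (column k e).carrier, fun a t => rfl⟩ ?_
      · exact BalancedTensor.hom_ext fun (m : A) n => smul_comm m (MulOpposite.op a) n
      · refine BalancedTensor.hom_ext fun (m : A) n => ?_
        change BalancedTensor.tmul A (M := A) 1 (m • n) = BalancedTensor.tmul A (M := A) m n
        rw [← BalancedTensor.op_smul_tmul]; simp
    · exact inAdd_outer_tensor_column he
  · rw [LinearMap.sum_apply]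
    change ∑ t, BalancedTensor.tmul A ((r t).toLin ((s t).toLin m)) x = BalancedTensor.tmul A m x
    rw [sum_tmul]
    have := DFunLike.congr_fun h m
    rw [LinearMap.sum_apply] at this
    exact congrArg (fun m => BalancedTensor.tmul A m x) this

theorem inAdd_column : InAdd (generators k A) (column k e) :=
  (inAdd_outer k A).of_retract_inAdd (imageIncl _) (imageProj _)
    (imageProj_comp_imageIncl _ (outerEnd_idem he))

end Column

theorem isRetract_column {e : A} {M : Bimodule k A} {s : Hom M (outer k A)} {r : Hom (outer k A) M}
    (h : r.comp s = Hom.id M) (hs : (outerEnd k 1 e).comp s = s) : M.IsRetract (column k e) := by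
  refine ⟨(imageProj _).comp s, r.comp (imageIncl _), ?_⟩
  change r.comp ((outerEnd k 1 e).comp s) = _
  rw [hs, h]

/-- The projection `p = s ∘ r` of `A ⊗ A` onto `M` is not zero, so `eq_zero` shows that its
character value is not zero, and `exists_contraction` writes `e` as a composite through `(A ⊗ A) ⊗
p`, hence through `(A ⊗ A) ⊗_A M`. This gives the inequality from the column back to `M` in the left
order. -/
theorem IsPrimitivePair.column_isRetract {χ : A →ₐ[k] k} {e : A} {J : Submodule k A}
    (he : IsPrimitivePair χ e J) {M : Bimodule k A} (hM : Nontrivial M.carrier)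
    {s : Hom M (outer k A)} {r : Hom (outer k A) M}
    (h : r.comp s = Hom.id M) (hs : (outerEnd k 1 e).comp s = s)
    (hr : r.comp (outerEnd k 1 e) = r) : (column k e).IsRetract ((outer k A).tensor M) := by
  let p : Hom (outer k A) (outer k A) := s.comp r
  have hp : p.comp p = p := by
    change s.comp ((r.comp s).comp r) = _
    rw [h]; rfl
  have h1 : (outerEnd k 1 e).comp p = p := by
    change ((outerEnd k 1 e).comp s).comp r = _
    rw [hs]
  have h2 : p.comp (outerEnd k 1 e) = p := by
    change s.comp (r.comp (outerEnd k 1 e)) = _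
    rw [hr]
  have h0 : outerChar χ (p.toLin (Outer.mk 1 1 : Outer k A)) ≠ 0 := by
    intro h0
    have h3 := he.eq_zero hp h1 h2 h0
    obtain ⟨m, hm⟩ := exists_ne (0 : M.carrier)
    apply hm
    have hrs : ∀ m, r.toLin (s.toLin m) = m := fun m => congrArg (fun f => f.toLin m) h
    have h4 : s.toLin (r.toLin (s.toLin m)) = 0 := DFunLike.congr_fun h3 (s.toLin m)
    rw [hrs] at h4
    rw [← hrs m, h4, map_zero]
  obtain ⟨φ, c, hc⟩ := he.exists_contraction h1 h2 h0
  -- The factorization of `p` through `M` persists after tensoring; this is where `(A ⊗ A) ⊗_A M`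
  -- enters the contraction.
  have hsr : Hom.tensor (Hom.id (outer k A)) p =
      (Hom.tensor (Hom.id (outer k A)) s).comp (Hom.tensor (Hom.id (outer k A)) r) :=
    Hom.ext fun m => DFunLike.congr_fun (BalancedTensor.hom_ext (M := Outer k A) (N := Outer k A)
      (f := (Hom.tensor (Hom.id (outer k A)) p).toLin) (g := (Hom.tensor (Hom.id (outer k A)) s).toLin ∘ₗ (Hom.tensor (Hom.id (outer k A)) r).toLin)
      fun m n => rfl) m
  rw [hsr] at hc
  refine ⟨(Hom.tensor (Hom.id _) r).comp ((outerToTensor 1).comp (imageIncl _)),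
    (imageProj _).comp ((outerEnd k 1 c).comp ((tensorToOuter φ).comp
      (Hom.tensor (Hom.id _) s))), ?_⟩
  refine Eq.trans (congrArg (fun f : Hom (outer k A) (outer k A) =>
    (imageProj (outerEnd k 1 e)).comp (f.comp (imageIncl (outerEnd k 1 e)))) hc) ?_
  have h3 := imageProj_comp_imageIncl _ (outerEnd_idem (k := k) he.idem)
  change ((imageProj (outerEnd k 1 e)).comp (imageIncl (outerEnd k 1 e))).comp
    ((imageProj (outerEnd k 1 e)).comp (imageIncl (outerEnd k 1 e))) = _
  rw [h3]
  rfl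

/-- If the idempotent endomorphism `p` of `M` acts as the identity on `M ⊗_A X`, then
`p(M) ⊗_A X ≅ M ⊗_A X`. -/
def imageTensorEquiv {M : Bimodule k A} {p : Hom M M} (hp : p.comp p = p) {X : Type u}
    [AddCommGroup X] [Module A X] (h : p.rTensor X = LinearMap.id) :
    BalancedTensor A (image p).carrier X ≃ₗ[A] BalancedTensor A M.carrier X where
  __ := (imageIncl p).rTensor X
  invFun := (imageProj p).rTensor X
  left_inv := DFunLike.congr_fun (f := (imageProj p).rTensor X ∘ₗ (imageIncl p).rTensor X)
    (g := LinearMap.id) (BalancedTensor.hom_ext fun m x =>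
      congrArg (fun f => BalancedTensor.tmul A (Hom.toLin f m) x) (imageProj_comp_imageIncl p hp))
  right_inv := DFunLike.congr_fun (f := (imageIncl p).rTensor X ∘ₗ (imageProj p).rTensor X)
    (g := LinearMap.id) (Eq.trans (b := p.rTensor X) (BalancedTensor.hom_ext fun m x => rfl) h)

section InducedColumn

variable (k) (P : Type u) [AddCommGroup P] [Module k P] [Module A P] [IsScalarTower k A P]

/-- The bimodule `P ⊗_k e A`. -/
abbrev inducedColumn (e : A) : Bimodule k A :=
  image (inducedMap (k := k) (LinearMap.id : P →ₗ[A] P) e)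

/-- In `outerEnd k 1 e` the left leg is acted on by right multiplication by `1`, which is not
syntactically the identity. -/
theorem outerEnd_one (e : A) :
    outerEnd k 1 e = inducedMap (k := k) (LinearMap.id : A →ₗ[A] A) e :=
  outer_hom_ext (by
    change (Outer.mk (1 * 1) (e * 1) : Outer k A) = Outer.mk 1 (e * 1)
    rw [mul_one])

variable {k}

theorem inducedMap_idem {e : A} (he : IsIdempotentElem e) :
    (inducedMap (k := k) (LinearMap.id : P →ₗ[A] P) e).comp
      (inducedMap (k := k) (LinearMap.id : P →ₗ[A] P) e) =
      inducedMap (k := k) (LinearMap.id : P →ₗ[A] P) e :=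
  Hom.ext fun t => DFunLike.congr_fun (InducedSpace.hom_ext (k := k) fun p y => by
    change InducedSpace.mk k A p (e * (e * y)) = InducedSpace.mk k A p (e * y)
    rw [← mul_assoc, he.eq]) t

/-- `P` is a summand of `Aⁿ`, hence `P ⊗ eA` is one of `(A ⊗ eA)ⁿ`. -/
theorem inAdd_inducedColumn [Module.Finite A P] [Module.Projective A P] {e : A}
    (he : IsIdempotentElem e) : InAdd {column k e} (inducedColumn k P e) := by
  obtain ⟨n, g, f, h⟩ := exists_sum_comp_eq_id (A := A) P
  refine ⟨n, fun _ => column k e,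
    fun t => (imageProj _).comp ((inducedMap (P' := A) (g t) e).comp (imageIncl _)),
    fun t => (imageProj _).comp ((inducedMap (P := A) (f t) e).comp (imageIncl _)),
    fun _ => rfl, LinearMap.ext fun m => ?_⟩
  -- The middle factor is `outerEnd k 1 e`, which arises when the projection onto the column is
  -- followed by its inclusion.
  have key : ∑ t, inducedLin (k := k) (P := A) (f t) e ∘ₗ inducedLin (k := k) (P' := A)
      (LinearMap.toSpanSingleton A A 1) e ∘ₗ inducedLin (g t) e =
      inducedLin (k := k) (LinearMap.id : P →ₗ[A] P) e := by
    refine InducedSpace.hom_ext fun p y => ?_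
    rw [LinearMap.sum_apply]
    change ∑ t, f t (g t p * 1) ⊗ₜ[k] (e * (e * (e * y))) = p ⊗ₜ[k] (e * y)
    rw [← TensorProduct.sum_tmul, ← mul_assoc e e, he.eq, ← mul_assoc e e, he.eq]
    have h1 := DFunLike.congr_fun h p
    rw [LinearMap.sum_apply] at h1
    simp only [mul_one]
    exact congrArg (fun z => z ⊗ₜ[k] (e * y)) h1
  let q := inducedMap (k := k) (LinearMap.id : P →ₗ[A] P) e
  have h2 := DFunLike.congr_fun key ((imageIncl q).toLin m)
  rw [LinearMap.sum_apply] at h2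
  rw [LinearMap.sum_apply]
  have h3 := congrArg (imageProj q).toLin h2
  rw [map_sum] at h3
  refine h3.trans ?_
  have h4 := imageProj_comp_imageIncl q (inducedMap_idem P he)
  exact (congrArg (fun f => f.toLin ((imageProj q).toLin ((imageIncl q).toLin m))) h4).trans
    (congrArg (fun f => f.toLin m) h4)

variable {χ : A →ₐ[k] k} {X : Type u} [AddCommGroup X] [Module A X] {x₀ : X} {κ : X →+ k}

/-- `(P ⊗_k e A) ⊗_A X ≅ P` if `X` is the one-dimensional module corresponding to `e`. -/
def inducedColumnTensorEquiv (h : IsCharModule χ x₀ κ) {e : A} (he : IsIdempotentElem e)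
    (hχ : χ e = 1) : BalancedTensor A (inducedColumn k P e).carrier X ≃ₗ[A] P :=
  (imageTensorEquiv (inducedMap_idem P he) (h.rTensor_inducedMap (P := P) hχ)).trans
    (inducedTensorEquiv P h)

end InducedColumn

end Bimodule


/-! ### Additive closures and indecomposable objects -/

theorem addClosure_trans {D : Type*} [Category* D] [Preadditive D] {P Q : D → Prop}
    (h : ∀ Y, P Y → addClosure Q Y) {X : D} (hX : addClosure P X) : addClosure Q X := by
  obtain ⟨n, Y, s, r, hY, hsr⟩ := hX
  choose m Z s' r' hZ h' using fun t => h (Y t) (hY t)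
  let φ := (Fintype.equivFin (Σ t, Fin (m t))).symm
  refine ⟨Fintype.card (Σ t, Fin (m t)), fun p => Z (φ p).1 (φ p).2,
    fun p => s (φ p).1 ≫ s' (φ p).1 (φ p).2, fun p => r' (φ p).1 (φ p).2 ≫ r (φ p).1,
    fun p => hZ _ _, ?_⟩
  refine (Equiv.sum_comp φ fun p => (s p.1 ≫ s' p.1 p.2) ≫ r' p.1 p.2 ≫ r p.1).trans ?_
  rw [Fintype.sum_sigma, ← hsr]
  refine Finset.sum_congr rfl fun t _ => ?_
  have : ∀ p : Fin (m t), (s t ≫ s' t p) ≫ r' t p ≫ r t = s t ≫ (s' t p ≫ r' t p) ≫ r t :=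
    fun p => by simp only [Category.assoc]
  rw [Finset.sum_congr rfl fun p _ => this p, ← Preadditive.comp_sum, ← Preadditive.sum_comp, h',
    Category.id_comp]

theorem addClosure_of_retract {D : Type*} [Category* D] [Preadditive D] {Q : D → Prop} {X Y : D}
    (R : Retract X Y) (hY : addClosure Q Y) : addClosure Q X :=
  addClosure_trans (P := fun Z => Z = Y) (by rintro _ rfl; exact hY)
    ⟨1, fun _ => Y, fun _ => R.i, fun _ => R.r, fun _ => rfl, by simp⟩

theorem IsIndecomposable.of_iso {D : Type*} [Category* D] [Preadditive D] {X Y : D} (φ : X ≅ Y)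
    (h : IsIndecomposable X) : IsIndecomposable Y := by
  refine ⟨fun hY => h.1 (hY.of_iso φ), fun Z₁ Z₂ i₁ p₁ i₂ p₂ h₁ h₂ h₃ => ?_⟩
  refine h.2 Z₁ Z₂ (i₁ ≫ φ.inv) (φ.hom ≫ p₁) (i₂ ≫ φ.inv) (φ.hom ≫ p₂) (by simpa) (by simpa) ?_
  have : φ.hom ≫ (p₁ ≫ i₁ + p₂ ≫ i₂) ≫ φ.inv = 𝟙 X := by rw [h₃]; simp
  simpa using this

/-! ### Translation between bimodules and 1-morphisms -/

namespace ProjTwoCat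

variable {k : Type v} [Field k] {A : Type u} [Ring A] [Algebra k A] [FiniteDimensional k A]
variable {C : Type w} [SmallCategory C] {e : C ≌ FGModuleCat.{u} A}
variable {a b c : ProjTwoCat k e}

/-- A natural transformation as a `2`-morphism. -/
def homOf {F G : a ⟶ b} (η : F.obj ⟶ G.obj) : F ⟶ G := ObjectProperty.homMk η

theorem hom_ext' {F G : a ⟶ b} {η θ : F ⟶ G} (h : η.hom = θ.hom) : η = θ :=
  ObjectProperty.hom_ext _ h

variable {M N : Bimodule k A}

theorem exists_oneMorphism (hM : M.InAdd (Bimodule.generators k A)) :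
    ∃ F : a ⟶ b, Nonempty (Realization e F.obj M) := by
  obtain ⟨T, ⟨α⟩⟩ := exists_realization e hM
  exact ⟨⟨T, M, hM, ⟨α⟩⟩, ⟨α⟩⟩

theorem retract_of_isRetract {F G : a ⟶ b} (α : Realization e F.obj M) (β : Realization e G.obj N)
    (h : M.IsRetract N) : Nonempty (Retract F G) := by
  obtain ⟨s, r, h⟩ := h
  exact ⟨⟨homOf (natOfHom α β s), homOf (natOfHom β α r), hom_ext' (by
    refine (natOfHom_comp α β α s r).trans ?_
    rw [h]
    exact natOfHom_id α)⟩⟩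

theorem iso_of_inverse {F G : a ⟶ b} (α : Realization e F.obj M) (β : Realization e G.obj N)
    {s : Bimodule.Hom M N} {r : Bimodule.Hom N M} (h : r.comp s = Bimodule.Hom.id M)
    (h' : s.comp r = Bimodule.Hom.id N) : Nonempty (F ≅ G) :=
  ⟨⟨homOf (natOfHom α β s), homOf (natOfHom β α r), hom_ext' (by
    refine (natOfHom_comp α β α s r).trans ?_
    rw [h]
    exact natOfHom_id α), hom_ext' (by
    refine (natOfHom_comp β α β r s).trans ?_
    rw [h']
    exact natOfHom_id β)⟩⟩

/-- The identity `1`-morphism is given by the regular bimodule. -/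
def idRealization : Realization e (𝟭 C) (Bimodule.regular k A) :=
  Functor.isoWhiskerLeft (e.functor ⋙ (ModuleCat.isFG A).ι) (Bimodule.tensorFunctorRegular k A).symm

variable [Preadditive C] [Linear k C] [e.functor.Additive] [e.functor.Linear k]

theorem addClosure_of_inAdd {V F : a ⟶ b} (ω : Realization e V.obj N) (α : Realization e F.obj M)
    (h : M.InAdd {N}) : addClosure (fun G => G = V) F := by
  obtain ⟨n, Y, s, r, hY, h⟩ := h
  obtain rfl : Y = fun _ => N := funext hY
  refine ⟨n, fun _ => V, fun t => homOf (natOfHom α ω (s t)), fun t => homOf (natOfHom ω α (r t)),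
    fun _ => rfl, hom_ext' ?_⟩
  refine Eq.trans ?_ (sum_natOfHom α (fun _ => ω) s r h)
  exact map_sum (AddMonoidHom.mk' (fun η : F ⟶ F => η.hom) fun _ _ => rfl) _ _

/-- An idempotent endomorphism of `M` splits it into two bimodules, both still in the additive
closure and therefore realized by 1-morphisms. Indecomposability of `G` makes one of them zero. -/
theorem hasTrivialIdempotents {G : a ⟶ b} (hG : IsIndecomposable G) (α : Realization e G.obj M)
    (hM : M.InAdd (Bimodule.generators k A)) : M.HasTrivialIdempotents := by
  have hzero : ∀ {p : Bimodule.Hom M M}, natOfHom α α p = 0 → p.toLin = 0 := fun {p} hp => by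
    let z : Bimodule.Hom M M := ⟨0, fun a m => (smul_zero _).symm⟩
    have h1 : natOfHom α α p = natOfHom α α z := hp.trans (natOfHom_eq_zero α α rfl).symm
    rw [natOfHom_injective α α h1]
  constructor
  · by_contra hn
    rw [not_nontrivial_iff_subsingleton] at hn
    apply hG.1
    rw [Limits.IsZero.iff_id_eq_zero]
    apply hom_ext'
    refine (natOfHom_id α).symm.trans (natOfHom_eq_zero α α ?_)
    ext m
    exact Subsingleton.elim _ _
  · intro p hp
    have hp' : ∀ m, p.toLin (p.toLin m) = p.toLin m := fun m => congrArg (fun f => f.toLin m) hp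
    let q : Bimodule.Hom M M := ⟨LinearMap.id - p.toLin, fun a m => by
      simp only [LinearMap.sub_apply, LinearMap.id_apply, p.map_op_smul, smul_sub]⟩
    have hq : q.comp q = q := Bimodule.Hom.ext fun m => by
      change (m - p.toLin m) - p.toLin (m - p.toLin m) = m - p.toLin m
      rw [map_sub, hp', sub_self, sub_zero]
    -- `Y` and `Z` realize the images of `p` and of `q = 1 - p`; together they decompose `G`.
    obtain ⟨Y, ⟨β⟩⟩ := exists_oneMorphism (a := a) (b := b) (hM.of_retract_inAdd _ _
      (Bimodule.imageProj_comp_imageIncl p hp))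
    obtain ⟨Z, ⟨γ⟩⟩ := exists_oneMorphism (a := a) (b := b) (hM.of_retract_inAdd _ _
      (Bimodule.imageProj_comp_imageIncl q hq))
    have hpe := natOfHom_comp α β α (Bimodule.imageProj p) (Bimodule.imageIncl p)
    have hqe := natOfHom_comp α γ α (Bimodule.imageProj q) (Bimodule.imageIncl q)
    rw [Bimodule.imageIncl_comp_imageProj] at hpe hqe
    rcases hG.2 Y Z (homOf (natOfHom β α (Bimodule.imageIncl p)))
      (homOf (natOfHom α β (Bimodule.imageProj p))) (homOf (natOfHom γ α (Bimodule.imageIncl q)))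
      (homOf (natOfHom α γ (Bimodule.imageProj q)))
      (hom_ext' (by
        refine (natOfHom_comp β α β _ _).trans ?_
        rw [Bimodule.imageProj_comp_imageIncl p hp]
        exact natOfHom_id β))
      (hom_ext' (by
        refine (natOfHom_comp γ α γ _ _).trans ?_
        rw [Bimodule.imageProj_comp_imageIncl q hq]
        exact natOfHom_id γ))
      (hom_ext' (by
        refine Eq.trans ?_ (natOfHom_id α)
        refine Eq.trans ?_ (natOfHom_add α α (f := p) (g := q) (h := Bimodule.Hom.id M) (by
          ext m
          change m = p.toLin m + (m - p.toLin m)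
          rw [add_sub_cancel])).symm
        exact congrArg₂ (· + ·) hpe hqe)) with h0 | h0
    · left
      apply hzero
      have h1 := congrArg (fun η : Y ⟶ Y => η.hom) ((Limits.IsZero.iff_id_eq_zero Y).1 h0)
      change 𝟙 Y.obj = 0 at h1
      rw [← hpe, ← Category.id_comp (natOfHom β α _), h1, Limits.zero_comp, Limits.comp_zero]
    · right
      have h1 := congrArg (fun η : Z ⟶ Z => η.hom) ((Limits.IsZero.iff_id_eq_zero Z).1 h0)
      change 𝟙 Z.obj = 0 at h1
      have h2 : q.toLin = 0 := by
        apply hzero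
        rw [← hqe, ← Category.id_comp (natOfHom γ α _), h1, Limits.zero_comp, Limits.comp_zero]
      exact (sub_eq_zero.1 h2).symm

end ProjTwoCat

/-- Every `χ i` kills `e_j y e_j - χ_j(y) e_j`: for `i ≠ j` because `χ i (e j) = 0`, and for `i = j`
by multiplicativity. So the common kernel serves as `J`. -/
theorem exists_isPrimitivePair {k : Type v} [Field k] {A : Type u} [Ring A] [Algebra k A]
    [FiniteDimensional k A] (h : IsBasicAlgebra k A) :
    ∃ (n : ℕ) (χ : Fin n → A →ₐ[k] k) (e : Fin n → A) (J : Submodule k A),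
      CompleteOrthogonalIdempotents e ∧ ∀ j, Bimodule.IsPrimitivePair (χ j) (e j) J := by
  obtain ⟨n, χ, e, he, hχ, hJ⟩ := h.exists_idempotents
  refine ⟨n, χ, e, charKer χ, he, fun j => ⟨he.idem j, hJ, ?_, fun y => ?_⟩⟩
  · rw [hχ, if_pos rfl]
  · rw [mem_charKer]
    intro i
    rw [map_sub, map_mul, map_mul, map_mul, AlgHom.commutes, hχ]
    by_cases hij : i = j
    · subst hij
      simp
    · simp [hij]


/-! ### Evaluation of the column functor at a one-dimensional module -/

namespace ProjTwoCat

variable {k : Type v} [Field k] {A : Type u} [Ring A] [Algebra k A] [FiniteDimensional k A]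
variable {C : Type w} [SmallCategory C] {e : C ≌ FGModuleCat.{u} A}
variable [Preadditive C] [Linear k C]

/-- Evaluation at `S` is a good invariant of the additive closure of `V`: natural transformations
which do not vanish at `S` can be contracted to the identity, using `W`. -/
structure IsEvaluationPair (V W : (star : ProjTwoCat k e) ⟶ star) (S : C) : Prop where
  full : ∀ h : V.obj.obj S ⟶ V.obj.obj S, ∃ η : V ⟶ V, η.hom.app S = h
  projective : Projective (V.obj.obj S)
  not_isZero : ¬ Limits.IsZero (V.obj.obj S)
  contraction : ∀ f : V ⟶ V, f.hom.app S ≠ 0 →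
    ∃ (u : V ⟶ V ≫ W) (v : V ≫ W ⟶ V), u ≫ (f ▷ W) ≫ v = 𝟙 V
  essSurj : ∀ P : C, Projective P →
    ∃ F : (star : ProjTwoCat k e) ⟶ star, addClosure (fun G => G = V) F ∧ Nonempty (F.obj.obj S ≅ P)

variable [e.functor.Additive] [e.functor.Linear k]

open Bimodule in
-- `V` is the summand of `W` cut out by `c` on the right leg, so endomorphisms of `V` are studied as
-- endomorphisms of `A ⊗ A` that absorb `c` on both sides.
theorem isEvaluationPair {χ : A →ₐ[k] k} {c : A} {J : Submodule k A} (hc : IsPrimitivePair χ c J)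
    {V W : (star : ProjTwoCat k e) ⟶ star} (ω : Realization e V.obj (column k c))
    (β : Realization e W.obj (outer k A)) {S : C} {x₀ : (toMod e).obj S}
    {κ : (toMod e).obj S →+ k} (hS : IsCharModule χ x₀ κ) : IsEvaluationPair V W S := by
  have hA : Nontrivial A := ⟨⟨c, 0, fun h => by
    have := hc.char_eq
    rw [h, map_zero] at this
    exact zero_ne_one this⟩⟩
  let inc : V.obj ⟶ W.obj := natOfHom ω β (imageIncl _)
  let prj : W.obj ⟶ V.obj := natOfHom β ω (imageProj _)
  have hip : inc ≫ prj = 𝟙 V.obj := by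
    refine (natOfHom_comp ω β ω _ _).trans ?_
    rw [imageProj_comp_imageIncl _ (outerEnd_idem hc.idem)]
    exact natOfHom_id ω
  have hpi : prj ≫ inc = natOfHom β β (outerEnd k 1 c) := natOfHom_comp β ω β _ _
  have hip_app : ∀ X, inc.app X ≫ prj.app X = 𝟙 _ := fun X => congrArg (fun η => η.app X) hip
  -- `(A ⊗ cA) ⊗_A S ≅ A`, the case `P = A` of `inducedColumnTensorEquiv`. It gives both
  -- projectivity and non-vanishing of `V(S)`.
  have hEV : Nonempty ((toMod e).obj (V.obj.obj S) ≃ₗ[A] A) := by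
    have hcol : Nonempty (BalancedTensor A (column k c).carrier ((toMod e).obj S) ≃ₗ[A] A) := by
      have := inducedColumnTensorEquiv (k := k) A hS hc.idem hc.char_eq
      rw [inducedColumn, ← outerEnd_one] at this
      exact ⟨this⟩
    obtain ⟨φ⟩ := hcol
    exact ⟨(ω.app S).toLinearEquiv.trans φ⟩
  refine ⟨fun h => ?_, ?_, fun h0 => ?_, fun f hf => ?_, fun P hP => ?_⟩
  -- The map `h` is extended to `W(S)`, lifted there to a right multiplication on `A ⊗ A`, and
  -- compressed back to `V`.
  · obtain ⟨a, ha⟩ := hS.rTensor_surjective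
      (β.inv.app S ≫ (toMod e).map (prj.app S ≫ h ≫ inc.app S) ≫ β.hom.app S).hom
    have hθ : (natOfHom β β (outerEnd k a 1)).app S = prj.app S ≫ h ≫ inc.app S := by
      apply (toMod e).map_injective
      rw [map_natOfHom_app]
      have : (tensorMap (outerEnd k a 1)).app ((toMod e).obj S) =
          β.inv.app S ≫ (toMod e).map (prj.app S ≫ h ≫ inc.app S) ≫ β.hom.app S :=
        ModuleCat.hom_ext ha
      rw [this]
      simp
    refine ⟨homOf (inc ≫ natOfHom β β (outerEnd k a 1) ≫ prj), ?_⟩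
    change inc.app S ≫ (natOfHom β β (outerEnd k a 1)).app S ≫ prj.app S = h
    rw [hθ, Category.assoc, Category.assoc, hip_app, Category.comp_id, ← Category.assoc, hip_app,
      Category.id_comp]
  · obtain ⟨φ⟩ := hEV
    rw [← e.map_projective_iff]
    exact FGModuleCat.projective_of_module _ (Module.Projective.of_equiv' φ.symm)
  · obtain ⟨φ⟩ := hEV
    have h1 : Limits.IsZero ((toMod e).obj (V.obj.obj S)) := (toMod e).map_isZero h0
    have := ModuleCat.subsingleton_of_isZero h1
    exact not_subsingleton A φ.symm.toEquiv.subsingleton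
  -- `g` is the endomorphism of `A ⊗ A` corresponding to `f`, extended by zero to the complement of
  -- `V` in `W`.
  · obtain ⟨g, hg⟩ := natOfHom_surjective β β (prj ≫ f.hom ≫ inc)
    have h1 : (outerEnd k 1 c).comp g = g := natOfHom_injective β β (by
      rw [← natOfHom_comp β β β, hg, ← hpi, Category.assoc, Category.assoc, reassoc_of% hip])
    have h2 : g.comp (outerEnd k 1 c) = g := natOfHom_injective β β (by
      rw [← natOfHom_comp β β β, hg, ← hpi, Category.assoc, reassoc_of% hip])
    have h0 : outerChar χ (g.toLin (Outer.mk 1 1 : Outer k A)) ≠ 0 := fun h0 => by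
      have h3 : (tensorMap g).app ((toMod e).obj S) = 0 :=
        ModuleCat.hom_ext (hS.rTensor_eq_zero h0)
      have h4 : prj.app S ≫ f.hom.app S ≫ inc.app S = 0 := by
        have h5 : (natOfHom β β g).app S = 0 := by
          apply (toMod e).map_injective
          rw [map_natOfHom_app, h3, Limits.zero_comp, Limits.comp_zero, Functor.map_zero]
        rw [hg] at h5
        exact h5
      apply hf
      have h6 := congrArg (fun t => inc.app S ≫ t ≫ prj.app S) h4
      simpa only [Category.assoc, hip_app, Category.comp_id, reassoc_of% hip_app,
        Limits.zero_comp, Limits.comp_zero] using h6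
    obtain ⟨φ, d, hφ⟩ := hc.exists_contraction h1 h2 h0
    let ββ := Realization.comp β β
    -- These are the maps of `exists_contraction`, compressed from `W` to `V`: the factors `prj` and
    -- `inc` whiskered by `W` turn `W(f)` into `(A ⊗ A) ⊗ g`.
    refine ⟨homOf (inc ≫ natOfHom β ββ (outerToTensor 1) ≫ Functor.whiskerRight prj W.obj),
      homOf (Functor.whiskerRight inc W.obj ≫ natOfHom ββ β (tensorToOuter φ) ≫
        natOfHom β β (outerEnd k 1 d) ≫ prj), hom_ext' ?_⟩
    have hw : Functor.whiskerRight prj W.obj ≫ Functor.whiskerRight f.hom W.obj ≫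
        Functor.whiskerRight inc W.obj = natOfHom ββ ββ (Hom.tensor (Hom.id (outer k A)) g) := by
      rw [← Functor.whiskerRight_comp, ← Functor.whiskerRight_comp, ← hg]
      exact whiskerRight_natOfHom β β β g
    change (inc ≫ natOfHom β ββ (outerToTensor 1) ≫ Functor.whiskerRight prj W.obj) ≫
      Functor.whiskerRight f.hom W.obj ≫ (Functor.whiskerRight inc W.obj ≫
        natOfHom ββ β (tensorToOuter φ) ≫ natOfHom β β (outerEnd k 1 d) ≫ prj) = 𝟙 V.obj
    have h7 : natOfHom β ββ (outerToTensor 1) ≫ natOfHom ββ ββ (Hom.tensor (Hom.id (outer k A)) g) ≫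
        natOfHom ββ β (tensorToOuter φ) ≫ natOfHom β β (outerEnd k 1 d) = prj ≫ inc := by
      rw [natOfHom_comp ββ β β, natOfHom_comp ββ ββ β, natOfHom_comp β ββ β, hpi]
      exact congrArg (natOfHom β β) hφ
    calc _ = inc ≫ natOfHom β ββ (outerToTensor 1) ≫ (Functor.whiskerRight prj W.obj ≫
          Functor.whiskerRight f.hom W.obj ≫ Functor.whiskerRight inc W.obj) ≫
          natOfHom ββ β (tensorToOuter φ) ≫ natOfHom β β (outerEnd k 1 d) ≫ prj := by
            simp only [Category.assoc]
      _ = inc ≫ (natOfHom β ββ (outerToTensor 1) ≫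
          natOfHom ββ ββ (Hom.tensor (Hom.id (outer k A)) g) ≫
          natOfHom ββ β (tensorToOuter φ) ≫ natOfHom β β (outerEnd k 1 d)) ≫ prj := by
            rw [hw]; simp only [Category.assoc]
      _ = 𝟙 V.obj := by rw [h7, Category.assoc, reassoc_of% hip, hip]
  -- The 1-morphism with value `P` at `S` is given by `P ⊗_k cA`.
  · rw [← e.map_projective_iff] at hP
    have hP' := FGModuleCat.moduleProjective (e.functor.obj P)
    let Q := (toMod e).obj P
    have : Module.Projective A Q := hP'
    have : Module.Finite A Q := (e.functor.obj P).property
    let _ : Module k Q := Module.compHom Q (algebraMap k A)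
    have : IsScalarTower k A Q := ⟨fun x y z => by
      change (x • y) • z = algebraMap k A x • y • z
      rw [Algebra.smul_def, mul_smul]⟩
    have hQ := inAdd_inducedColumn (k := k) (A := A) Q hc.idem
    have hQ' : InAdd (generators k A) (inducedColumn k Q c) := by
      obtain ⟨n, Y, s, r, hY, h⟩ := hQ
      exact InAdd.of_inAdd Y (fun t => by rw [hY t]; exact inAdd_column hc.idem) s r h
    obtain ⟨F, ⟨α⟩⟩ := exists_oneMorphism (e := e) (a := star) (b := star) hQ'
    refine ⟨F, addClosure_of_inAdd ω α hQ, ⟨(toMod e).preimageIso ?_⟩⟩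
    exact α.app S ≪≫ (inducedColumnTensorEquiv (k := k) Q hS hc.idem hc.char_eq).toModuleIso

open Bimodule in
-- The classification of summands leaves two cases. A summand of `A` would be `A`, that is, the
-- identity functor; a summand of a column supplies `V`, `W` and the one-dimensional object `S` of
-- its character.
theorem exists_isEvaluationPair (hconn : IsConnectedAlgebra A) (hbasic : IsBasicAlgebra k A)
    {G : (star : ProjTwoCat k e) ⟶ star} (hG : IsIndecomposable G) (hG1 : IsEmpty (G ≅ 𝟙 star)) :
    ∃ (V W : (star : ProjTwoCat k e) ⟶ star) (S : C), IsEvaluationPair V W S ∧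
      (∀ H : (star : ProjTwoCat k e) ⟶ star, addClosure (fun F => F = V) (V ≫ H)) ∧
      Nonempty (Retract G V) ∧ Nonempty (Retract V (G ≫ W)) := by
  obtain ⟨M, hM, ⟨α⟩⟩ := G.property
  change Realization e G.obj M at α
  obtain ⟨n, χ, c, J, hc, hp⟩ := exists_isPrimitivePair hbasic
  have hMt := hasTrivialIdempotents hG α hM
  rcases hM.regular_or_outer hMt hc with ⟨s, r, h⟩ | ⟨j, s, r, h, hs, hr⟩
  · refine (hG1.false ?_).elim
    exact (iso_of_inverse (F := G) (G := 𝟙 star) α idRealization h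
      (comp_eq_id_of_connected hconn hMt.1 h)).some
  · obtain ⟨V, ⟨ω⟩⟩ := exists_oneMorphism (e := e) (a := star) (b := star)
      (inAdd_column (k := k) (hp j).idem)
    obtain ⟨W, ⟨β⟩⟩ := exists_oneMorphism (e := e) (a := star) (b := star) (inAdd_outer k A)
    obtain ⟨S, ⟨τ⟩⟩ := exists_iso_of_finite e (A ⧸ RingHom.ker (χ j))
    obtain ⟨κ, hκ⟩ := exists_isCharModule (χ j)
    refine ⟨V, W, S, isEvaluationPair (hp j) ω β (hκ.of_equiv τ.symm.toLinearEquiv), fun H => ?_,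
      retract_of_isRetract α ω (isRetract_column h hs),
      retract_of_isRetract (G := G ≫ W) ω (Realization.comp α β)
        ((hp j).column_isRetract hMt.1 h hs hr)⟩
    obtain ⟨N, hN, ⟨δ⟩⟩ := H.property
    exact addClosure_of_inAdd (F := V ≫ H) ω (Realization.comp ω δ)
      (inAdd_tensor_column (hp j).idem hN)

end ProjTwoCat


/-! ### Additive functors on the additive closure of one object -/

section AddClosure

variable {D : Type*} [Category* D] [Preadditive D] {E : Type*} [Category* E] [Preadditive E]
  (Φ : D ⥤ E) [Φ.Additive] {V : D}

theorem sum_map_comp_map {X : D} {n : ℕ} {Y : Fin n → D} {s : ∀ t, X ⟶ Y t} {r : ∀ t, Y t ⟶ X}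
    (h : ∑ t, s t ≫ r t = 𝟙 X) : ∑ t, Φ.map (s t) ≫ Φ.map (r t) = 𝟙 (Φ.obj X) := by
  rw [← Φ.map_id, ← h, Φ.map_sum]
  simp only [Functor.map_comp]

theorem addClosure_projective (hV : Projective (Φ.obj V)) {X : D}
    (hX : addClosure (fun Y => Y = V) X) : Projective (Φ.obj X) := by
  obtain ⟨n, Y, s, r, hY, h⟩ := hX
  obtain rfl : Y = fun _ => V := funext hY
  refine ⟨fun {Z Z'} f p hp => ⟨∑ t, Φ.map (s t) ≫ Projective.factorThru (Φ.map (r t) ≫ f) p, ?_⟩⟩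
  simp only [Preadditive.sum_comp, Category.assoc, Projective.factorThru_comp]
  simp only [← Category.assoc]
  rw [← Preadditive.sum_comp, sum_map_comp_map Φ h, Category.id_comp]

/-- Matrix entries: each component of `g` between copies of `Φ V` is lifted separately, and the
lifts are reassembled. -/
theorem addClosure_map_surjective (hV : Function.Surjective (Φ.map : (V ⟶ V) → _)) {X X' : D}
    (hX : addClosure (fun Y => Y = V) X) (hX' : addClosure (fun Y => Y = V) X') :
    Function.Surjective (Φ.map : (X ⟶ X') → _) := fun g => by
  obtain ⟨n, Y, s, r, hY, h⟩ := hX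
  obtain rfl : Y = fun _ => V := funext hY
  obtain ⟨n', Y', s', r', hY', h'⟩ := hX'
  obtain rfl : Y' = fun _ => V := funext hY'
  choose φ hφ using fun t t' => hV (Φ.map (r t) ≫ g ≫ Φ.map (s' t'))
  refine ⟨∑ t, s t ≫ ∑ t', φ t t' ≫ r' t', ?_⟩
  simp only [Φ.map_sum, Φ.map_comp, hφ, Category.assoc, ← Preadditive.comp_sum,
    sum_map_comp_map Φ h', Category.comp_id]
  simp only [← Category.assoc]
  rw [← Preadditive.sum_comp, sum_map_comp_map Φ h, Category.id_comp]

/-- A morphism all of whose matrix entries between copies of `V` are killed by `Φ` is itself killed.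
It reduces the study of ideals to endomorphisms of `V`. -/
theorem addClosure_exists_map_ne_zero {X X' : D} (hX : addClosure (fun Y => Y = V) X)
    (hX' : addClosure (fun Y => Y = V) X') {f : X ⟶ X'} (hf : Φ.map f ≠ 0) :
    ∃ (r : V ⟶ X) (s : X' ⟶ V), Φ.map (r ≫ f ≫ s) ≠ 0 := by
  obtain ⟨n, Y, s, r, hY, h⟩ := hX
  obtain rfl : Y = fun _ => V := funext hY
  obtain ⟨n', Y', s', r', hY', h'⟩ := hX'
  obtain rfl : Y' = fun _ => V := funext hY'
  by_contra! H
  apply hf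
  have h1 : ∀ t, Φ.map (r t) ≫ Φ.map f = 0 := fun t => by
    rw [← Category.comp_id (Φ.map (r t) ≫ Φ.map f), ← sum_map_comp_map Φ h', Preadditive.comp_sum]
    refine Finset.sum_eq_zero fun t' _ => ?_
    have := H (r t) (s' t')
    rw [Φ.map_comp, Φ.map_comp] at this
    rw [← Category.assoc, Category.assoc (Φ.map (r t)), this, Limits.zero_comp]
  rw [← Category.id_comp (Φ.map f), ← sum_map_comp_map Φ h, Preadditive.sum_comp]
  exact Finset.sum_eq_zero fun t _ => by rw [Category.assoc, h1, Limits.comp_zero]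

end AddClosure

/-! ### Evaluation as a transformation of 2-representations -/

namespace ProjTwoCat

variable {k : Type v} [Field k] {A : Type u} [Ring A] [Algebra k A] [FiniteDimensional k A]
variable {C : Type w} [SmallCategory C] {e : C ≌ FGModuleCat.{u} A}
variable [Preadditive C] [Linear k C] [e.functor.Additive] [e.functor.Linear k]

section Evaluation

variable {i : ProjTwoCat k e} {L : ∀ j : ProjTwoCat k e, Set (i ⟶ j)} (S : C)

/-- The `1`-morphism underlying an object of `cellSubrep k L`. -/
abbrev underlying {j : ProjTwoCat k e} (X : (cellSubrep k L).obj j) : i ⟶ j :=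
  ObjectProperty.FullSubcategory.obj X

/-- The `2`-morphism underlying a morphism of `cellSubrep k L`. -/
abbrev underlyingHom {j : ProjTwoCat k e} {X Y : (cellSubrep k L).obj j} (f : X ⟶ Y) :
    underlying X ⟶ underlying Y :=
  InducedCategory.Hom.hom f

/-- Evaluation at `S` with values in `C`. -/
abbrev evalFunctor (j : ProjTwoCat k e) : (cellSubrep k L).obj j ⥤ C where
  obj X := (underlying X).obj.obj S
  map f := (underlyingHom f).hom.app S
  map_id _ := rfl
  map_comp _ _ := rfl

variable (hproj : ∀ (j : ProjTwoCat k e) (X : (cellSubrep k L).obj j),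
  Projective ((underlying X).obj.obj S))
variable (I : TwoRep.StableIdeal (cellSubrep k L))
variable (hI : ∀ (j : ProjTwoCat k e) (X Y : (cellSubrep k L).obj j) (f : X ⟶ Y),
  f ∈ I.carrier X Y → (underlyingHom f).hom.app S = 0)

/-- The functor induced by evaluation at `S` on the quotient by an ideal of morphisms which vanish
at `S`. -/
def quotEval (j : ProjTwoCat k e) : I.Quot j ⥤ (naturalAction k e).obj j :=
  CategoryTheory.Quotient.lift (I.rel j)
    (ObjectProperty.lift (fun X : C => Projective X) (evalFunctor S j) (hproj j))
    fun X Y f g h => by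
      apply ObjectProperty.hom_ext
      have h1 := hI j X Y _ h
      change (underlyingHom f).hom.app S - (underlyingHom g).hom.app S = 0 at h1
      exact sub_eq_zero.1 h1

/-- Evaluation at `S` as a strong transformation. -/
def evalTrans : I.quotient.toPseudofunctor.StrongTrans (naturalAction k e).toPseudofunctor where
  app j := (quotEval S hproj I hI j).toCatHom
  -- Both sides send `X` to `F(X(S))` on the nose, so the comparison isomorphisms are identities.
  naturality {j j'} F := Cat.Hom.isoMk (NatIso.ofComponents (fun X => Iso.refl _) (by
    rintro X Y ⟨f⟩
    apply ObjectProperty.hom_ext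
    let t : (underlying X.as).obj.obj S ⟶ (underlying Y.as).obj.obj S := (underlyingHom f).hom.app S
    change F.obj.map t ≫ 𝟙 _ = 𝟙 _ ≫ F.obj.map t
    simp))
  naturality_naturality {j j' F G} η := by
    apply Cat.Hom₂.ext
    apply NatTrans.ext
    funext X
    apply ObjectProperty.hom_ext
    exact (Category.comp_id _).trans (Category.id_comp _).symm
  naturality_id j := by
    apply Cat.Hom₂.ext
    apply NatTrans.ext
    funext X
    apply ObjectProperty.hom_ext
    change 𝟙 (X.as.obj.obj.obj S) ≫ 𝟙 _ = 𝟙 _ ≫ 𝟙 _ ≫ 𝟙 _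
    simp
  naturality_comp {j j' j''} F G := by
    apply Cat.Hom₂.ext
    apply NatTrans.ext
    funext X
    apply ObjectProperty.hom_ext
    change 𝟙 (G.obj.obj (F.obj.obj (X.as.obj.obj.obj S))) ≫ 𝟙 _ =
      𝟙 _ ≫ 𝟙 _ ≫ 𝟙 _ ≫ 𝟙 _ ≫ G.obj.map (𝟙 _) ≫ 𝟙 _
    simp

end Evaluation

/-- Evaluation of `1`-morphisms at an object. -/
def evaluationAt (a b : ProjTwoCat k e) (S : C) : (a ⟶ b) ⥤ C where
  obj F := F.obj.obj S
  map f := f.hom.app S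
  map_id _ := rfl
  map_comp _ _ := rfl

instance (a b : ProjTwoCat k e) (S : C) : (evaluationAt a b S).Additive where
  map_add := rfl

/-- The ideal of morphisms vanishing at `S`. -/
def vanishingIdeal {i : ProjTwoCat k e} (L : ∀ j : ProjTwoCat k e, Set (i ⟶ j)) (S : C) :
    TwoRep.StableIdeal (cellSubrep k L) where
  carrier X Y :=
    { carrier := {f | (underlyingHom f).hom.app S = 0}
      add_mem' := fun {f g} hf hg => by
        change (underlyingHom f).hom.app S + (underlyingHom g).hom.app S = 0
        rw [Set.mem_ofPred_eq] at hf hg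
        rw [hf, hg, add_zero]
      zero_mem' := rfl
      smul_mem' := fun c f hf => by
        change c • (underlyingHom f).hom.app S = 0
        rw [Set.mem_ofPred_eq] at hf
        rw [hf, smul_zero] }
  comp_mem f g hf := by
    change (underlyingHom f).hom.app S ≫ (underlyingHom g).hom.app S = 0
    have hf' : (underlyingHom f).hom.app S = 0 := hf
    rw [hf', Limits.zero_comp]
  mem_comp f g hg := by
    change (underlyingHom f).hom.app S ≫ (underlyingHom g).hom.app S = 0
    have hg' : (underlyingHom g).hom.app S = 0 := hg
    rw [hg', Limits.comp_zero]
  act_mem F X Y f hf := by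
    change F.obj.map ((underlyingHom f).hom.app S) = 0
    have hf' : (underlyingHom f).hom.app S = 0 := hf
    have := F.property.additive
    rw [hf', Functor.map_zero]

/-! ### The maximal ideal and the cell 2-representation -/

section Cell

variable {L : ∀ j : ProjTwoCat k e, Set ((star : ProjTwoCat k e) ⟶ j)}
variable {V W : (star : ProjTwoCat k e) ⟶ star} {S : C}

theorem vanishingIdeal_isProper (hE : IsEvaluationPair V W S)
    (hV : addClosure (fun F => ∃ (j₀ : ProjTwoCat k e), ∃ G ∈ L j₀, LeftGE F G) V) :
    (vanishingIdeal L S).IsProper := by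
  let X : (cellSubrep k L).obj star := ⟨V, hV⟩
  refine ⟨star, X, X, 𝟙 X, fun h => hE.not_isZero ?_⟩
  rw [Limits.IsZero.iff_id_eq_zero]
  exact h

/-- An element of `I` not vanishing at `S` has a matrix entry on `V` with the same property.
Contraction puts the identity of `V` into `I`, and every morphism factors through copies of `V`, so
`I` would not be proper. -/
theorem le_vanishingIdeal (hE : IsEvaluationPair V W S)
    (hV : addClosure (fun F => ∃ (j₀ : ProjTwoCat k e), ∃ G ∈ L j₀, LeftGE F G) V)
    (hL : ∀ F : (star : ProjTwoCat k e) ⟶ star,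
      addClosure (fun F => ∃ (j₀ : ProjTwoCat k e), ∃ G ∈ L j₀, LeftGE F G) F →
        addClosure (fun G => G = V) F)
    {I : TwoRep.StableIdeal (cellSubrep k L)} (hI : I.IsProper) {j : ProjTwoCat k e}
    (X Y : (cellSubrep k L).obj j) : I.carrier X Y ≤ (vanishingIdeal L S).carrier X Y := by
  intro f hf
  by_contra hf0
  cases j
  let V' : (cellSubrep k L).obj star := ⟨V, hV⟩
  obtain ⟨r, s, hrs⟩ := addClosure_exists_map_ne_zero (evaluationAt star star S)
    (hL _ X.property) (hL _ Y.property) (f := underlyingHom f) hf0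
  let r' : V' ⟶ X := ObjectProperty.homMk r
  let s' : Y ⟶ V' := ObjectProperty.homMk s
  have hg : r' ≫ f ≫ s' ∈ I.carrier V' V' := I.mem_comp _ _ (I.comp_mem _ _ hf)
  obtain ⟨u, v, huv⟩ := hE.contraction (r ≫ underlyingHom f ≫ s) hrs
  let u' : V' ⟶ ((cellSubrep k L).act W).obj V' := ObjectProperty.homMk u
  let v' : ((cellSubrep k L).act W).obj V' ⟶ V' := ObjectProperty.homMk v
  -- Stability enters here: `I` contains the image of the matrix entry under the action of `W`, and
  -- the contraction turns it into the identity.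
  have h1 : 𝟙 V' ∈ I.carrier V' V' := by
    have h2 : u' ≫ ((cellSubrep k L).act W).map (r' ≫ f ≫ s') ≫ v' = 𝟙 V' :=
      ObjectProperty.hom_ext _ huv
    rw [← h2]
    exact I.mem_comp _ _ (I.comp_mem _ _ (I.act_mem W _ hg))
  obtain ⟨j, Z, Z', g, hg'⟩ := hI
  apply hg'
  cases j
  -- The identity of `Z` is a sum of maps through `V`, so it lies in `I` together with the identity
  -- of `V`.
  obtain ⟨n, Y, s, r, hY, h⟩ := hL _ Z.property
  obtain rfl : Y = fun _ => V := funext hY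
  let s' : ∀ t, Z ⟶ V' := fun t => ObjectProperty.homMk (s t)
  let r' : ∀ t, V' ⟶ Z := fun t => ObjectProperty.homMk (r t)
  have h3 : ∑ t, s' t ≫ r' t = 𝟙 Z := by
    apply ObjectProperty.hom_ext
    refine Eq.trans ?_ h
    exact map_sum (AddMonoidHom.mk' (fun η : Z ⟶ Z => underlyingHom η) fun _ _ => rfl) _ _
  rw [← Category.id_comp g, ← h3, Preadditive.sum_comp]
  refine Submodule.sum_mem _ fun t _ => ?_
  rw [Category.assoc, ← Category.id_comp (r' t ≫ g)]
  exact I.mem_comp _ _ (I.comp_mem _ _ h1)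

/-- The sum of all proper stable ideals is the ideal of morphisms vanishing at `S`, so evaluation is
faithful on the quotient; fullness and essential surjectivity come from the evaluation pair. -/
theorem cellTwoRep_equivalent (hE : IsEvaluationPair V W S)
    (hV : addClosure (fun F => ∃ (j₀ : ProjTwoCat k e), ∃ G ∈ L j₀, LeftGE F G) V)
    (hL : ∀ F : (star : ProjTwoCat k e) ⟶ star,
      addClosure (fun F => ∃ (j₀ : ProjTwoCat k e), ∃ G ∈ L j₀, LeftGE F G) F →
        addClosure (fun G => G = V) F) :
    (cellTwoRep k L).Equivalent (naturalAction k e) := by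
  let I := TwoRep.StableIdeal.sum {I : TwoRep.StableIdeal (cellSubrep k L) | I.IsProper}
  -- One inclusion is maximality of the vanishing ideal, the other its properness.
  have hI : ∀ (j : ProjTwoCat k e) (X Y : (cellSubrep k L).obj j) (f : X ⟶ Y),
      f ∈ I.carrier X Y ↔ (underlyingHom f).hom.app S = 0 := fun j X Y f =>
    ⟨fun hf => (iSup₂_le fun I hI => le_vanishingIdeal hE hV hL hI X Y :
        I.carrier X Y ≤ (vanishingIdeal L S).carrier X Y) hf,
      fun hf => (le_iSup₂_of_le (vanishingIdeal L S) (vanishingIdeal_isProper hE hV) le_rfl :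
        (vanishingIdeal L S).carrier X Y ≤ I.carrier X Y) hf⟩
  have hproj : ∀ (j : ProjTwoCat k e) (X : (cellSubrep k L).obj j),
      Projective ((underlying X).obj.obj S) := by
    rintro ⟨⟩ X
    exact addClosure_projective (evaluationAt star star S) hE.projective (hL _ X.property)
  refine ⟨evalTrans S hproj I fun j X Y f => (hI j X Y f).1, fun j => ?_⟩
  let Φ := quotEval S hproj I (fun j X Y f => (hI j X Y f).1) j
  have hadd : Φ.Additive := ⟨by rintro X Y ⟨f⟩ ⟨g⟩; rfl⟩
  have hlin : Φ.Linear k := ⟨by rintro X Y ⟨f⟩ c; rfl⟩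
  have hfaith : Φ.Faithful := ⟨by
    rintro X Y ⟨f⟩ ⟨g⟩ h
    refine CategoryTheory.Quotient.sound (I.rel j) ?_
    refine (hI j X.as Y.as (f - g)).2 ?_
    have h1 : (underlyingHom f).hom.app S = (underlyingHom g).hom.app S :=
      congrArg (fun t => t.hom) h
    exact sub_eq_zero.2 h1⟩
  have hfull : Φ.Full := ⟨by
    cases j
    intro X Y h
    obtain ⟨η, hη⟩ := addClosure_map_surjective (evaluationAt star star S) hE.full
      (hL _ X.as.property) (hL _ Y.as.property) h.hom
    let η' : X.as ⟶ Y.as := ObjectProperty.homMk η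
    exact ⟨(I.proj _).map η', ObjectProperty.hom_ext _ hη⟩⟩
  have hess : Φ.EssSurj := ⟨by
    cases j
    intro P
    obtain ⟨F, hF, ⟨φ⟩⟩ := hE.essSurj P.obj P.property
    let X : (cellSubrep k L).obj star := ⟨F, addClosure_trans (by rintro _ rfl; exact hV) hF⟩
    exact ⟨(I.proj _).obj X, ⟨ObjectProperty.isoMk _ φ⟩⟩⟩
  exact ⟨hadd, hlin, { faithful := hfaith, full := hfull, essSurj := hess }⟩

end Cell

end ProjTwoCat

/-! ### Cells, and the conclusion -/

theorem LeftGE.refl {B : Type u₁} [Bicategory.{w₁, v₁} B] {a b : B} (F : a ⟶ b) : LeftGE F F :=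
  ⟨𝟙 b, ⟨Retract.ofIso (ρ_ F).symm⟩⟩

theorem TwoSidedGE.of_iso {B : Type u₁} [Bicategory.{w₁, v₁} B] {a a' b b' : B} {F F' : a ⟶ b}
    {G G' : a' ⟶ b'} (φ : F ≅ F') (ψ : G ≅ G') (h : TwoSidedGE F G) : TwoSidedGE F' G' := by
  obtain ⟨K, H, ⟨R⟩⟩ := h
  exact ⟨K, H, ⟨(Retract.ofIso φ.symm).trans (R.trans
    (Retract.ofIso (whiskerLeftIso K (whiskerRightIso ψ H))))⟩⟩

/-- Turns the absence of the identity from the cell into the absence of every 1-morphism isomorphic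
to it. -/
theorem IsTwoSidedCell.mem_of_iso {B : Type u₁} [Bicategory.{w₁, v₁} B]
    [∀ a b : B, Preadditive (a ⟶ b)] {J : ∀ a b : B, Set (a ⟶ b)} (hJ : IsTwoSidedCell J)
    {a b : B} {F G : a ⟶ b} (φ : F ≅ G) (hF : F ∈ J a b) : G ∈ J a b := by
  obtain ⟨i₀, j₀, G₀, -, h⟩ := hJ
  rw [h] at hF ⊢
  exact ⟨hF.1.of_iso φ, hF.2.1.of_iso φ (Iso.refl _), hF.2.2.of_iso (Iso.refl _) φ⟩

end

theorem proposition8p1 {k : Type v} [Field k] [IsAlgClosed k]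
    {A : Type u} [Ring A] [Algebra k A] [FiniteDimensional k A]
    (hconn : IsConnectedAlgebra A) (hbasic : IsBasicAlgebra k A)
    {C : Type w} [SmallCategory C] [Preadditive C] [Linear k C]
    (e : C ≌ FGModuleCat.{u} A) [e.functor.Additive] [e.functor.Linear k]
    (J' : ∀ a b : ProjTwoCat k e, Set (a ⟶ b)) (hJ : IsTwoSidedCell J')
    (hid : ∀ a : ProjTwoCat k e, 𝟙 a ∉ J' a a)
    (i : ProjTwoCat k e) (L' : ∀ j : ProjTwoCat k e, Set (i ⟶ j))
    (hL : IsLeftCell L') (hLJ : ∀ j : ProjTwoCat k e, L' j ⊆ J' i j) :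
    (cellTwoRep k L').Equivalent (ProjTwoCat.naturalAction k e) := by
  cases i
  obtain ⟨⟨⟩, G₀, hG₀, hL⟩ := hL
  have hmem : G₀ ∈ L' .star := (hL _ _).2 ⟨hG₀, LeftGE.refl _, LeftGE.refl _⟩
  obtain ⟨V, W, S, hE, hVH, ⟨R₁⟩, ⟨R₂⟩⟩ := ProjTwoCat.exists_isEvaluationPair hconn hbasic hG₀
    ⟨fun φ => hid _ (hJ.mem_of_iso φ (hLJ _ hmem))⟩
  refine ProjTwoCat.cellTwoRep_equivalent hE ?_ fun F hF => addClosure_trans ?_ hF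
  -- `V` is a summand of `W ∘ G₀`, so it lies above the left cell.
  · exact ⟨1, fun _ => V, fun _ => 𝟙 V, fun _ => 𝟙 V, fun _ => ⟨_, G₀, hmem, W, ⟨R₂⟩⟩, by simp⟩
  -- Conversely `F` is a summand of `H ∘ G`, `G` of `H' ∘ G₀`, and `G₀` of `V`; hence `F` is a
  -- summand of `H ∘ H' ∘ V`, which is in the additive closure of `V`.
  · rintro F ⟨⟨⟩, G, hG, H, ⟨R⟩⟩
    obtain ⟨-, ⟨H', ⟨R'⟩⟩, -⟩ := (hL _ _).1 hG
    have R₃ : Retract F (V ≫ H' ≫ H) := ((R.trans (R'.map (postcomp _ H))).trans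
      ((R₁.map (postcomp _ H')).map (postcomp _ H))).trans (Retract.ofIso (α_ V H' H))
    exact addClosure_of_retract R₃ (hVH _)
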